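/- Let $n\ge 3$. There are infinitely many primes $p\equiv 4n+1 \pmod{8n}$. Let $p$ be any such prime, let $G=PGL_2(p)$, and let $H=L_2(p)\le G$ be the image of $SL_2(p)$; it is the unique subgroup of index $2$ in $G$. There are elements $d\in\mathbb F_p^*$ of multiplicative order $4n$; fix any such $d$. (i) Let $X=\begin{pmatrix}a&b\\ c&-a\end{pmatrix}\in GL_2(p)$ and $Y=\begin{pmatrix}d&0\\0&1/d\end{pmatrix}$. Then the images $x,y$ of $X,Y$ in $G$ have orders $2$ and $2n$, $y\in H$, and $x\in G\setminus H$ if $a^2+bc$ is a non-square in $\mathbb F_p$. (ii) There are $a,b,c\in\mathbb F_p$ with $a\ne 0$ and $a^{-2}bc+d+d^{-1}=1$. For any such $a,b,c$ we have $bc\neq 0$, $a^2+bc$ is a non-square (so $X$ is invertible and $x\notin H$), and if $z$ is the image of $Z=(XY)^{-1}$ in $G$, then $x,y,z$ have orders $2,2n,4n$, $xyz=1$, $H=\langle y,z^2\rangle$ and $G=\langle y,z\rangle$. (iii) Let $a,b,c$ be as in (ii). Let $\Delta^*=\Delta(2,2n,4n)=\langle u,v,w\mid u^2=v^{2n}=w^{4n}=uvw=1\rangle$,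 and let $\Delta_0,\Delta_1,\Delta_2$ be the subgroups of index $2$ in $\Delta^*$ that contain $u$, $v$, $w$ respectively, together with the squares of the other two generators. Let $\theta:\Delta^*\to G$ be the epimorphism sending $u,v,w$ to $x,y,z$, and let $L=\ker\theta$. Then $L\le\Delta_1$ and $K:=\Delta_0\cap L=\Delta_2\cap L$ is a normal subgroup of $\Delta^*$ contained in $\Delta_1$ and $\Delta_2$. Let ${\mathcal H}_1$ be the hypermap consisting of the permutations of the finite set $\Delta_1/K$ given by right multiplication by (the cosets of) $uvu^{-1}$ and $v$, and let ${\mathcal H}_2$ be the hypermap consisting of the permutations of the finite set $\Delta_2/K$ given by right multiplication by $v^2$ and $w$. These are regular dessins of types $(2n,2n,2n)$ and $(n,4n,4n)$ with non-isomorphic automorphism groups $$\mathrm{Aut}\,{\mathcal H}_1\cong L_2(p)\times C_2,\qquad \mathrm{Aut}\,{\mathcal H}_2\cong PGL_2(p),$$ and they lie on the same compact Riemann surface: there are a compact connected Riemann surface $S$ and Belyi functions $\beta_1,\beta_2:S\to\mathbb P^1(\mathbb C)$ (non-constant holomorphic maps, unramified outside $\{0,1,\infty\}$) such that the two permutations of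 ${\mathcal H}_i$ are the monodromy permutations of $\beta_i$ at $0$ and at $1$. If $n=3$ and $p=13$, both dessins have genus $547$. Here a hypermap is a pair of permutations $\sigma,\tau$ of a finite set $\Omega$ generating a transitive group; its automorphism group is the centraliser of $\langle \sigma,\tau\rangle$ in $\mathrm{Sym}(\Omega)$; it is a regular dessin if this centraliser is transitive; its type consists of the orders of $\sigma$, $\tau$ and $(\sigma\tau)^{-1}$; its genus $g$ is given by $2-2g=\#\mathrm{cyc}(\sigma)+\#\mathrm{cyc}(\tau)+\#\mathrm{cyc}(\sigma\tau)-|\Omega|$. -/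

import Mathlib

open scoped MatrixGroups Manifold ContDiff

noncomputable section

/-! ### The groups -/

/-- The subgroup `L₂(p)` of `PGL₂(p)`: the image of `PSL₂(p)` under the natural inclusion. -/
def L2 (p : ℕ) [Fact p.Prime] : Subgroup PGL(2, ZMod p) :=
  (Matrix.ProjectiveSpecialLinearGroup.toPGL (n := Fin 2) (R := ZMod p)).range

/-- The relators `u ^ l, v ^ m, w ^ n, u v w` in the free group on three letters. -/
def triangleRels (l m n : ℕ) : Set (FreeGroup (Fin 3)) :=
  {FreeGroup.of 0 ^ l, FreeGroup.of 1 ^ m, FreeGroup.of 2 ^ n,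
    FreeGroup.of 0 * FreeGroup.of 1 * FreeGroup.of 2}

/-- The triangle group `Δ(l, m, n) = ⟨u, v, w | u ^ l = v ^ m = w ^ n = u v w = 1⟩`. -/
abbrev TriangleGroup (l m n : ℕ) : Type := PresentedGroup (triangleRels l m n)

namespace TriangleGroup

variable {l m n : ℕ}

/-- The first canonical generator. -/
def u : TriangleGroup l m n := PresentedGroup.of 0

/-- The second canonical generator. -/
def v : TriangleGroup l m n := PresentedGroup.of 1

/-- The third canonical generator. -/
def w : TriangleGroup l m n := PresentedGroup.of 2

/-- For even `l, m, n`, the subgroup of index two of `Δ(l, m, n)` that contains the first canonical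
generator and the squares of the other two. -/
abbrev Delta0 : Subgroup (TriangleGroup l m n) :=
  Subgroup.normalClosure {u, v ^ 2, w ^ 2}

/-- For even `l, m, n`, the subgroup of index two of `Δ(l, m, n)` that contains the second canonical
generator and the squares of the other two. -/
abbrev Delta1 : Subgroup (TriangleGroup l m n) :=
  Subgroup.normalClosure {v, u ^ 2, w ^ 2}

/-- For even `l, m, n`, the subgroup of index two of `Δ(l, m, n)` that contains the third canonical
generator and the squares of the other two. -/
abbrev Delta2 : Subgroup (TriangleGroup l m n) :=
  Subgroup.normalClosure {w, u ^ 2, v ^ 2}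

end TriangleGroup

/-! ### Hypermaps -/

/-- A (finite, oriented) hypermap on the set `Ω`: an ordered pair of permutations generating a
finite transitive permutation group. -/
structure Hypermap (Ω : Type) where
  x : Equiv.Perm Ω
  y : Equiv.Perm Ω
  finite : Finite Ω
  nonempty : Nonempty Ω
  transitive : ∀ e f : Ω, ∃ g ∈ Subgroup.closure {x, y}, g e = f

namespace Hypermap

variable {Ω : Type} (ℋ : Hypermap Ω)

/-- The third permutation `z = (xy)⁻¹`. Products of permutations in `xyz = 1` are read from left to
right, i.e. `xy` means "first `x`, then `y`", which is `y * x` in Lean. -/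
def z : Equiv.Perm Ω := (ℋ.y * ℋ.x)⁻¹

/-- The automorphism group: the centraliser in `Sym Ω` of the monodromy group `⟨x, y⟩`. -/
def Aut : Subgroup (Equiv.Perm Ω) :=
  Subgroup.centralizer (Subgroup.closure {ℋ.x, ℋ.y} : Set (Equiv.Perm Ω))

/-- A hypermap is (orientably) regular if its automorphism group is transitive. -/
def IsRegular : Prop := ∀ e f : Ω, ∃ g ∈ ℋ.Aut, g e = f

/-- The type of a regular hypermap: the orders of `x`, `y` and `z`. -/
def HasType (l m n : ℕ) : Prop :=
  orderOf ℋ.x = l ∧ orderOf ℋ.y = m ∧ orderOf ℋ.z = n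

/-- The number of cycles of a permutation, fixed points included. -/
def numCycles (σ : Equiv.Perm Ω) : ℕ := Nat.card (Quotient (Equiv.Perm.SameCycle.setoid σ))

/-- The genus `g` of (the underlying surface of) a hypermap: the cell decomposition given by its
Walsh map has the cycles of `x` and `y` as vertices, the points of `Ω` as edges, and the cycles of
`z` as faces, and `2 - 2g` is its Euler characteristic. -/
def HasGenus (g : ℕ) : Prop :=
  (numCycles ℋ.x : ℤ) + numCycles ℋ.y - Nat.card Ω + numCycles ℋ.z = 2 - 2 * g

/-- `ℋ` is the regular hypermap on `D ⧸ K` given by a normal subgroup `K` and elements `s, t` of a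
subgroup `D ≥ K`: the permutations `x` and `y` are multiplication by the cosets of `s` and `t`.
When `(s, t, (st)⁻¹)` is a canonical generating triple of the triangle group `D`, this is the
dessin corresponding to the normal inclusion of `K` in `D`. -/
def IsGivenBy {Γ : Type} [Group Γ] {D K : Subgroup Γ} [K.Normal]
    (ℋ : Hypermap (D ⧸ K.subgroupOf D)) (s t : Γ) : Prop :=
  ∃ (hs : s ∈ D) (ht : t ∈ D),
    (∀ q, ℋ.x q = q * QuotientGroup.mk ⟨s, hs⟩) ∧ (∀ q, ℋ.y q = q * QuotientGroup.mk ⟨t, ht⟩)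

end Hypermap

/-! ### Riemann surfaces, Belyi functions and dessins -/

/-- A compact (connected) Riemann surface. -/
def IsCompactRiemannSurface (S : Type) [TopologicalSpace S] [ChartedSpace ℂ S] : Prop :=
  T2Space S ∧ CompactSpace S ∧ ConnectedSpace S ∧ IsManifold 𝓘(ℂ) ω S

/-- The standard coordinate `w` on the part `ℂ` of the Riemann sphere `OnePoint ℂ`
(with an irrelevant value at `∞`). -/
def affineCoord : OnePoint ℂ → ℂ
  | none => 0
  | some w => w

/-- The coordinate `1 / w` on the part `(ℂ ∖ {0}) ∪ {∞}` of the Riemann sphere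
(with an irrelevant value at `0`). -/
def coordAtInfinity : OnePoint ℂ → ℂ
  | none => 0
  | some w => w⁻¹

/-- Holomorphic maps from a Riemann surface to the Riemann sphere. -/
def IsHolomorphicToSphere {S : Type} [TopologicalSpace S] [ChartedSpace ℂ S]
    (β : S → OnePoint ℂ) : Prop :=
  Continuous β ∧
  (∀ P, β P ≠ OnePoint.infty → MDifferentiableAt 𝓘(ℂ) 𝓘(ℂ) (affineCoord ∘ β) P) ∧
  (∀ P, β P ≠ ((0 : ℂ) : OnePoint ℂ) → MDifferentiableAt 𝓘(ℂ) 𝓘(ℂ) (coordAtInfinity ∘ β) P)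

/-- Belyi functions: non-constant holomorphic maps to the Riemann sphere that are unramified
outside `{0, 1, ∞}`. -/
def IsBelyi {S : Type} [TopologicalSpace S] [ChartedSpace ℂ S] (β : S → OnePoint ℂ) : Prop :=
  IsHolomorphicToSphere β ∧ (∃ P Q, β P ≠ β Q) ∧
  ∀ P, β P ≠ ((0 : ℂ) : OnePoint ℂ) → β P ≠ ((1 : ℂ) : OnePoint ℂ) → β P ≠ OnePoint.infty →
    mfderiv 𝓘(ℂ) 𝓘(ℂ) (affineCoord ∘ β) P ≠ 0

/-- The hypermap `ℋ` is the dessin on the Riemann surface `S` with Belyi function `β`: the set `Ω`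
is identified with the fibre of `β` over the base point `1/2` (equivalently with the set of edges
of the bipartite map `β⁻¹[0, 1]`) so that `x` and `y` are the monodromy permutations of `β` at `0`
and `1`, obtained by lifting the positively oriented circles through `1/2` centred at these
points. -/
def IsDessinOn {S : Type} [TopologicalSpace S] [ChartedSpace ℂ S] (β : S → OnePoint ℂ)
    {Ω : Type} (ℋ : Hypermap Ω) : Prop :=
  IsBelyi β ∧ ∃ φ : Ω ≃ {P : S // β P = ((1 / 2 : ℂ) : OnePoint ℂ)}, ∀ e : Ω,
    (∃ γ : C(unitInterval, S), γ 0 = φ e ∧ γ 1 = φ (ℋ.x e) ∧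
      ∀ t : unitInterval, β (γ t) =
        ((1 / 2 * Complex.exp (2 * Real.pi * Complex.I * ((t : ℝ) : ℂ)) : ℂ) : OnePoint ℂ)) ∧
    (∃ γ : C(unitInterval, S), γ 0 = φ e ∧ γ 1 = φ (ℋ.y e) ∧
      ∀ t : unitInterval, β (γ t) =
        ((1 - 1 / 2 * Complex.exp (2 * Real.pi * Complex.I * ((t : ℝ) : ℂ)) : ℂ) : OnePoint ℂ))

end

noncomputable section

/-! ### The sphere with four marked points `0, 1, ∞, -1` -/

namespace FourPoint

open Complex Set Filter Topology

/-! Everything on the topological side follows from one covering. The group `Δ1 ∩ Δ2` has index four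
in the triangle group and is mapped onto `H`, the subgroup of index two in `G`. Hence the surface
belonging to `K` is an `H`-covering of a sphere branched over four points, placed here at `0, 1, ∞,
-1`. The extensions of `Δ1 ∩ Δ2` to `Δ1` and to `Δ2` are two different double coverings of spheres,
`h ↦ -(h - 1)² / (4h)` and `h ↦ 1 - h²`, and the two Belyi functions are the compositions.
Algebraically, `Δ2 / K` is `G`, because `θ` restricted to `Δ2` is still onto, while `Δ1 / K` is `H ×
C2`, because `θ` and the sign character with kernel `Δ2` are independent on `Δ1`. The groups differ
because `PGL₂(p)` has trivial centre.

The surface is built by hand from two half-planes for each element of the group, glued along the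
four real intervals between marked points. Its charts are centred over the marked points and written
with logarithmic coordinates; the heart of their compatibility is `eventually_label`, which says
that the change of half-plane across the real line does not depend on the chart. The monodromy is
then read off from explicit lifts of the two circles through `1/2`, and the labels at the ends of
these lifts are compared with right multiplications in the group (`isDessinOn1`, `isDessinOn2`).

On the arithmetical side `p - 1` is `4n` times an odd number, so `d` is a non-square while `-1` is a
square. The relation between `a, b, c, d` makes `a² + bc` equal to minus a square divided by `d`,
hence a non-square, and gives `XY` eigenvalues of ratio `d`, hence order `4n` in `PGL₂(p)`.

Generation avoids the classification of subgroups. Let `J` contain the diagonal `y` and `z²`. If `p`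
divides the order of `J`, then `J` contains a conjugate of a transvection and fixes no point of the
projective line, so it contains `L₂(p)`. Otherwise every non-trivial element has exactly two fixed
points on the projective line over the quadratic extension, and counting orbits as for finite
rotation groups (`le_two_of_sum`) shows that a stabiliser of order at least six has an orbit of at
most two points. Here `0` has such a stabiliser and at least three images. -/

/-- The plane slit along the real rays `(-∞, -1]` and `[1, ∞)`. -/
def slit : Set ℂ := {t | t.im = 0 → |t.re| < 1}

/-- A compact region inside the slit plane, the images of which under the rotations of the sphere
that permute the marked points cover the sphere. -/
def cap : Set ℂ := {t | normSq t + 2 * |t.re| ≤ 1}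

/-- The points of the sphere that are not marked. -/
def base : Set ℂ := {h | h ≠ 0 ∧ h ≠ 1 ∧ h ≠ -1}

/-- The numerator of the rotation of the sphere that takes `0` to the `j`-th marked point. -/
def num (j : Fin 4) (t : ℂ) : ℂ := ![t, 1 + t, 1, t - 1] j

/-- The denominator of the rotation of the sphere that takes `0` to the `j`-th marked point. -/
def den (j : Fin 4) (t : ℂ) : ℂ := ![1, 1 - t, -t, t + 1] j

/-- The rotation of the sphere that takes `0` to the `j`-th marked point. -/
def moeb (j : Fin 4) (t : ℂ) : ℂ := num j t / den j t

/-- The inverse of `moeb j`, a local parameter at the `j`-th marked point. -/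
def coord (j : Fin 4) (h : ℂ) : ℂ := ![h, (h - 1) / (h + 1), -1 / h, (1 + h) / (1 - h)] j

lemma isOpen_slit : IsOpen slit := by
  have : slit = {t : ℂ | t.im = 0 ∧ 1 ≤ |t.re|}ᶜ := by
    ext t; simp [slit]
  rw [this, isOpen_compl_iff]
  exact (isClosed_eq continuous_im continuous_const).inter
    (isClosed_le continuous_const continuous_re.abs)

lemma zero_mem_slit : (0 : ℂ) ∈ slit := by simp [slit]

lemma I_mem_slit : I ∈ slit := by simp [slit]

lemma ne_one_of_mem_slit {t : ℂ} (h : t ∈ slit) : t ≠ 1 := by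
  rintro rfl; simp [slit] at h

lemma ne_neg_one_of_mem_slit {t : ℂ} (h : t ∈ slit) : t ≠ -1 := by
  rintro rfl; simp [slit] at h

lemma smul_mem_slit {t : ℂ} (h : t ∈ slit) {s : ℝ} (hs0 : 0 ≤ s) (hs1 : s ≤ 1) :
    (s : ℂ) * t ∈ slit := by
  intro him
  simp only [mul_im, ofReal_re, ofReal_im, zero_mul, add_zero, mul_eq_zero, mul_re,
    sub_zero] at him ⊢
  rcases him with rfl | him
  · simp
  · have := h him
    rw [abs_mul, abs_of_nonneg hs0]
    nlinarith [abs_nonneg t.re]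

lemma cap_subset_slit : cap ⊆ slit := by
  intro t ht him
  simp only [cap, mem_ofPred_eq, normSq_apply, him, mul_zero, add_zero] at ht
  nlinarith [abs_nonneg t.re, mul_self_nonneg t.re]

lemma isCompact_cap : IsCompact cap := by
  refine (isCompact_closedBall (0 : ℂ) 1).of_isClosed_subset ?_ ?_
  · exact isClosed_le (by fun_prop) continuous_const
  · intro t ht
    simp only [cap, mem_ofPred_eq, normSq_eq_norm_sq] at ht
    rw [mem_closedBall_zero_iff]
    nlinarith [abs_nonneg t.re, norm_nonneg t]

lemma differentiable_num (j : Fin 4) : Differentiable ℂ (num j) := by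
  fin_cases j
  · exact differentiable_id
  · exact differentiable_id.const_add 1
  · exact differentiable_const _
  · exact differentiable_id.sub_const 1

lemma differentiable_den (j : Fin 4) : Differentiable ℂ (den j) := by
  fin_cases j
  · exact differentiable_const _
  · exact differentiable_id.const_sub 1
  · exact differentiable_id.neg
  · exact differentiable_id.add_const 1

lemma num_ne_zero_or_den_ne_zero (j : Fin 4) (t : ℂ) : num j t ≠ 0 ∨ den j t ≠ 0 := by
  by_contra! h
  obtain ⟨h1, h2⟩ := h
  fin_cases j <;> simp [num, den] at h1 h2 <;> grind

lemma den_ne_zero (j : Fin 4) {t : ℂ} (ht : t ∈ slit) (h0 : t ≠ 0) : den j t ≠ 0 := by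
  have h1 := ne_one_of_mem_slit ht
  have h2 := ne_neg_one_of_mem_slit ht
  fin_cases j <;> simp [den] <;> grind

lemma moeb_mem_base (j : Fin 4) {t : ℂ} (ht : t ∈ slit) (h0 : t ≠ 0) : moeb j t ∈ base := by
  have h1 := ne_one_of_mem_slit ht
  have h2 := ne_neg_one_of_mem_slit ht
  have h3 := den_ne_zero j ht h0
  refine ⟨?_, ?_, ?_⟩
  · rw [moeb, Ne, div_eq_zero_iff, not_or]
    refine ⟨?_, h3⟩
    fin_cases j <;> simp [num] <;> grind
  · rw [moeb, Ne, div_eq_one_iff_eq h3]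
    fin_cases j <;> simp [num, den] <;> grind
  · rw [moeb, Ne, div_eq_iff h3]
    fin_cases j <;> simp [num, den] <;> grind

lemma coord_moeb (j : Fin 4) {t : ℂ} (ht : t ∈ slit) (h0 : t ≠ 0) : coord j (moeb j t) = t := by
  have h3 := den_ne_zero j ht h0
  have h4 : (2 : ℂ) ≠ 0 := two_ne_zero
  fin_cases j <;> simp [num, den, moeb, coord] at h3 ⊢
  · rw [div_sub_one h3, div_add_one h3, div_div_div_cancel_right₀ h3]
    ring_nf
  · have h5 : t + 1 + (t - 1) ≠ 0 := by ring_nf; simpa using h0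
    have h6 : t + 1 - (t - 1) ≠ 0 := by ring_nf; simp
    rw [one_add_div h3, one_sub_div h3, div_div_div_cancel_right₀ h3]
    ring_nf

lemma moeb_coord (j : Fin 4) {h : ℂ} (hh : h ∈ base) : moeb j (coord j h) = h := by
  obtain ⟨h0, h1, h2⟩ := hh
  have h1' : 1 - h ≠ 0 := sub_ne_zero.2 (Ne.symm h1)
  have h2' : h + 1 ≠ 0 := fun h => h2 (eq_neg_of_add_eq_zero_left h)
  fin_cases j <;> simp [num, den, moeb, coord]
  · rw [one_add_div h2', one_sub_div h2', div_div_div_cancel_right₀ h2']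
    ring_nf
  · rw [div_neg, div_one, neg_neg]
  · rw [div_sub_one h1', div_add_one h1', div_div_div_cancel_right₀ h1']
    ring_nf

lemma coord_ne_zero (j : Fin 4) {h : ℂ} (hh : h ∈ base) : coord j h ≠ 0 := by
  obtain ⟨h0, h1, h2⟩ := hh
  have h1' : 1 - h ≠ 0 := sub_ne_zero.2 (Ne.symm h1)
  have h1'' : h - 1 ≠ 0 := sub_ne_zero.2 h1
  have h2' : h + 1 ≠ 0 := fun h => h2 (eq_neg_of_add_eq_zero_left h)
  have h2'' : 1 + h ≠ 0 := by rwa [add_comm]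
  fin_cases j <;> simp [coord, *]

lemma differentiableAt_coord (j : Fin 4) {h : ℂ} (hh : h ∈ base) :
    DifferentiableAt ℂ (coord j) h := by
  obtain ⟨h0, h1, h2⟩ := hh
  have h1' : 1 - h ≠ 0 := sub_ne_zero.2 (Ne.symm h1)
  have h2' : h + 1 ≠ 0 := fun h => h2 (eq_neg_of_add_eq_zero_left h)
  fin_cases j
  · exact differentiableAt_id
  · exact (differentiableAt_id.sub_const 1).div (differentiableAt_id.add_const 1) h2'
  · exact (differentiableAt_const _).div differentiableAt_id h0
  · exact (differentiableAt_id.const_add 1).div (differentiableAt_id.const_sub 1) h1'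

lemma differentiableAt_moeb (j : Fin 4) {t : ℂ} (ht : t ∈ slit) (h0 : t ≠ 0) :
    DifferentiableAt ℂ (moeb j) t :=
  (differentiable_num j t).div (differentiable_den j t) (den_ne_zero j ht h0)

lemma div_mem_cap {a b : ℂ} (hb : b ≠ 0)
    (h : normSq a + 2 * |a.re * b.re + a.im * b.im| ≤ normSq b) : a / b ∈ cap := by
  have hb' : 0 < normSq b := normSq_pos.2 hb
  simp only [cap, mem_ofPred_eq, map_div₀, div_re]
  rw [← add_div, abs_div, abs_of_pos hb', ← mul_div_assoc, ← add_div, div_le_one hb']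
  exact h

/-- `cap` is the intersection of the two discs `|t ± 1|² ≤ 2`, a lune with corners `±I`. The circles
`|h ± 1|² = 2` cut the sphere into four such lunes, one around each marked point; comparing `|2 Re
h|` with `||h|² - 1|` and then looking at signs tells which lune contains `h`. -/
lemma exists_coord_mem_cap {h : ℂ} (hh : h ∈ base) : ∃ j, coord j h ∈ cap := by
  obtain ⟨h0, h1, h2⟩ := hh
  have h1' : 1 - h ≠ 0 := sub_ne_zero.2 (Ne.symm h1)
  have h2' : h + 1 ≠ 0 := fun h => h2 (eq_neg_of_add_eq_zero_left h)
  rcases le_total |2 * h.re| |normSq h - 1| with hle | hle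
  · rcases le_total (normSq h - 1) 0 with hs | hs
    · refine ⟨0, ?_⟩
      rw [abs_of_nonpos hs, abs_mul, abs_two] at hle
      simp only [coord, cap, mem_ofPred_eq, Matrix.cons_val_zero]
      linarith
    · refine ⟨2, div_mem_cap h0 ?_⟩
      rw [abs_of_nonneg hs, abs_mul, abs_two] at hle
      simp
      linarith
  · rw [normSq_apply] at hle
    rcases le_total (2 * h.re) 0 with hs | hs
    · refine ⟨3, div_mem_cap h1' ?_⟩
      rw [abs_of_nonpos hs] at hle
      have e : (1 + h).re * (1 - h).re + (1 + h).im * (1 - h).im =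
        -(h.re * h.re + h.im * h.im - 1) := by simp; ring
      rw [e, abs_neg, normSq_apply, normSq_apply]
      simp
      linarith
    · refine ⟨1, div_mem_cap h2' ?_⟩
      rw [abs_of_nonneg hs] at hle
      have e : (h - 1).re * (h + 1).re + (h - 1).im * (h + 1).im =
        (h.re * h.re + h.im * h.im - 1) := by simp; ring
      rw [e, normSq_apply, normSq_apply]
      simp
      linarith

/-- The rotations are real Möbius maps of determinant `1` or `2`, so they preserve the two
half-planes. This makes "upper" and "lower" mean the same in all charts. -/
lemma moeb_im_eq (j : Fin 4) {t : ℂ} (ht : t ∈ slit) (h0 : t ≠ 0) :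
    ∃ r : ℝ, 0 < r ∧ (moeb j t).im = r * t.im := by
  have h3 := normSq_pos.2 (den_ne_zero j ht h0)
  have h4 := normSq_pos.2 h0
  fin_cases j
  · exact ⟨1, one_pos, by simp [moeb, num, den]⟩
  · refine ⟨2 / normSq (den 1 t), by positivity, ?_⟩
    simp only [moeb, num, den, div_im] at h3 ⊢
    simp
    ring
  · refine ⟨(normSq (den 2 t))⁻¹, by positivity, ?_⟩
    simp only [moeb, num, den, div_im] at h3 ⊢
    simp
    ring
  · refine ⟨2 / normSq (den 3 t), by positivity, ?_⟩
    simp only [moeb, num, den, div_im] at h3 ⊢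
    simp
    ring

lemma moeb_im_nonneg_iff (j : Fin 4) {t : ℂ} (ht : t ∈ slit) (h0 : t ≠ 0) :
    0 ≤ (moeb j t).im ↔ 0 ≤ t.im := by
  obtain ⟨r, hr, h⟩ := moeb_im_eq j ht h0
  rw [h, mul_nonneg_iff_of_pos_left hr]

/-- The index of the interval between marked points (the `j`-th one starts at the `j`-th marked
point) that contains a real number. -/
def interval (x : ℝ) : Fin 4 :=
  if x < -1 then 2 else if x < 0 then 3 else if x < 1 then 0 else 1

lemma moeb_ofReal (j : Fin 4) (x : ℝ) :
    (moeb j x).re = (![x, 1 + x, 1, x - 1] j) / (![1, 1 - x, -x, x + 1] j) := by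
  have : moeb j x = (((![x, 1 + x, 1, x - 1] j) / (![1, 1 - x, -x, x + 1] j) : ℝ) : ℂ) := by
    fin_cases j <;> simp [moeb, num, den]
  rw [this, ofReal_re]

lemma interval_moeb_of_pos (j : Fin 4) {x : ℝ} (h0 : 0 < x) (h1 : x < 1) :
    interval (moeb j x).re = j := by
  have h2 : 0 < 1 - x := by linarith
  rw [moeb_ofReal]
  fin_cases j <;> simp only [interval] <;> simp
  · grind
  · have : 1 < (1 + x) / (1 - x) := by rw [lt_div_iff₀ h2]; linarith
    grind
  · have : x⁻¹ > 1 := (one_lt_inv₀ h0).2 h1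
    grind
  · have a : -1 < (x - 1) / (x + 1) := by rw [lt_div_iff₀ (by linarith)]; linarith
    have b : (x - 1) / (x + 1) < 0 := div_neg_of_neg_of_pos (by linarith) (by linarith)
    grind

/-- The segment left of `0` ends at `0`, so its image lies in the interval that ends at the `j`-th
marked point. The subtraction in `Fin 4` wraps around, as the intervals do on the real circle. -/
lemma interval_moeb_of_neg (j : Fin 4) {x : ℝ} (h0 : x < 0) (h1 : -1 < x) :
    interval (moeb j x).re = j - 1 := by
  have h2 : 0 < 1 - x := by linarith
  have h3 : 0 < x + 1 := by linarith
  rw [moeb_ofReal]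
  fin_cases j <;> simp only [interval] <;> simp
  · rw [if_neg (by linarith), if_pos h0]; rfl
  · have a : 0 < (1 + x) / (1 - x) := div_pos (by linarith) h2
    have b : (1 + x) / (1 - x) < 1 := by rw [div_lt_one h2]; linarith
    grind
  · have : 1 < (-x)⁻¹ := (one_lt_inv₀ (by linarith)).2 (by linarith)
    rw [inv_neg] at this
    rw [if_neg (by linarith), if_neg (by linarith), if_neg (by linarith)]
  · have a : (x - 1) / (x + 1) < -1 := by rw [div_lt_iff₀ h3]; linarith
    simp [a]

end FourPoint

end

noncomputable section

/-! ### Coverings of the sphere branched over the four marked points -/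

open Complex Set Filter Topology FourPoint

/-- Gluing instructions for a covering of the sphere branched over the four marked points: `c j`
tells which lower half-plane is attached to a given upper half-plane along the `j`-th interval, and
`m j` is the ramification index over the `j`-th marked point. -/
structure GluingData (Ω : Type) where
  c : Fin 4 → Equiv.Perm Ω
  m : Fin 4 → ℕ
  m_pos : ∀ j, 0 < m j
  zpow_apply_eq_iff : ∀ (j : Fin 4) (k : ℤ) (e : Ω),
    (((c j)⁻¹ * c (j - 1)) ^ k) e = e ↔ (m j : ℤ) ∣ k

namespace GluingData

variable {Ω : Type} (D : GluingData Ω)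

/-- The permutation of the upper half-planes obtained by turning around the `j`-th marked point. -/
def rot (j : Fin 4) : Equiv.Perm Ω := (D.c j)⁻¹ * D.c (j - 1)

/-- The points of the covering surface. Points over the real line are labelled by the upper
half-plane to which they belong. -/
def Surface : Type :=
  {h : ℂ // h ∈ base} × Ω ⊕ Σ j, Quotient (Equiv.Perm.SameCycle.setoid (D.rot j))

variable {D} in
/-- The point of the half-plane `e` over an unmarked point. -/
def point (h : ℂ) (hh : h ∈ base) (e : Ω) : D.Surface := Sum.inl (⟨h, hh⟩, e)

variable {D} in
/-- The point over the `j`-th marked point on the half-plane `e`. -/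
def vertex (j : Fin 4) (e : Ω) : D.Surface := Sum.inr ⟨j, Quotient.mk _ e⟩

lemma point_eq_point {h h' : ℂ} {hh : h ∈ base} {hh' : h' ∈ base} {e e' : Ω} :
    (point h hh e : D.Surface) = point h' hh' e' ↔ h = h' ∧ e = e' := by
  constructor
  · intro h
    have h' := Sum.inl.inj h
    rw [Prod.mk.injEq, Subtype.mk.injEq] at h'
    exact h'
  · rintro ⟨rfl, rfl⟩
    rfl

lemma vertex_eq_vertex {j j' : Fin 4} {e e' : Ω} :
    (vertex j e : D.Surface) = vertex j' e' ↔ j = j' ∧ (D.rot j).SameCycle e e' := by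
  constructor
  · intro h
    have h' := Sum.inr.inj h
    rw [Sigma.mk.injEq] at h'
    obtain ⟨rfl, h'⟩ := h'
    exact ⟨rfl, Quotient.exact (eq_of_heq h')⟩
  · rintro ⟨rfl, h⟩
    have : (Quotient.mk (Equiv.Perm.SameCycle.setoid (D.rot j)) e) = Quotient.mk _ e' :=
      Quotient.sound h
    rw [vertex, vertex, this]

lemma vertex_ne_point (j : Fin 4) (e : Ω) (h : ℂ) (hh : h ∈ base) (e' : Ω) :
    (vertex j e : D.Surface) ≠ point h hh e' := Sum.inr_ne_inl

/-- The half-plane that contains the point with logarithmic coordinate `τ` near the `j`-th marked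
point. -/
def label (j : Fin 4) (e : Ω) (τ : ℂ) : Ω :=
  if 0 ≤ (exp τ).im then (D.rot j ^ ⌊τ.im / (2 * Real.pi)⌋) e
  else D.c (j - 1) ((D.rot j ^ ⌊τ.im / (2 * Real.pi)⌋) e)

/-- The inverse of the chart centred at the point over the `j`-th marked point on the half-plane
`e`. -/
def param (j : Fin 4) (e : Ω) (ζ : ℂ) : D.Surface :=
  open Classical in
  if h : ζ ^ D.m j ∈ slit ∧ ζ ^ D.m j ≠ 0 then
    point (moeb j (ζ ^ D.m j)) (moeb_mem_base j h.1 h.2) (D.label j e (D.m j * log ζ))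
  else vertex j e

/-- The domain of `param`. -/
def dom (j : Fin 4) : Set ℂ := {ζ | ζ ^ D.m j ∈ slit}

lemma isOpen_dom (j : Fin 4) : IsOpen (D.dom j) := isOpen_slit.preimage (continuous_pow _)

lemma zero_mem_dom (j : Fin 4) : (0 : ℂ) ∈ D.dom j := by
  simp [dom, (D.m_pos j).ne', zero_mem_slit]

lemma m_ne_zero (j : Fin 4) : (D.m j : ℂ) ≠ 0 := Nat.cast_ne_zero.2 (D.m_pos j).ne'

lemma exp_div_pow (j : Fin 4) (τ : ℂ) : exp (τ / D.m j) ^ D.m j = exp τ := by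
  rw [← exp_nat_mul, mul_div_cancel₀ _ (D.m_ne_zero j)]

lemma rot_zpow_eq_iff (j : Fin 4) (k : ℤ) (e : Ω) :
    (D.rot j ^ k) e = e ↔ (D.m j : ℤ) ∣ k := D.zpow_apply_eq_iff j k e

lemma floor_add_two_pi (x : ℝ) (r : ℤ) :
    ⌊(x + 2 * Real.pi * r) / (2 * Real.pi)⌋ = ⌊x / (2 * Real.pi)⌋ + r := by
  rw [add_div, mul_div_cancel_left₀ _ (by positivity), Int.floor_add_intCast]

lemma exp_add_int (τ : ℂ) (r : ℤ) : exp (τ + r * (2 * Real.pi * I)) = exp τ := by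
  rw [exp_add, exp_int_mul_two_pi_mul_I, mul_one]

/-- A full turn of the coordinate amounts to starting from another half-plane. All ambiguities of
logarithms are absorbed through this identity. -/
lemma label_add (j : Fin 4) (e : Ω) (τ : ℂ) (r : ℤ) :
    D.label j e (τ + r * (2 * Real.pi * I)) = D.label j ((D.rot j ^ r) e) τ := by
  have : (τ + r * (2 * Real.pi * I)).im = τ.im + 2 * Real.pi * r := by simp; ring
  rw [label, label, exp_add_int, this, floor_add_two_pi, zpow_add, Equiv.Perm.mul_apply]

lemma label_bijective (j : Fin 4) (τ : ℂ) : Function.Bijective fun e => D.label j e τ := by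
  unfold label
  split_ifs
  · exact (D.rot j ^ ⌊τ.im / (2 * Real.pi)⌋).bijective
  · exact (D.c (j - 1)).bijective.comp (D.rot j ^ ⌊τ.im / (2 * Real.pi)⌋).bijective

lemma param_of_mem {j : Fin 4} {ζ : ℂ} (hζ : ζ ∈ D.dom j) (h0 : ζ ≠ 0) (e : Ω) :
    D.param j e ζ = point (moeb j (ζ ^ D.m j)) (moeb_mem_base j hζ (pow_ne_zero _ h0))
      (D.label j e (D.m j * log ζ)) := by
  rw [param, dif_pos ⟨hζ, pow_ne_zero _ h0⟩]

lemma param_zero (j : Fin 4) (e : Ω) : D.param j e 0 = vertex j e := by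
  rw [param, dif_neg]
  simp [(D.m_pos j).ne']

lemma exp_div_mem_dom {j : Fin 4} {τ : ℂ} (h : exp τ ∈ slit) : exp (τ / D.m j) ∈ D.dom j := by
  rwa [dom, mem_ofPred_eq, exp_div_pow]

/-- Two logarithms of `ζ` differ by a multiple of `2πi`, so after multiplication by `m j` the number
of extra turns is a multiple of `m j`, and these turns fix every half-plane because all cycles of
`rot j` have length `m j`. Any logarithmic coordinate may therefore replace the principal one used
in `param`. -/
lemma param_exp (j : Fin 4) (e : Ω) {τ : ℂ} (h : exp τ ∈ slit) :
    D.param j e (exp (τ / D.m j)) =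
      point (moeb j (exp τ)) (moeb_mem_base j h (exp_ne_zero τ)) (D.label j e τ) := by
  rw [D.param_of_mem (D.exp_div_mem_dom h) (exp_ne_zero _)]
  have h1 : D.label j e (D.m j * log (exp (τ / D.m j))) = D.label j e τ := by
    obtain ⟨k, hk⟩ := exp_eq_exp_iff_exists_int.1 (exp_log (exp_ne_zero (τ / D.m j)))
    rw [hk, mul_add, mul_div_cancel₀ _ (D.m_ne_zero j)]
    have : τ + D.m j * (k * (2 * Real.pi * I)) =
        τ + ((D.m j * k : ℤ) : ℂ) * (2 * Real.pi * I) := by push_cast; ring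
    rw [this, label_add, (D.rot_zpow_eq_iff j _ e).2 (dvd_mul_right _ _)]
  rw [h1, point_eq_point, D.exp_div_pow j τ]
  exact ⟨rfl, rfl⟩

lemma exists_eq_exp {j : Fin 4} {ζ : ℂ} (hζ : ζ ∈ D.dom j) (h0 : ζ ≠ 0) :
    ∃ τ : ℂ, exp τ ∈ slit ∧ ζ = exp (τ / D.m j) := by
  have h : ζ = exp (D.m j * log ζ / D.m j) := by
    rw [mul_div_cancel_left₀ _ (D.m_ne_zero j), exp_log h0]
  refine ⟨D.m j * log ζ, ?_, h⟩
  rw [← D.exp_div_pow j, ← h]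
  exact hζ

lemma moeb_injOn {j : Fin 4} {s t : ℂ} (hs : s ∈ slit) (hs0 : s ≠ 0) (ht : t ∈ slit) (ht0 : t ≠ 0)
    (h : moeb j s = moeb j t) : s = t := by
  rw [← coord_moeb j hs hs0, h, coord_moeb j ht ht0]

/-- Two charts of the same kind agree up to a rotation, or have disjoint images. -/
lemma param_eq_param {j : Fin 4} {e e' : Ω} {ζ ζ' : ℂ} (hζ : ζ ∈ D.dom j) (hζ' : ζ' ∈ D.dom j)
    (h : D.param j e ζ = D.param j e' ζ') :
    ∃ r : ℤ, e = (D.rot j ^ r) e' ∧ ζ' = ζ * exp (r * (2 * Real.pi * I) / D.m j) := by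
  by_cases h0 : ζ = 0
  · subst h0
    by_cases h0' : ζ' = 0
    · subst h0'
      rw [param_zero, param_zero, vertex_eq_vertex] at h
      obtain ⟨r, hr⟩ := h.2.symm
      exact ⟨r, hr.symm, by simp⟩
    · rw [param_zero, D.param_of_mem hζ' h0'] at h
      exact absurd h (D.vertex_ne_point _ _ _ _ _)
  · by_cases h0' : ζ' = 0
    · subst h0'
      rw [param_zero, D.param_of_mem hζ h0] at h
      exact absurd h.symm (D.vertex_ne_point _ _ _ _ _)
    · obtain ⟨τ, hτ, rfl⟩ := D.exists_eq_exp hζ h0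
      obtain ⟨τ', hτ', rfl⟩ := D.exists_eq_exp hζ' h0'
      rw [D.param_exp j e hτ, D.param_exp j e' hτ', point_eq_point] at h
      obtain ⟨r, hr⟩ := exp_eq_exp_iff_exists_int.1
        (moeb_injOn hτ' (exp_ne_zero _) hτ (exp_ne_zero _) h.1.symm)
      refine ⟨r, ?_, ?_⟩
      · rw [hr, label_add] at h
        exact (D.label_bijective j τ).1 h.2
      · rw [hr, ← exp_add, add_div]

lemma param_rotate {j : Fin 4} (e : Ω) (r : ℤ) {ζ : ℂ} (hζ : ζ ∈ D.dom j) :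
    ζ * exp (r * (2 * Real.pi * I) / D.m j) ∈ D.dom j ∧
    D.param j e (ζ * exp (r * (2 * Real.pi * I) / D.m j)) = D.param j ((D.rot j ^ r) e) ζ := by
  by_cases h0 : ζ = 0
  · subst h0
    refine ⟨by simpa using hζ, ?_⟩
    rw [zero_mul, param_zero, param_zero, vertex_eq_vertex]
    exact ⟨rfl, r, rfl⟩
  · obtain ⟨τ, hτ, rfl⟩ := D.exists_eq_exp hζ h0
    have hτ' : exp (τ + r * (2 * Real.pi * I)) ∈ slit := by rwa [exp_add_int]
    rw [← exp_add, ← add_div]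
    refine ⟨D.exp_div_mem_dom hτ', ?_⟩
    rw [D.param_exp j e hτ', D.param_exp j _ hτ, label_add, point_eq_point, exp_add_int]
    exact ⟨rfl, rfl⟩

/-- Equal images on the same half-plane differ by `r` turns with `m j ∣ r`, and then the
corresponding rotation of `ζ` is trivial. -/
lemma param_injOn (j : Fin 4) (e : Ω) : InjOn (D.param j e) (D.dom j) := by
  intro ζ hζ ζ' hζ' h
  obtain ⟨r, hr, rfl⟩ := D.param_eq_param hζ hζ' h
  obtain ⟨q, rfl⟩ := (D.rot_zpow_eq_iff j r e).1 hr.symm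
  have : ((D.m j * q : ℤ) : ℂ) * (2 * Real.pi * I) / D.m j = q * (2 * Real.pi * I) := by
    have := D.m_ne_zero j
    push_cast
    field_simp
  rw [this, exp_int_mul_two_pi_mul_I, mul_one]

/-- Every point over a neighbourhood of a marked point is in the image of a chart. -/
lemma exists_param_eq (j : Fin 4) {h : ℂ} (hh : h ∈ base) (hc : coord j h ∈ slit) (e : Ω) :
    ∃ e' ζ, ζ ^ D.m j = coord j h ∧ D.param j e' ζ = point h hh e := by
  have h0 := coord_ne_zero j hh
  obtain ⟨e', he'⟩ := (D.label_bijective j (log (coord j h))).2 e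
  have hl : exp (log (coord j h)) ∈ slit := by rwa [exp_log h0]
  refine ⟨e', exp (log (coord j h) / D.m j), ?_, ?_⟩
  · rw [exp_div_pow, exp_log h0]
  · rw [D.param_exp j e' hl, point_eq_point, exp_log h0, moeb_coord j hh]
    exact ⟨rfl, he'⟩

/-! ### Continuation of labels across the real line -/

/-- The permutation that relates labels at a point over `h₀` to labels at nearby points. -/
def cross (h₀ h : ℂ) : Equiv.Perm Ω :=
  if 0 ≤ h₀.im ∧ h.im < 0 then D.c (interval h₀.re) else 1

lemma eventually_floor_eq {x : ℝ} (hx : (⌊x⌋ : ℝ) < x) : ∀ᶠ y in 𝓝 x, ⌊y⌋ = ⌊x⌋ := by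
  filter_upwards [Ioo_mem_nhds hx (Int.lt_floor_add_one x)] with y hy
  exact Int.floor_eq_iff.2 ⟨hy.1.le, hy.2⟩

/-- The turn count jumps only where `τ.im` is a multiple of `2π`, that is, where `exp τ` is a
positive real number. -/
lemma floor_lt_of_not_pos {τ : ℂ} (h : ¬ ((exp τ).im = 0 ∧ 0 < (exp τ).re)) :
    (⌊τ.im / (2 * Real.pi)⌋ : ℝ) < τ.im / (2 * Real.pi) := by
  refine lt_of_le_of_ne (Int.floor_le _) fun heq => h ?_
  have : τ.im = ⌊τ.im / (2 * Real.pi)⌋ * (2 * Real.pi) := by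
    rw [heq, div_mul_cancel₀ _ (by positivity)]
  rw [exp_im, exp_re, this, Real.cos_int_mul_two_pi]
  have h2 := Real.sin_int_mul_pi (2 * ⌊τ.im / (2 * Real.pi)⌋)
  push_cast at h2
  constructor
  · rw [mul_eq_zero]
    right
    rw [← h2]
    ring_nf
  · simp [Real.exp_pos]

/-- Labels are continued analytically in the same way in all charts. -/
lemma eventually_label (j : Fin 4) (e : Ω) {τ₀ : ℂ} (h : exp τ₀ ∈ slit) :
    ∀ᶠ τ in 𝓝 τ₀, D.label j e τ = D.cross (moeb j (exp τ₀)) (moeb j (exp τ)) (D.label j e τ₀) := by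
  have hslit : ∀ᶠ τ in 𝓝 τ₀, exp τ ∈ slit :=
    continuous_exp.continuousAt.eventually_mem (isOpen_slit.mem_nhds h)
  have hfl : Tendsto (fun τ : ℂ => τ.im / (2 * Real.pi)) (𝓝 τ₀) (𝓝 (τ₀.im / (2 * Real.pi))) :=
    (continuous_im.div_const _).continuousAt
  have him : Tendsto (fun τ : ℂ => (exp τ).im) (𝓝 τ₀) (𝓝 (exp τ₀).im) :=
    (continuous_im.comp continuous_exp).continuousAt
  have e0 := exp_ne_zero τ₀
  -- Off the real axis neither the turn count nor the half-plane changes nearby, so both sides keep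
  -- their labels; only real `exp τ₀` needs care.
  rcases lt_trichotomy (exp τ₀).im 0 with hneg | hzero | hpos
  · have h1 := hfl.eventually (eventually_floor_eq (floor_lt_of_not_pos fun h => hneg.ne h.1))
    filter_upwards [h1, him.eventually (gt_mem_nhds hneg)] with τ h1 h2
    have h3 : ¬ 0 ≤ (moeb j (exp τ₀)).im := by rw [moeb_im_nonneg_iff j h e0]; linarith
    rw [cross, if_neg (fun h => h3 h.1), label, label, if_neg (not_le.2 h2), if_neg (not_le.2 hneg),
      h1, Equiv.Perm.one_apply]
  · have habs := h hzero
    have heq : exp τ₀ = ((exp τ₀).re : ℂ) := Complex.ext (by simp) (by simpa using hzero)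
    have hre0 : (exp τ₀).re ≠ 0 := fun h => e0 (by rw [heq, h, ofReal_zero])
    have h30 : 0 ≤ (moeb j (exp τ₀)).im := by rw [moeb_im_nonneg_iff j h e0, hzero]
    -- On the negative axis the turn count is locally constant and going down crosses the interval
    -- `j - 1`. On the positive axis the turn count itself drops by one on going down, and the
    -- interval crossed is the `j`-th one.
    rcases lt_or_gt_of_ne hre0 with hre | hre
    · have h1 := hfl.eventually (eventually_floor_eq (floor_lt_of_not_pos fun h => hre.not_gt h.2))
      have hint : interval (moeb j (exp τ₀)).re = j - 1 := by
        rw [heq]; exact interval_moeb_of_neg j hre (neg_lt_of_abs_lt habs)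
      filter_upwards [h1, hslit] with τ h1 h2
      have h3 := moeb_im_nonneg_iff j h2 (exp_ne_zero τ)
      simp only [cross, label, h30, hzero, le_refl, if_true, true_and, h1, hint, ← not_le, h3]
      split_ifs <;> rfl
    · have hint : interval (moeb j (exp τ₀)).re = j := by
        rw [heq]; exact interval_moeb_of_pos j hre (lt_of_abs_lt habs)
      obtain ⟨k, hk⟩ : ∃ k : ℤ, τ₀.im = k * (2 * Real.pi) := by
        rw [exp_re] at hre
        rw [exp_im] at hzero
        have hs : Real.sin τ₀.im = 0 := by simpa [Real.exp_ne_zero] using hzero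
        have hc : Real.cos τ₀.im = 1 := by
          have := (pos_iff_pos_of_mul_pos hre).1 (Real.exp_pos _)
          nlinarith [Real.sin_sq_add_cos_sq τ₀.im]
        obtain ⟨k, hk⟩ := (Real.cos_eq_one_iff _).1 hc
        exact ⟨k, hk.symm⟩
      have hf0 : ⌊τ₀.im / (2 * Real.pi)⌋ = k := by
        rw [hk, mul_div_cancel_right₀ _ (by positivity), Int.floor_intCast]
      have hτ : ∀ᶠ τ in 𝓝 τ₀, |τ.im - τ₀.im| < Real.pi := by
        have : Tendsto (fun τ : ℂ => |τ.im - τ₀.im|) (𝓝 τ₀) (𝓝 |τ₀.im - τ₀.im|) :=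
          (continuous_im.sub continuous_const).abs.continuousAt
        rw [sub_self, abs_zero] at this
        exact this.eventually (gt_mem_nhds Real.pi_pos)
      filter_upwards [hτ, hslit] with τ h1 h2
      have h3 := moeb_im_nonneg_iff j h2 (exp_ne_zero τ)
      have hexp : (exp τ).im = Real.exp τ.re * Real.sin (τ.im - τ₀.im) := by
        rw [exp_im, hk, Real.sin_sub_int_mul_two_pi]
      have hpi := Real.pi_pos
      simp only [cross, label, h30, hzero, le_refl, if_true, true_and, hint, ← not_le, h3, hf0]
      rcases le_or_gt 0 (τ.im - τ₀.im) with hs | hs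
      · have h5 : 0 ≤ (exp τ).im := by
          rw [hexp]
          exact mul_nonneg (Real.exp_pos _).le
            (Real.sin_nonneg_of_nonneg_of_le_pi hs (lt_of_abs_lt h1).le)
        have h4 : ⌊τ.im / (2 * Real.pi)⌋ = k := by
          rw [Int.floor_eq_iff, le_div_iff₀ (by positivity), div_lt_iff₀ (by positivity)]
          constructor <;> nlinarith [lt_of_abs_lt h1]
        rw [if_pos h5, if_neg (not_not.2 h5), h4]; rfl
      · have h5 : ¬ 0 ≤ (exp τ).im := by
          rw [hexp, not_le]
          exact mul_neg_of_pos_of_neg (Real.exp_pos _)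
            (Real.sin_neg_of_neg_of_neg_pi_lt hs (neg_lt_of_abs_lt h1))
        have h4 : ⌊τ.im / (2 * Real.pi)⌋ = k - 1 := by
          rw [Int.floor_eq_iff, le_div_iff₀ (by positivity), div_lt_iff₀ (by positivity)]
          push_cast
          constructor <;> nlinarith [neg_lt_of_abs_lt h1]
        rw [if_neg h5, if_pos h5, h4]
        -- The two descriptions of the lower half-plane agree since `c (j - 1) = c j * rot j`: this
        -- identity is the reason for the definition of `rot`.
        have : D.rot j ^ k = D.rot j * D.rot j ^ (k - 1) := by
          rw [← zpow_one_add]; congr 1; ring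
        rw [this]
        simp [rot]
  · have h1 := hfl.eventually (eventually_floor_eq (floor_lt_of_not_pos fun h => hpos.ne' h.1))
    filter_upwards [h1, him.eventually (lt_mem_nhds hpos), hslit] with τ h1 h2 h4
    have h3 : ¬ (moeb j (exp τ)).im < 0 := by
      rw [not_lt, moeb_im_nonneg_iff j h4 (exp_ne_zero τ)]; exact h2.le
    rw [cross, if_neg (fun h => h3 h.2), label, label, if_pos h2.le, if_pos hpos.le,
      h1, Equiv.Perm.one_apply]

/-- Transition maps between the charts are holomorphic. -/
lemma exists_transition {j j' : Fin 4} {e e' : Ω} {ζ₀ ζ₀' : ℂ} (hζ : ζ₀ ∈ D.dom j)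
    (hζ' : ζ₀' ∈ D.dom j') (h : D.param j e ζ₀ = D.param j' e' ζ₀') :
    ∃ g : ℂ → ℂ, DifferentiableAt ℂ g ζ₀ ∧ g ζ₀ = ζ₀' ∧
      ∀ᶠ ζ in 𝓝 ζ₀, g ζ ∈ D.dom j' ∧ D.param j' e' (g ζ) = D.param j e ζ := by
  -- A centre of a chart can only correspond to a centre, and then for the same marked point, where
  -- the transition is a rotation. All other points have logarithmic coordinates.
  by_cases h0 : ζ₀ = 0
  · subst h0
    have h0' : ζ₀' = 0 := by
      by_contra h0'
      rw [param_zero, D.param_of_mem hζ' h0'] at h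
      exact absurd h (D.vertex_ne_point _ _ _ _ _)
    subst h0'
    have hj : j = j' := by
      rw [param_zero, param_zero, vertex_eq_vertex] at h
      exact h.1
    subst hj
    obtain ⟨r, rfl, -⟩ := D.param_eq_param hζ hζ' h
    refine ⟨fun ζ => ζ * exp (r * (2 * Real.pi * I) / D.m j), by fun_prop, by simp, ?_⟩
    filter_upwards [(D.isOpen_dom j).mem_nhds hζ] with ζ hζ
    exact D.param_rotate e' r hζ
  · have h0' : ζ₀' ≠ 0 := by
      rintro rfl
      rw [param_zero, D.param_of_mem hζ h0] at h
      exact absurd h.symm (D.vertex_ne_point _ _ _ _ _)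
    obtain ⟨τ₀, hτ₀, rfl⟩ := D.exists_eq_exp hζ h0
    obtain ⟨τ₀', hτ₀', rfl⟩ := D.exists_eq_exp hζ' h0'
    rw [D.param_exp j e hτ₀, D.param_exp j' e' hτ₀', point_eq_point] at h
    obtain ⟨hh, hl⟩ := h
    -- lift the coordinates to logarithmic ones
    set T : ℂ → ℂ := fun ζ => τ₀ + D.m j * log (ζ / exp (τ₀ / D.m j)) with hT
    have hTd : DifferentiableAt ℂ T (exp (τ₀ / D.m j)) := by
      refine (differentiableAt_const _).add ((differentiableAt_const _).mul ?_)
      refine (differentiableAt_id.div_const _).clog ?_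
      simp only [div_self (exp_ne_zero (τ₀ / D.m j))]
      exact one_mem_slitPlane
    have hT0 : T (exp (τ₀ / D.m j)) = τ₀ := by simp [hT]
    have hTe : ∀ᶠ ζ in 𝓝 (exp (τ₀ / D.m j)), ζ = exp (T ζ / D.m j) := by
      filter_upwards [isOpen_ne.mem_nhds (exp_ne_zero (τ₀ / D.m j))] with ζ hζ
      rw [hT, add_div, mul_div_cancel_left₀ _ (D.m_ne_zero j), exp_add,
        exp_log (div_ne_zero hζ (exp_ne_zero _)), mul_div_cancel₀ _ (exp_ne_zero _)]
    set q : ℂ → ℂ := fun τ => coord j' (moeb j (exp τ)) with hq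
    have hq0 : q τ₀ = exp τ₀' := by
      rw [hq]
      simp only [hh, coord_moeb j' hτ₀' (exp_ne_zero _)]
    have hqd : DifferentiableAt ℂ q τ₀ :=
      (differentiableAt_coord j' (moeb_mem_base j hτ₀ (exp_ne_zero _))).comp τ₀
        (f := fun τ => moeb j (exp τ))
        ((differentiableAt_moeb j hτ₀ (exp_ne_zero _)).comp τ₀ differentiableAt_exp)
    -- Dividing by the value at `τ₀` puts the argument of the logarithm near `1`, away from its cut,
    -- and selects the branch with `T' τ₀ = τ₀'`.
    set T' : ℂ → ℂ := fun τ => τ₀' + log (q τ / q τ₀) with hT'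
    have hT'0 : T' τ₀ = τ₀' := by
      rw [hT']
      simp only [hq0, div_self (exp_ne_zero τ₀'), log_one, add_zero]
    have hT'd : DifferentiableAt ℂ T' τ₀ := by
      refine (differentiableAt_const _).add ((hqd.div_const _).clog ?_)
      rw [hq0, div_self (exp_ne_zero _)]
      exact one_mem_slitPlane
    have hslit : ∀ᶠ τ in 𝓝 τ₀, exp τ ∈ slit :=
      continuous_exp.continuousAt.eventually_mem (isOpen_slit.mem_nhds hτ₀)
    have hT'e : ∀ᶠ τ in 𝓝 τ₀, exp (T' τ) = q τ := by
      filter_upwards [hslit] with τ hτ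
      have := coord_ne_zero j' (moeb_mem_base j hτ (exp_ne_zero _))
      rw [hT', exp_add, exp_log (div_ne_zero this (hq0 ▸ exp_ne_zero _)), hq0,
        mul_div_cancel₀ _ (exp_ne_zero _)]
    have hslit' : ∀ᶠ τ in 𝓝 τ₀, exp (T' τ) ∈ slit := by
      refine ContinuousAt.eventually_mem (f := fun τ => exp (T' τ)) ?_ (isOpen_slit.mem_nhds ?_)
      · exact continuous_exp.continuousAt.comp hT'd.continuousAt
      · rwa [hT'0]
    have hmain : ∀ᶠ τ in 𝓝 τ₀, exp (T' τ) ∈ slit ∧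
        D.param j' e' (exp (T' τ / D.m j')) = D.param j e (exp (τ / D.m j)) := by
      have hl' : ∀ᶠ τ in 𝓝 τ₀, D.label j' e' (T' τ) =
          D.cross (moeb j' (exp τ₀')) (moeb j' (exp (T' τ))) (D.label j' e' τ₀') := by
        have := D.eventually_label j' e' hτ₀'
        rw [← hT'0] at this
        have := hT'd.continuousAt.eventually this
        rwa [hT'0] at this
      -- Both labels start equal at the common point, and `cross` depends only on the positions in
      -- the sphere, so they remain equal.
      filter_upwards [hslit, hslit', hT'e, hl', D.eventually_label j e hτ₀] with τ h1 h2 h3 h4 h5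
      refine ⟨h2, ?_⟩
      have h6 : moeb j' (exp (T' τ)) = moeb j (exp τ) := by
        rw [h3, hq, moeb_coord j' (moeb_mem_base j h1 (exp_ne_zero _))]
      rw [D.param_exp j e h1, D.param_exp j' e' h2, point_eq_point, h4, h5, ← hl, h6, hh]
      exact ⟨rfl, rfl⟩
    refine ⟨fun ζ => exp (T' (T ζ) / D.m j'), ?_, ?_, ?_⟩
    · refine (DifferentiableAt.div_const ?_ _).cexp
      refine DifferentiableAt.comp (g := T') _ ?_ hTd
      rwa [hT0]
    · simp only [hT0, hT'0]
    · have h1 := hTd.continuousAt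
      rw [ContinuousAt, hT0] at h1
      filter_upwards [h1.eventually hmain, hTe] with ζ h2 h3
      refine ⟨D.exp_div_mem_dom h2.1, ?_⟩
      rw [h2.2, ← h3]

end GluingData

end

/-! ### Complex structure, compactness and connectedness of the covering surface -/

noncomputable section

namespace GluingData

open Complex Set Filter Topology FourPoint

variable {Ω : Type} (D : GluingData Ω)

/-- The chart centred at the point over the `j`-th marked point on the half-plane `e`. -/
def chart (j : Fin 4) (e : Ω) : PartialEquiv D.Surface ℂ where
  toFun := Function.invFunOn (D.param j e) (D.dom j)
  invFun := D.param j e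
  source := D.param j e '' D.dom j
  target := D.dom j
  map_source' := by
    rintro _ ⟨ζ, hζ, rfl⟩
    exact Function.invFunOn_mem ⟨ζ, hζ, rfl⟩
  map_target' ζ hζ := mem_image_of_mem _ hζ
  left_inv' := by
    rintro _ ⟨ζ, hζ, rfl⟩
    exact Function.invFunOn_eq ⟨ζ, hζ, rfl⟩
  right_inv' ζ hζ := (D.param_injOn j e).leftInvOn_invFunOn hζ

lemma eventually_transition {j j' : Fin 4} {e e' : Ω} {ζ₀ : ℂ}
    (h : ζ₀ ∈ ((D.chart j e).symm.trans (D.chart j' e')).source) :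
    (∀ᶠ ζ in 𝓝 ζ₀, ζ ∈ ((D.chart j e).symm.trans (D.chart j' e')).source) ∧
      DifferentiableAt ℂ ((D.chart j e).symm.trans (D.chart j' e')) ζ₀ := by
  obtain ⟨hζ, ζ₀', hζ', heq⟩ := h
  obtain ⟨g, hg, -, hev⟩ := D.exists_transition hζ hζ' heq.symm
  constructor
  · filter_upwards [hev, (D.isOpen_dom j).mem_nhds hζ] with ζ h1 h2
    exact ⟨h2, g ζ, h1.1, h1.2⟩
  · refine hg.congr_of_eventuallyEq ?_
    filter_upwards [hev] with ζ h1
    change D.chart j' e' (D.param j e ζ) = g ζ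
    rw [← h1.2]
    exact (D.chart j' e').right_inv h1.1

/-- The part of each chart domain lying over `cap` already suffices to cover the surface. These
parts are compact, which gives compactness when there are finitely many half-planes. -/
lemma exists_param_cap (P : D.Surface) :
    ∃ (j : Fin 4) (e : Ω) (ζ : ℂ), ζ ^ D.m j ∈ cap ∧ D.param j e ζ = P := by
  obtain ⟨⟨h, hh⟩, e⟩ | ⟨j, q⟩ := P
  · obtain ⟨j, hj⟩ := exists_coord_mem_cap hh
    obtain ⟨e', ζ, h1, h2⟩ := D.exists_param_eq j hh (cap_subset_slit hj) e
    exact ⟨j, e', ζ, h1 ▸ hj, h2⟩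
  · obtain ⟨e, rfl⟩ := Quotient.exists_rep q
    refine ⟨j, e, 0, ?_, D.param_zero j e⟩
    simp [cap, (D.m_pos j).ne']

/-- The atlas of the surface. -/
def core : ChartedSpaceCore ℂ D.Surface where
  atlas := {φ | ∃ j e, φ = D.chart j e}
  chartAt P := D.chart (D.exists_param_cap P).choose (D.exists_param_cap P).choose_spec.choose
  mem_chart_source P := by
    obtain ⟨ζ, h1, h2⟩ := (D.exists_param_cap P).choose_spec.choose_spec
    exact ⟨ζ, cap_subset_slit h1, h2⟩
  chart_mem_atlas P := ⟨_, _, rfl⟩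
  open_source := by
    rintro _ _ ⟨j, e, rfl⟩ ⟨j', e', rfl⟩
    exact isOpen_iff_mem_nhds.2 fun ζ hζ => (D.eventually_transition hζ).1
  continuousOn_toFun := by
    rintro _ _ ⟨j, e, rfl⟩ ⟨j', e', rfl⟩ ζ hζ
    exact (D.eventually_transition hζ).2.continuousAt.continuousWithinAt

instance : TopologicalSpace D.Surface := D.core.toTopologicalSpace

instance : ChartedSpace ℂ D.Surface := D.core.toChartedSpace

/-- The charts as homeomorphisms. -/
def homeo (j : Fin 4) (e : Ω) : OpenPartialHomeomorph D.Surface ℂ :=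
  D.core.openPartialHomeomorph (D.chart j e) ⟨j, e, rfl⟩

lemma mem_atlas_iff (φ : OpenPartialHomeomorph D.Surface ℂ) :
    φ ∈ atlas ℂ D.Surface ↔ ∃ j e, φ = D.homeo j e := by
  constructor
  · intro h
    obtain ⟨_, ⟨e, rfl⟩, h⟩ := h
    obtain ⟨_, ⟨⟨j, e', rfl⟩, rfl⟩, h⟩ := h
    exact ⟨j, e', h⟩
  · rintro ⟨j, e, rfl⟩
    exact mem_iUnion₂.2 ⟨D.chart j e, ⟨j, e, rfl⟩, rfl⟩

lemma chartAt_eq (P : D.Surface) : ∃ j e, chartAt ℂ P = D.homeo j e :=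
  (D.mem_atlas_iff _).1 (chart_mem_atlas ℂ P)

instance : IsManifold 𝓘(ℂ) ω D.Surface := by
  refine isManifold_of_contDiffOn _ _ _ fun φ ψ hφ hψ => ?_
  obtain ⟨j, e, rfl⟩ := (D.mem_atlas_iff φ).1 hφ
  obtain ⟨j', e', rfl⟩ := (D.mem_atlas_iff ψ).1 hψ
  simp only [modelWithCornersSelf_coe, modelWithCornersSelf_coe_symm, range_id, inter_univ,
    Function.id_comp, Function.comp_id, preimage_id]
  have ho : IsOpen ((D.homeo j e).symm.trans (D.homeo j' e')).source :=
    ((D.homeo j e).symm.trans (D.homeo j' e')).open_source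
  -- Complex differentiability on an open set already gives analyticity, so the transition maps need
  -- no estimate of higher derivatives.
  refine AnalyticOnNhd.contDiffOn (DifferentiableOn.analyticOnNhd (fun ζ hζ => ?_) ho)
    ho.uniqueDiffOn
  exact (D.eventually_transition hζ).2.differentiableWithinAt

lemma continuousOn_param (j : Fin 4) (e : Ω) : ContinuousOn (D.param j e) (D.dom j) :=
  (D.homeo j e).continuousOn_symm

lemma isOpen_image_param (j : Fin 4) (e : Ω) : IsOpen (D.param j e '' D.dom j) :=
  (D.homeo j e).open_source

lemma compactSpace [Finite Ω] : CompactSpace D.Surface := by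
  have : (univ : Set D.Surface) =
      ⋃ (j : Fin 4) (e : Ω), D.param j e '' {ζ | ζ ^ D.m j ∈ cap} := by
    refine (eq_univ_of_forall fun P => ?_).symm
    obtain ⟨j, e, ζ, h1, h2⟩ := D.exists_param_cap P
    exact mem_iUnion₂.2 ⟨j, e, ζ, h1, h2⟩
  refine ⟨this ▸ isCompact_iUnion fun j => isCompact_iUnion fun e => ?_⟩
  refine IsCompact.image_of_continuousOn ?_ ((D.continuousOn_param j e).mono fun ζ hζ =>
    cap_subset_slit hζ)
  refine (isCompact_closedBall (0 : ℂ) 1).of_isClosed_subset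
    (isCompact_cap.isClosed.preimage (continuous_pow _)) fun ζ hζ => ?_
  rw [mem_closedBall_zero_iff]
  simp only [cap, mem_ofPred_eq, normSq_eq_norm_sq, norm_pow] at hζ
  by_contra! h
  have h1 := one_lt_pow₀ h (D.m_pos j).ne'
  nlinarith [abs_nonneg (ζ ^ D.m j).re]

/-- The slit plane is star-shaped about `0`, and this passes to its preimage under a power map. -/
lemma isPreconnected_image_param (j : Fin 4) (e : Ω) : IsPreconnected (D.param j e '' D.dom j) := by
  have hs : StarConvex ℝ 0 (D.dom j) := by
    rw [starConvex_zero_iff]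
    intro ζ hζ a ha0 ha1
    have := smul_mem_slit hζ (pow_nonneg ha0 (D.m j)) (pow_le_one₀ ha0 ha1)
    simpa [dom, mul_pow] using this
  exact (hs.isPathConnected (D.zero_mem_dom j)).isConnected.isPreconnected.image _
    (D.continuousOn_param j e)

/-- The four rotations are the powers of a rotation of order four about the axis through `±I`. So
`I` lies over every chart and serves as a common base point. -/
lemma moeb_I (j : Fin 4) : moeb j I = I := by
  have h := I_mem_slit
  have hd := den_ne_zero j h I_ne_zero
  rw [moeb, div_eq_iff hd]
  fin_cases j <;> simp [num, den, mul_add, mul_sub]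
  all_goals ring

lemma I_mem_base : I ∈ base := ⟨I_ne_zero, by simp [Complex.ext_iff], by simp [Complex.ext_iff]⟩

lemma label_of_mem_Icc (j : Fin 4) (e : Ω) {τ : ℂ} (h0 : 0 ≤ τ.im) (h1 : τ.im ≤ Real.pi) :
    D.label j e τ = e := by
  have hpi := Real.pi_pos
  have hf : ⌊τ.im / (2 * Real.pi)⌋ = 0 := by
    rw [Int.floor_eq_iff, le_div_iff₀ (by positivity), div_lt_iff₀ (by positivity)]
    constructor <;> push_cast <;> linarith
  have h2 : 0 ≤ (exp τ).im := by
    rw [exp_im]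
    exact mul_nonneg (Real.exp_pos _).le (Real.sin_nonneg_of_nonneg_of_le_pi h0 h1)
  rw [label, if_pos h2, hf, zpow_zero, Equiv.Perm.one_apply]

lemma label_of_mem_Ioo (j : Fin 4) (e : Ω) {τ : ℂ} (h0 : Real.pi < τ.im)
    (h1 : τ.im < 2 * Real.pi) : D.label j e τ = D.c (j - 1) e := by
  have hpi := Real.pi_pos
  have hf : ⌊τ.im / (2 * Real.pi)⌋ = 0 := by
    rw [Int.floor_eq_iff, le_div_iff₀ (by positivity), div_lt_iff₀ (by positivity)]
    constructor <;> push_cast <;> linarith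
  have h2 : ¬ 0 ≤ (exp τ).im := by
    rw [exp_im, not_le]
    refine mul_neg_of_pos_of_neg (Real.exp_pos _) ?_
    rw [← Real.sin_sub_two_pi]
    exact Real.sin_neg_of_neg_of_neg_pi_lt (by linarith) (by linarith)
  rw [label, if_neg h2, hf, zpow_zero, Equiv.Perm.one_apply]

lemma exp_pi_div_two_mul_I : exp (Real.pi / 2 * I) = I := by
  rw [exp_mul_I, cos_pi_div_two, sin_pi_div_two]; simp

lemma point_I_mem (j : Fin 4) (e : Ω) : point I I_mem_base e ∈ D.param j e '' D.dom j := by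
  have hs : exp (Real.pi / 2 * I) ∈ slit := by rw [exp_pi_div_two_mul_I]; exact I_mem_slit
  refine ⟨_, D.exp_div_mem_dom hs, ?_⟩
  have hpi := Real.pi_pos
  rw [D.param_exp j e hs, point_eq_point, exp_pi_div_two_mul_I, moeb_I]
  refine ⟨rfl, D.label_of_mem_Icc _ _ ?_ ?_⟩ <;> simp <;> linarith

/-- The chart around the vertex of `e` also reaches the half-plane `rot j e`. Hence one step of the
monodromy stays in a connected set. -/
lemma point_I_rot_mem (j : Fin 4) (e : Ω) :
    point I I_mem_base (D.rot j e) ∈ D.param j e '' D.dom j := by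
  obtain ⟨ζ, hζ, h⟩ := D.point_I_mem j (D.rot j e)
  have := D.param_rotate e 1 hζ
  exact ⟨_, this.1, this.2.trans h⟩

/-- Each generator of the monodromy joins two points over `I` inside a single chart image, so by
transitivity all points over `I` lie in one component; every chart image meets it. -/
lemma connectedSpace [Nonempty Ω]
    (h : ∀ e e' : Ω, ∃ g ∈ Subgroup.closure (range D.rot), g e = e') :
    ConnectedSpace D.Surface := by
  have h1 : ∀ g ∈ Subgroup.closure (range D.rot), ∀ e : Ω,
      connectedComponent (point I I_mem_base (g e) : D.Surface) =
        connectedComponent (point I I_mem_base e) := by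
    intro g hg
    induction hg using Subgroup.closure_induction with
    | mem g hg =>
      obtain ⟨j, rfl⟩ := hg
      intro e
      exact (connectedComponent_eq ((D.isPreconnected_image_param j e).subset_connectedComponent
        (D.point_I_mem j e) (D.point_I_rot_mem j e))).symm
    | one => intro e; rfl
    | mul g g' _ _ hg hg' => intro e; rw [Equiv.Perm.mul_apply, hg, hg']
    | inv g _ hg => intro e; rw [← hg (g⁻¹ e), ← Equiv.Perm.mul_apply, mul_inv_cancel, Equiv.Perm.one_apply]
  obtain ⟨e₀⟩ := ‹Nonempty Ω›
  rw [connectedSpace_iff_connectedComponent]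
  refine ⟨point I I_mem_base e₀, eq_univ_of_forall fun P => ?_⟩
  obtain ⟨j, e, ζ, h2, rfl⟩ := D.exists_param_cap P
  obtain ⟨g, hg, rfl⟩ := h e₀ e
  rw [← h1 g hg e₀]
  exact (D.isPreconnected_image_param j _).subset_connectedComponent
    (D.point_I_mem j _) ⟨ζ, cap_subset_slit h2, rfl⟩

end GluingData

end

noncomputable section

/-! ### Rational functions on the covering surfaces -/

open Complex Set Filter Topology FourPoint

/-- The point of the Riemann sphere with homogeneous coordinates `(a : b)`. -/
def ratio (a b : ℂ) : OnePoint ℂ :=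
  open Classical in if b = 0 then OnePoint.infty else ((a / b : ℂ) : OnePoint ℂ)

lemma ratio_of_ne {a b : ℂ} (h : b ≠ 0) : ratio a b = ((a / b : ℂ) : OnePoint ℂ) := if_neg h

lemma ratio_zero_right (a : ℂ) : ratio a 0 = OnePoint.infty := if_pos rfl

lemma ratio_mul_left {c : ℂ} (hc : c ≠ 0) (a b : ℂ) : ratio (c * a) (c * b) = ratio a b := by
  by_cases hb : b = 0
  · rw [hb, mul_zero, ratio_zero_right, ratio_zero_right]
  · rw [ratio_of_ne hb, ratio_of_ne (mul_ne_zero hc hb), mul_div_mul_left _ _ hc]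

lemma ratio_eq_coe_iff {a b z : ℂ} : ratio a b = (z : OnePoint ℂ) ↔ b ≠ 0 ∧ a = z * b := by
  by_cases hb : b = 0
  · simp [hb, ratio_zero_right]
  · rw [ratio_of_ne hb, OnePoint.coe_eq_coe, div_eq_iff hb]
    simp [hb]

lemma ratio_eq_infty_iff {a b : ℂ} : ratio a b = OnePoint.infty ↔ b = 0 := by
  by_cases hb : b = 0
  · simp [hb, ratio_zero_right]
  · simp [hb, ratio_of_ne hb]

lemma continuousAt_ratio {X : Type*} [TopologicalSpace X] {f g : X → ℂ} {x : X}
    (hf : ContinuousAt f x) (hg : ContinuousAt g x) (h : f x ≠ 0 ∨ g x ≠ 0) :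
    ContinuousAt (fun y => ratio (f y) (g y)) x := by
  by_cases hgx : g x = 0
  · have hfx : f x ≠ 0 := h.resolve_right (not_not.2 hgx)
    rw [ContinuousAt, hgx, ratio_zero_right, OnePoint.hasBasis_nhds_infty.tendsto_right_iff]
    rintro s ⟨-, hs⟩
    obtain ⟨R, hR⟩ := hs.isBounded.exists_norm_le
    have h1 : Tendsto (fun y => R * ‖g y‖ - ‖f y‖) (𝓝 x) (𝓝 (R * ‖g x‖ - ‖f x‖)) :=
      ((hg.norm.const_mul R).sub hf.norm)
    have h2 : R * ‖g x‖ - ‖f x‖ < 0 := by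
      rw [hgx]; simpa using hfx
    filter_upwards [h1.eventually (gt_mem_nhds h2)] with y hy
    by_cases hgy : g y = 0
    · right; rw [hgy, ratio_zero_right]; rfl
    · left
      rw [ratio_of_ne hgy]
      refine mem_image_of_mem _ fun hmem => ?_
      have := hR _ hmem
      rw [norm_div, div_le_iff₀ (norm_pos_iff.2 hgy)] at this
      linarith
  · have h1 : ∀ᶠ y in 𝓝 x, g y ≠ 0 := hg.eventually_ne hgx
    have h2 : ContinuousAt (fun y => ((f y / g y : ℂ) : OnePoint ℂ)) x :=
      OnePoint.continuous_coe.continuousAt.comp (hf.div hg hgx)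
    refine h2.congr ?_
    filter_upwards [h1] with y hy
    rw [ratio_of_ne hy]

/-- A rational function on the sphere, given by two homogeneous forms without common zeros. -/
structure SphereMap where
  P : ℂ → ℂ → ℂ
  Q : ℂ → ℂ → ℂ
  deg : ℕ
  P_hom : ∀ c a b, P (c * a) (c * b) = c ^ deg * P a b
  Q_hom : ∀ c a b, Q (c * a) (c * b) = c ^ deg * Q a b
  differentiable_P : Differentiable ℂ fun x : ℂ × ℂ => P x.1 x.2
  differentiable_Q : Differentiable ℂ fun x : ℂ × ℂ => Q x.1 x.2
  ne_zero : ∀ a b, a ≠ 0 ∨ b ≠ 0 → P a b ≠ 0 ∨ Q a b ≠ 0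

/-- The identity map of the sphere. -/
def SphereMap.id : SphereMap where
  P a _ := a
  Q _ b := b
  deg := 1
  P_hom c a b := by ring
  Q_hom c a b := by ring
  differentiable_P := differentiable_fst
  differentiable_Q := differentiable_snd
  ne_zero _ _ h := h

namespace GluingData

variable {Ω : Type} (D : GluingData Ω) (R : SphereMap)

/-- The pullback to the covering surface of a rational function on the sphere. -/
def pullback : D.Surface → OnePoint ℂ
  | Sum.inl (h, _) => ratio (R.P h 1) (R.Q h 1)
  | Sum.inr ⟨j, _⟩ => ratio (R.P (num j 0) (den j 0)) (R.Q (num j 0) (den j 0))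

lemma pullback_point {h : ℂ} (hh : h ∈ base) (e : Ω) :
    D.pullback R (point h hh e) = ratio (R.P h 1) (R.Q h 1) := rfl

lemma pullback_vertex (j : Fin 4) (e : Ω) : D.pullback R (vertex j e) =
    ratio (R.P (num j 0) (den j 0)) (R.Q (num j 0) (den j 0)) := rfl

/-- Homogeneity allows the denominator of the rotation to be cleared. The right-hand side also makes
sense at `t = 0`, including over `∞`. -/
lemma ratio_moeb (j : Fin 4) {t : ℂ} (ht : t ∈ slit) (h0 : t ≠ 0) :
    ratio (R.P (moeb j t) 1) (R.Q (moeb j t) 1) =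
      ratio (R.P (num j t) (den j t)) (R.Q (num j t) (den j t)) := by
  have hd := den_ne_zero j ht h0
  have h1 : num j t = den j t * moeb j t := by rw [moeb, mul_div_cancel₀ _ hd]
  have hP := R.P_hom (den j t) (moeb j t) 1
  have hQ := R.Q_hom (den j t) (moeb j t) 1
  rw [mul_one, ← h1] at hP hQ
  rw [hP, hQ, ratio_mul_left (pow_ne_zero _ hd)]

lemma pullback_param {j : Fin 4} {ζ : ℂ} (hζ : ζ ∈ D.dom j) (e : Ω) :
    D.pullback R (D.param j e ζ) = ratio (R.P (num j (ζ ^ D.m j)) (den j (ζ ^ D.m j)))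
      (R.Q (num j (ζ ^ D.m j)) (den j (ζ ^ D.m j))) := by
  by_cases h0 : ζ = 0
  · subst h0
    rw [param_zero, pullback_vertex, zero_pow (D.m_pos j).ne']
  · rw [D.param_of_mem hζ h0, pullback_point, ratio_moeb R j hζ (pow_ne_zero _ h0)]

/-- The numerator of the pullback of a rational function, in a chart. -/
def pullbackNum (j : Fin 4) (ζ : ℂ) : ℂ := R.P (num j (ζ ^ D.m j)) (den j (ζ ^ D.m j))

/-- The denominator of the pullback of a rational function, in a chart. -/
def pullbackDen (j : Fin 4) (ζ : ℂ) : ℂ := R.Q (num j (ζ ^ D.m j)) (den j (ζ ^ D.m j))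

lemma differentiable_pullbackNum (j : Fin 4) : Differentiable ℂ (D.pullbackNum R j) :=
  R.differentiable_P.comp (((differentiable_num j).comp (differentiable_id.pow _)).prodMk
    ((differentiable_den j).comp (differentiable_id.pow _)))

lemma differentiable_pullbackDen (j : Fin 4) : Differentiable ℂ (D.pullbackDen R j) :=
  R.differentiable_Q.comp (((differentiable_num j).comp (differentiable_id.pow _)).prodMk
    ((differentiable_den j).comp (differentiable_id.pow _)))

lemma pullback_ne_zero (j : Fin 4) (ζ : ℂ) :
    D.pullbackNum R j ζ ≠ 0 ∨ D.pullbackDen R j ζ ≠ 0 :=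
  R.ne_zero _ _ (num_ne_zero_or_den_ne_zero j _)

lemma eventually_pullback {j : Fin 4} {ζ₀ : ℂ} (hζ : ζ₀ ∈ D.dom j) (e : Ω) :
    ∀ᶠ ζ in 𝓝 ζ₀, D.pullback R (D.param j e ζ) =
      ratio (D.pullbackNum R j ζ) (D.pullbackDen R j ζ) := by
  filter_upwards [(D.isOpen_dom j).mem_nhds hζ] with ζ hζ
  exact D.pullback_param R hζ e

lemma continuousAt_iff {X : Type*} [TopologicalSpace X] {f : D.Surface → X} {j : Fin 4} {ζ : ℂ}
    (hζ : ζ ∈ D.dom j) (e : Ω) :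
    ContinuousAt f (D.param j e ζ) ↔ ContinuousAt (f ∘ D.param j e) ζ :=
  ((D.homeo j e).symm.continuousAt_iff_continuousAt_comp_right
    (show D.param j e ζ ∈ (D.homeo j e).source from ⟨ζ, hζ, rfl⟩)).trans
    (by rw [OpenPartialHomeomorph.symm_symm]
        exact iff_of_eq (congrArg _ ((D.chart j e).right_inv hζ)))

lemma continuous_pullback : Continuous (D.pullback R) := by
  rw [continuous_iff_continuousAt]
  intro P
  obtain ⟨j, e, ζ, h, rfl⟩ := D.exists_param_cap P
  have hζ : ζ ∈ D.dom j := cap_subset_slit h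
  rw [D.continuousAt_iff hζ]
  refine (continuousAt_ratio (D.differentiable_pullbackNum R j ζ).continuousAt
    (D.differentiable_pullbackDen R j ζ).continuousAt (D.pullback_ne_zero R j ζ)).congr ?_
  filter_upwards [D.eventually_pullback R hζ e] with ζ h
  exact h.symm

/-- Differentiability can be checked in charts. -/
lemma exists_chart (P : D.Surface) : ∃ (j : Fin 4) (e : Ω) (ζ : ℂ), ζ ∈ D.dom j ∧
    D.param j e ζ = P ∧ ∀ (f : D.Surface → ℂ) (f' : ℂ), HasDerivAt (f ∘ D.param j e) f' ζ →
      MDifferentiableAt 𝓘(ℂ) 𝓘(ℂ) f P ∧ (f' ≠ 0 → mfderiv 𝓘(ℂ) 𝓘(ℂ) f P ≠ 0) := by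
  obtain ⟨j, e, h⟩ := D.chartAt_eq P
  have hP : P ∈ (D.homeo j e).source := h ▸ mem_chart_source ℂ P
  have hζ : D.homeo j e P ∈ D.dom j := (D.homeo j e).map_source hP
  have hP' : D.param j e (D.homeo j e P) = P := (D.homeo j e).left_inv hP
  refine ⟨j, e, D.homeo j e P, hζ, hP', fun f f' hf => ?_⟩
  have hw : writtenInExtChartAt 𝓘(ℂ) 𝓘(ℂ) P f = f ∘ D.param j e := by
    ext ζ
    simp only [writtenInExtChartAt, mfld_simps, h]
    rfl
  have hx : extChartAt 𝓘(ℂ) P P = D.homeo j e P := by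
    simp only [mfld_simps, h]
  have hmd : MDifferentiableAt 𝓘(ℂ) 𝓘(ℂ) f P := by
    rw [mdifferentiableAt_iff, hw, hx]
    refine ⟨?_, hf.differentiableAt.differentiableWithinAt⟩
    have := (D.continuousAt_iff hζ e (f := f)).2 hf.continuousAt
    rwa [hP'] at this
  refine ⟨hmd, fun hf' h0 => hf' ?_⟩
  rw [hmd.mfderiv, hw, hx] at h0
  simp only [mfld_simps, fderivWithin_univ] at h0
  rw [hf.hasFDerivAt.fderiv] at h0
  have h1 : (ContinuousLinearMap.toSpanSingleton ℂ f' : ℂ →L[ℂ] ℂ) = 0 := h0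
  simpa using DFunLike.congr_fun h1 (1 : ℂ)

lemma isHolomorphicToSphere_pullback : IsHolomorphicToSphere (D.pullback R) := by
  refine ⟨D.continuous_pullback R, fun P hP => ?_, fun P hP => ?_⟩
  · obtain ⟨j, e, ζ, hζ, rfl, h⟩ := D.exists_chart P
    rw [D.pullback_param R hζ, Ne, ratio_eq_infty_iff] at hP
    have hd : D.pullbackDen R j ζ ≠ 0 := hP
    have hdiff := (D.differentiable_pullbackNum R j ζ).div (D.differentiable_pullbackDen R j ζ) hd
    refine (h _ _ (hdiff.hasDerivAt.congr_of_eventuallyEq ?_)).1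
    filter_upwards [D.eventually_pullback R hζ e,
      (D.differentiable_pullbackDen R j ζ).continuousAt.eventually_ne hd] with ζ h1 h2
    rw [Function.comp_apply, Function.comp_apply, h1, ratio_of_ne h2]
    rfl
  · obtain ⟨j, e, ζ, hζ, rfl, h⟩ := D.exists_chart P
    rw [D.pullback_param R hζ, Ne, ratio_eq_coe_iff, zero_mul] at hP
    have hn : D.pullbackNum R j ζ ≠ 0 := by
      intro h0
      exact hP ⟨(D.pullback_ne_zero R j ζ).resolve_left (not_not.2 h0), h0⟩
    have hdiff := (D.differentiable_pullbackDen R j ζ).div (D.differentiable_pullbackNum R j ζ) hn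
    refine (h _ _ (hdiff.hasDerivAt.congr_of_eventuallyEq ?_)).1
    filter_upwards [D.eventually_pullback R hζ e,
      (D.differentiable_pullbackNum R j ζ).continuousAt.eventually_ne hn] with ζ h1 h2
    rw [Function.comp_apply, Function.comp_apply, h1, Pi.div_apply]
    by_cases hd : D.pullbackDen R j ζ = 0
    · rw [hd, ratio_zero_right, zero_div]
      rfl
    · rw [ratio_of_ne hd]
      exact inv_div _ _

/-- `moeb j` has the differentiable left inverse `coord j`, so its derivative cannot vanish; the
power map is unramified away from `0`. -/
lemma exists_hasDerivAt_moeb {j : Fin 4} {ζ : ℂ} (hζ : ζ ∈ D.dom j) (h0 : ζ ≠ 0) :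
    ∃ d ≠ 0, HasDerivAt (fun ζ => moeb j (ζ ^ D.m j)) d ζ := by
  have ht : ζ ^ D.m j ≠ 0 := pow_ne_zero _ h0
  have hm : DifferentiableAt ℂ (moeb j) (ζ ^ D.m j) := differentiableAt_moeb j hζ ht
  have hc := (differentiableAt_coord j (moeb_mem_base j hζ ht)).hasDerivAt
  have hcm : HasDerivAt (fun t => coord j (moeb j t)) 1 (ζ ^ D.m j) := by
    refine (hasDerivAt_id _).congr_of_eventuallyEq ?_
    filter_upwards [isOpen_slit.mem_nhds hζ, isOpen_ne.mem_nhds ht] with t h1 h2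
    exact coord_moeb j h1 h2
  have hne : deriv (moeb j) (ζ ^ D.m j) ≠ 0 := by
    intro h
    have := (hc.comp _ hm.hasDerivAt).unique hcm
    rw [h, mul_zero] at this
    exact zero_ne_one this
  refine ⟨_, ?_, hm.hasDerivAt.comp ζ (hasDerivAt_pow (D.m j) ζ)⟩
  exact mul_ne_zero hne (mul_ne_zero (D.m_ne_zero j) (pow_ne_zero _ h0))

/-- The pullback of a rational function that is ramified only over `0, 1, ∞` and takes only these
values at the marked points is a Belyi function. -/
lemma isBelyi_pullback [Nonempty Ω]
    (hmark : ∀ j, ratio (R.P (num j 0) (den j 0)) (R.Q (num j 0) (den j 0)) ∈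
      ({((0 : ℂ) : OnePoint ℂ), ((1 : ℂ) : OnePoint ℂ), OnePoint.infty} : Set (OnePoint ℂ)))
    (hderiv : ∀ h ∈ base, R.Q h 1 ≠ 0 → ∃ d ≠ 0, HasDerivAt (fun h => R.P h 1 / R.Q h 1) d h)
    (hconst : ratio (R.P (num 0 0) (den 0 0)) (R.Q (num 0 0) (den 0 0)) ≠
      ratio (R.P (num 1 0) (den 1 0)) (R.Q (num 1 0) (den 1 0))) :
    IsBelyi (D.pullback R) := by
  obtain ⟨e₀⟩ := ‹Nonempty Ω›
  refine ⟨D.isHolomorphicToSphere_pullback R, ⟨vertex 0 e₀, vertex 1 e₀, hconst⟩,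
    fun P hP0 hP1 hPi => ?_⟩
  obtain ⟨j, e, ζ, hζ, rfl, h⟩ := D.exists_chart P
  have h0 : ζ ≠ 0 := by
    rintro rfl
    rw [D.param_zero, pullback_vertex] at hP0 hP1 hPi
    rcases hmark j with h | h | h
    · exact hP0 h
    · exact hP1 h
    · exact hPi h
  have ht : ζ ^ D.m j ≠ 0 := pow_ne_zero _ h0
  rw [D.param_of_mem hζ h0, pullback_point, Ne, ratio_eq_infty_iff] at hPi
  obtain ⟨d, hd, hd'⟩ := hderiv _ (moeb_mem_base j hζ ht) hPi
  obtain ⟨d', hd0, hd'0⟩ := D.exists_hasDerivAt_moeb hζ h0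
  refine (h _ (d * d') ?_).2 (mul_ne_zero hd hd0)
  refine (hd'.comp ζ hd'0).congr_of_eventuallyEq ?_
  have hQ : ∀ᶠ ζ in 𝓝 ζ, R.Q (moeb j (ζ ^ D.m j)) 1 ≠ 0 := by
    refine ContinuousAt.eventually_ne (g := fun ζ => R.Q (moeb j (ζ ^ D.m j)) 1) ?_ hPi
    exact (R.differentiable_Q.continuous.continuousAt (x := (moeb j (ζ ^ D.m j), 1))).comp
      (f := fun ζ => (moeb j (ζ ^ D.m j), (1 : ℂ))) (hd'0.continuousAt.prodMk continuousAt_const)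
  filter_upwards [hQ, (D.isOpen_dom j).mem_nhds hζ, isOpen_ne.mem_nhds h0] with ζ h1 h2 h3
  rw [Function.comp_apply, Function.comp_apply, D.param_of_mem h2 h3, pullback_point,
    ratio_of_ne h1]
  rfl

lemma exists_num_div_den (h : OnePoint ℂ) : ∃ (j : Fin 4) (t : ℂ), t ∈ slit ∧
    ratio (num j t) (den j t) = h := by
  by_cases hi : h = OnePoint.infty
  · exact ⟨2, 0, zero_mem_slit, by simp [den, ratio, hi]⟩
  · obtain ⟨z, rfl⟩ := OnePoint.ne_infty_iff_exists.1 hi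
    by_cases hz : z ∈ base
    · obtain ⟨j, hj⟩ := exists_coord_mem_cap hz
      refine ⟨j, coord j z, cap_subset_slit hj, ?_⟩
      rw [ratio_of_ne (den_ne_zero j (cap_subset_slit hj) (coord_ne_zero j hz))]
      exact congrArg _ (moeb_coord j hz)
    · simp only [base, mem_ofPred_eq] at hz
      by_cases h0 : z = 0
      · exact ⟨0, 0, zero_mem_slit, by simp [num, den, ratio, h0]⟩
      · by_cases h1 : z = 1
        · exact ⟨1, 0, zero_mem_slit, by simp [num, den, ratio, h1]⟩
        · have h2 : z = -1 := by
            by_contra h2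
            exact hz ⟨h0, h1, h2⟩
          exact ⟨3, 0, zero_mem_slit, by simp [num, den, ratio, h2]⟩

/-- The position in the sphere alone decides which marked point can serve as centre of a chart. Two
points with the same position can thus be put in charts with the same `j`, which is what the
Hausdorff property needs. -/
lemma pullback_id_eq_ratio {P : D.Surface} {j : Fin 4} {t : ℂ} (ht : t ∈ slit)
    (h : D.pullback SphereMap.id P = ratio (num j t) (den j t)) :
    ∃ e, ∃ ζ ∈ D.dom j, D.param j e ζ = P := by
  by_cases h0 : t = 0
  · subst h0
    obtain ⟨⟨z, hz⟩, e⟩ | ⟨j', q⟩ := P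
    · exfalso
      have h' : ratio z 1 = ratio (num j 0) (den j 0) := h
      rw [ratio_of_ne one_ne_zero, div_one, eq_comm, ratio_eq_coe_iff] at h'
      obtain ⟨h1, h2, h3⟩ := hz
      fin_cases j <;> simp [num, den] at h' <;> grind
    · obtain ⟨e, rfl⟩ := Quotient.exists_rep q
      have h' : ratio (num j' 0) (den j' 0) = ratio (num j 0) (den j 0) := h
      have hj : j' = j := by
        fin_cases j <;> fin_cases j' <;> simp [num, den, ratio] at h' <;> first | rfl | exfalso
        all_goals exact absurd h' (by norm_num)
      subst hj
      exact ⟨e, 0, D.zero_mem_dom j', D.param_zero j' e⟩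
  · rw [ratio_of_ne (den_ne_zero j ht h0)] at h
    obtain ⟨⟨z, hz⟩, e⟩ | ⟨j', q⟩ := P
    · have h' : ratio z 1 = (moeb j t : OnePoint ℂ) := h
      rw [ratio_of_ne one_ne_zero, div_one, OnePoint.coe_eq_coe] at h'
      subst h'
      obtain ⟨e', ζ, h1, h2⟩ := D.exists_param_eq j hz (by rwa [coord_moeb j ht h0]) e
      refine ⟨e', ζ, ?_, h2⟩
      rw [dom, mem_ofPred_eq, h1]
      rwa [coord_moeb j ht h0]
    · exfalso
      have h' : ratio (num j' 0) (den j' 0) = (moeb j t : OnePoint ℂ) := h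
      obtain ⟨h1, h2, h3⟩ := moeb_mem_base j ht h0
      rw [ratio_eq_coe_iff] at h'
      fin_cases j' <;> simp [num, den] at h' <;> grind

/-- Points with different positions are separated in the sphere. Points with the same position lie
in charts over the same marked point; these charts are disjoint if the centres differ, and otherwise
a rotation puts both points into one chart, where `ℂ` separates them. -/
lemma t2Space : T2Space D.Surface := by
  refine ⟨fun P Q hPQ => ?_⟩
  by_cases h : D.pullback SphereMap.id P = D.pullback SphereMap.id Q
  · obtain ⟨j, t, ht, hj⟩ := exists_num_div_den (D.pullback SphereMap.id P)
    obtain ⟨e, ζ, hζ, rfl⟩ := D.pullback_id_eq_ratio ht hj.symm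
    obtain ⟨e', ζ', hζ', rfl⟩ := D.pullback_id_eq_ratio ht (h.symm.trans hj.symm)
    by_cases he : (D.rot j).SameCycle e' e
    · obtain ⟨r, rfl⟩ := he
      obtain ⟨h1, h2⟩ := D.param_rotate e' r hζ
      rw [← h2] at hPQ ⊢
      have hne : ζ * exp (r * (2 * Real.pi * I) / D.m j) ≠ ζ' := fun h => hPQ (by rw [h])
      obtain ⟨u, v, hu, hv, hu', hv', huv⟩ := t2_separation hne
      have key : ∀ w, IsOpen w → IsOpen ((D.chart j e').source ∩ D.chart j e' ⁻¹' w) :=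
        fun w hw => (D.homeo j e').isOpen_inter_preimage hw
      refine ⟨_, _, key u hu, key v hv, ⟨⟨_, h1, rfl⟩, ?_⟩, ⟨⟨_, hζ', rfl⟩, ?_⟩, ?_⟩
      · rw [mem_preimage]
        exact ((D.chart j e').right_inv h1).symm ▸ hu'
      · rw [mem_preimage]
        exact ((D.chart j e').right_inv hζ').symm ▸ hv'
      · exact (huv.preimage _).mono inter_subset_right inter_subset_right
    · refine ⟨_, _, D.isOpen_image_param j e, D.isOpen_image_param j e', ⟨ζ, hζ, rfl⟩,
        ⟨ζ', hζ', rfl⟩, disjoint_left.2 ?_⟩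
      rintro _ ⟨ξ, hξ, rfl⟩ ⟨ξ', hξ', h⟩
      obtain ⟨r, hr, -⟩ := D.param_eq_param hξ hξ' h.symm
      exact he ⟨r, hr.symm⟩
  · obtain ⟨u, v, hu, hv, hu', hv', huv⟩ := t2_separation h
    have hc := D.continuous_pullback SphereMap.id
    exact ⟨_, _, hu.preimage hc, hv.preimage hc, hu', hv', huv.preimage _⟩

lemma isCompactRiemannSurface [Finite Ω] [Nonempty Ω]
    (h : ∀ e e' : Ω, ∃ g ∈ Subgroup.closure (range D.rot), g e = e') :
    IsCompactRiemannSurface D.Surface :=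
  ⟨D.t2Space, D.compactSpace, D.connectedSpace h, inferInstance⟩

/-- The path in the surface with given logarithmic coordinates near a marked point. -/
lemma exists_path (j : Fin 4) (e : Ω) {τ : unitInterval → ℂ} (hτ : Continuous τ)
    (hs : ∀ t, exp (τ t) ∈ slit) :
    ∃ γ : C(unitInterval, D.Surface), ∀ t,
      γ t = point (moeb j (exp (τ t))) (moeb_mem_base j (hs t) (exp_ne_zero _))
        (D.label j e (τ t)) := by
  refine ⟨⟨fun t => D.param j e (exp (τ t / D.m j)), ?_⟩, fun t => D.param_exp j e (hs t)⟩
  exact (D.continuousOn_param j e).comp_continuous (continuous_exp.comp (hτ.div_const _))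
    fun t => D.exp_div_mem_dom (hs t)

end GluingData

end

noncomputable section

/-! ### Two Belyi functions and their monodromy -/

open Complex Set Filter Topology FourPoint

/-- The rational function `-(h - 1)² / (4 h)`. -/
def beta1 : SphereMap where
  P a b := -(a - b) ^ 2
  Q a b := 4 * a * b
  deg := 2
  P_hom c a b := by ring
  Q_hom c a b := by ring
  differentiable_P := by fun_prop
  differentiable_Q := by fun_prop
  ne_zero a b h := by
    by_contra! h'
    obtain ⟨h1, h2⟩ := h'
    have h3 : a = b := by simpa [sub_eq_zero] using h1
    subst h3
    simp at h2 h
    exact h h2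

/-- The rational function `1 - h²`. -/
def beta2 : SphereMap where
  P a b := b ^ 2 - a ^ 2
  Q _ b := b ^ 2
  deg := 2
  P_hom c a b := by ring
  Q_hom c a b := by ring
  differentiable_P := by fun_prop
  differentiable_Q := by fun_prop
  ne_zero a b h := by
    by_contra! h'
    obtain ⟨h1, h2⟩ := h'
    have h3 : b = 0 := by simpa using h2
    subst h3
    simp at h1 h
    exact h h1

/-- The circle around `0` through `1 / 2`. -/
def circ (θ : ℝ) : ℂ := 1 / 2 * exp (2 * Real.pi * I * (θ : ℂ))

lemma circ_eq (θ : ℝ) : circ θ = 1 / 2 * exp (Real.pi * I * θ) ^ 2 := by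
  rw [circ, ← exp_nat_mul]
  congr 2
  push_cast
  ring

@[fun_prop]
lemma continuous_circ : Continuous circ := by unfold circ; fun_prop

lemma norm_circ (θ : ℝ) : ‖circ θ‖ = 1 / 2 := by
  have : 2 * Real.pi * I * (θ : ℂ) = ((2 * Real.pi * θ : ℝ) : ℂ) * I := by push_cast; ring
  rw [circ, this, norm_mul, norm_exp_ofReal_mul_I]
  simp

lemma circ_zero : circ 0 = 1 / 2 := by simp [circ]

lemma circ_one : circ 1 = 1 / 2 := by simp [circ, exp_two_pi_mul_I]

lemma one_sub_circ_mem (θ : ℝ) : 1 - circ θ ∈ slitPlane := by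
  left
  have h := abs_re_le_norm (circ θ)
  rw [norm_circ] at h
  have := le_of_abs_le h
  rw [sub_re, one_re]
  linarith

lemma one_sub_circ_ne_zero (θ : ℝ) : 1 - circ θ ≠ 0 := slitPlane_ne_zero (one_sub_circ_mem θ)

lemma re_exp_half_log_pos {z : ℂ} (hz : z ∈ slitPlane) : 0 < (exp (log z / 2)).re := by
  rw [exp_re]
  refine mul_pos (Real.exp_pos _) (Real.cos_pos_of_mem_Ioo ?_)
  have h1 := neg_pi_lt_arg z
  have h2 := (arg_le_pi z).lt_of_ne (mem_slitPlane_iff_arg.1 hz).1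
  have : (log z / 2).im = arg z / 2 := by rw [div_ofNat_im, log_im]
  rw [this]
  constructor <;> linarith

lemma exp_half_log_sq {z : ℂ} (hz : z ≠ 0) : exp (log z / 2) ^ 2 = z := by
  rw [← exp_nat_mul]
  push_cast
  rw [mul_div_cancel₀ _ two_ne_zero, exp_log hz]

lemma mem_slit_of_norm_lt_one {t : ℂ} (h : ‖t‖ < 1) : t ∈ slit :=
  fun _ => (abs_re_le_norm t).trans_lt h

/-- The positive square root of `1 / 2`. -/
def rootHalf : ℂ := exp (log (1 / 2) / 2)

lemma rootHalf_sq : rootHalf ^ 2 = 1 / 2 := exp_half_log_sq (by norm_num)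

lemma log_half : log (1 / 2 : ℂ) = (Real.log (1 / 2) : ℂ) := by
  rw [ofReal_log (by norm_num)]; push_cast; rfl

lemma rootHalf_eq : rootHalf = ((Real.exp (Real.log (1 / 2) / 2) : ℝ) : ℂ) := by
  rw [rootHalf, log_half]; push_cast; rfl

lemma rootHalf_mem_base : rootHalf ∈ base := by
  have h := rootHalf_sq
  refine ⟨?_, ?_, ?_⟩ <;> intro h' <;> rw [h'] at h <;> norm_num at h

lemma neg_rootHalf_mem_base : -rootHalf ∈ base := by
  have h := rootHalf_sq
  rw [← neg_sq] at h
  refine ⟨?_, ?_, ?_⟩ <;> intro h' <;> rw [h'] at h <;> norm_num at h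

lemma neg_I_mem_base : -I ∈ base :=
  ⟨neg_ne_zero.2 I_ne_zero, by simp [Complex.ext_iff], by simp [Complex.ext_iff]⟩

namespace GluingData

variable {Ω : Type} (D : GluingData Ω)

lemma exists_lift (R : SphereMap) (j : Fin 4) (e : Ω) {τ : ℝ → ℂ} (hτ : Continuous τ)
    (hs : ∀ t, exp (τ t) ∈ slit) {b : ℝ → ℂ}
    (hb : ∀ t, R.Q (num j (exp (τ t))) (den j (exp (τ t))) ≠ 0 ∧
      R.P (num j (exp (τ t))) (den j (exp (τ t))) =
        b t * R.Q (num j (exp (τ t))) (den j (exp (τ t))))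
    {h₀ h₁ : ℂ} (hh₀ : h₀ ∈ base) (hh₁ : h₁ ∈ base) {e₀ e₁ : Ω}
    (h0 : moeb j (exp (τ 0)) = h₀) (h1 : moeb j (exp (τ 1)) = h₁)
    (he0 : D.label j e (τ 0) = e₀) (he1 : D.label j e (τ 1) = e₁) :
    ∃ γ : C(unitInterval, D.Surface), γ 0 = point h₀ hh₀ e₀ ∧ γ 1 = point h₁ hh₁ e₁ ∧
      ∀ t : unitInterval, D.pullback R (γ t) = (b t : OnePoint ℂ) := by
  subst h0 h1 he0 he1
  obtain ⟨γ, hγ⟩ := D.exists_path j e (τ := fun t => τ t) (hτ.comp continuous_subtype_val)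
    fun t => hs t
  refine ⟨γ, ?_, ?_, fun t => ?_⟩
  · rw [hγ, point_eq_point]; exact ⟨rfl, rfl⟩
  · rw [hγ, point_eq_point]; exact ⟨rfl, rfl⟩
  · rw [hγ, pullback_point, ratio_moeb R j (hs t) (exp_ne_zero _), ratio_eq_coe_iff]
    exact hb t

/-! ### Explicit lifts of the two circles -/

/-- Logarithmic coordinates of the lifts by `beta2` of the circle around `0`. -/
def lift20 (c : ℂ) (θ : ℝ) : ℂ :=
  log (1 / 2) + c + 2 * Real.pi * I * θ - 2 * log (1 + exp (log (1 - circ θ) / 2))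

lemma one_add_mem_slitPlane (θ : ℝ) : 1 + exp (log (1 - circ θ) / 2) ∈ slitPlane := by
  left
  rw [add_re, one_re]
  linarith [re_exp_half_log_pos (one_sub_circ_mem θ)]

lemma continuous_lift20 (c : ℂ) : Continuous (lift20 c) := by
  have h1 : Continuous fun θ => log (1 - circ θ) :=
    (continuous_const.sub continuous_circ).clog one_sub_circ_mem
  have h2 : Continuous fun θ => log (1 + exp (log (1 - circ θ) / 2)) :=
    Continuous.clog (by fun_prop) one_add_mem_slitPlane
  unfold lift20
  fun_prop

lemma exp_lift20 (c : ℂ) (θ : ℝ) :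
    exp (lift20 c θ) = exp c * circ θ / (1 + exp (log (1 - circ θ) / 2)) ^ 2 := by
  rw [lift20, exp_sub, exp_add, exp_add, exp_log (by norm_num), two_mul (log _), exp_add,
    exp_log (slitPlane_ne_zero (one_add_mem_slitPlane θ)), circ, sq]
  ring

/-- For `s² = 1 - circ θ` one has `(1 - s) / (1 + s) = circ θ / (1 + s)²`. With `Re s > 0` the
logarithm of `1 + s` is continuous and returns to its initial value, so the whole expression turns
once around `0`. The sign `σ` serves both lifts: `h = s` has coordinate `-(1 - s) / (1 + s)` at `1`,
and `h = -s` has coordinate `(1 - s) / (1 + s)` at `-1`. -/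
lemma exp_lift20' {c : ℂ} {σ : ℂ} (hc : exp c = σ) (θ : ℝ) :
    ∃ s : ℂ, 0 < s.re ∧ s ^ 2 = 1 - circ θ ∧ s = exp (log (1 - circ θ) / 2) ∧
      exp (lift20 c θ) = σ * ((1 - s) / (1 + s)) := by
  refine ⟨exp (log (1 - circ θ) / 2), re_exp_half_log_pos (one_sub_circ_mem θ),
    exp_half_log_sq (one_sub_circ_ne_zero θ), rfl, ?_⟩
  have h1 := exp_half_log_sq (one_sub_circ_ne_zero θ)
  have h2 := slitPlane_ne_zero (one_add_mem_slitPlane θ)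
  have h3 : circ θ = 1 - exp (log (1 - circ θ) / 2) ^ 2 := by rw [h1]; ring
  rw [exp_lift20, hc]
  generalize exp (log (1 - circ θ) / 2) = s at *
  rw [h3, mul_div_assoc]
  congr 1
  rw [div_eq_div_iff (pow_ne_zero _ h2) h2]
  ring

lemma norm_one_sub_div_lt {s : ℂ} (hs : 0 < s.re) : ‖(1 - s) / (1 + s)‖ < 1 := by
  have h : 1 + s ≠ 0 := fun h => by
    have := congrArg re h
    rw [add_re, one_re, zero_re] at this
    linarith
  rw [norm_div, div_lt_one (norm_pos_iff.2 h), ← sq_lt_sq₀ (norm_nonneg _) (norm_nonneg _),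
    ← normSq_eq_norm_sq, ← normSq_eq_norm_sq, normSq_apply, normSq_apply]
  simp
  nlinarith

lemma lift20_zero (c : ℂ) : lift20 c 0 =
    ((Real.log (1 / 2) - 2 * Real.log (1 + Real.exp (Real.log (1 / 2) / 2)) : ℝ) : ℂ) + c := by
  have h1 : (1 : ℂ) - 1 / 2 = 1 / 2 := by norm_num
  have h2 : (1 : ℂ) + rootHalf = ((1 + Real.exp (Real.log (1 / 2) / 2) : ℝ) : ℂ) := by
    rw [rootHalf_eq]; push_cast; rfl
  have h3 : (0 : ℝ) ≤ 1 + Real.exp (Real.log (1 / 2) / 2) := by positivity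
  rw [lift20, circ_zero, h1, ← rootHalf, h2, ← ofReal_log h3, log_half]
  push_cast
  ring

lemma lift20_zero_im (c : ℂ) : (lift20 c 0).im = c.im := by
  rw [lift20_zero, add_im, ofReal_im, zero_add]

lemma lift20_one (c : ℂ) : lift20 c 1 = lift20 c 0 + (1 : ℤ) * (2 * Real.pi * I) := by
  rw [lift20, lift20, circ_one, circ_zero]
  push_cast
  ring

/-- The equation `1 - h² = circ θ` is solved by `h = ±s`, a closed loop around `1` or `-1` on which
the logarithmic coordinate grows by exactly `2πi`. Hence the end point differs from the starting
point by one turn. -/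
lemma exists_lift_beta2_zero (e : Ω) :
    (∃ γ : C(unitInterval, D.Surface), γ 0 = point rootHalf rootHalf_mem_base e ∧
      γ 1 = point rootHalf rootHalf_mem_base (D.rot 1 e) ∧
      ∀ t : unitInterval, D.pullback beta2 (γ t) = (circ t : OnePoint ℂ)) ∧
    (∃ γ : C(unitInterval, D.Surface), γ 0 = point (-rootHalf) neg_rootHalf_mem_base e ∧
      γ 1 = point (-rootHalf) neg_rootHalf_mem_base (D.rot 3 e) ∧
      ∀ t : unitInterval, D.pullback beta2 (γ t) = (circ t : OnePoint ℂ)) := by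
  have hpi := Real.pi_pos
  have hne : ∀ {s : ℂ}, 0 < s.re → 1 + s ≠ 0 := fun hs h => by
    have := congrArg re h
    rw [add_re, one_re, zero_re] at this
    linarith
  have h12 : (1 : ℂ) - 1 / 2 = 1 / 2 := by norm_num
  have hroot : exp (log (1 - circ 0) / 2) = rootHalf := by rw [circ_zero, h12]; rfl
  constructor
  · have h0 : moeb 1 (exp (lift20 (Real.pi * I) 0)) = rootHalf := by
      obtain ⟨s, hs, -, hs', ht⟩ := exp_lift20' exp_pi_mul_I 0
      rw [ht]
      rw [hroot] at hs'
      have := hne hs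
      rw [hs'] at this ⊢
      simp only [moeb, num, den]
      simp
      field_simp
      ring
    refine D.exists_lift beta2 1 e (continuous_lift20 (Real.pi * I)) (fun θ => ?_) (fun θ => ?_)
      rootHalf_mem_base rootHalf_mem_base h0 ?_ ?_ ?_
    · obtain ⟨s, hs, -, -, ht⟩ := exp_lift20' exp_pi_mul_I θ
      rw [ht]
      apply mem_slit_of_norm_lt_one
      rw [norm_mul, norm_neg, norm_one, one_mul]
      exact norm_one_sub_div_lt hs
    · obtain ⟨s, hs, hs2, -, ht⟩ := exp_lift20' exp_pi_mul_I θ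
      have hb : circ θ = 1 - s ^ 2 := by rw [hs2]; ring
      have := hne hs
      have hd : den 1 (exp (lift20 (Real.pi * I) θ)) = 2 / (1 + s) := by
        rw [ht]
        simp only [den]
        simp
        field_simp
        ring
      have hn : num 1 (exp (lift20 (Real.pi * I) θ)) = 2 * s / (1 + s) := by
        rw [ht]
        simp only [num]
        simp
        field_simp
        ring
      rw [hd, hn, hb]
      simp only [beta2]
      constructor
      · exact pow_ne_zero _ (div_ne_zero two_ne_zero this)
      · field_simp
    · rw [lift20_one, exp_add_int, h0]
    · apply label_of_mem_Icc <;> rw [lift20_zero_im] <;> simp <;> linarith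
    · rw [lift20_one, label_add, zpow_one]
      apply label_of_mem_Icc <;> rw [lift20_zero_im] <;> simp <;> linarith
  · have h0 : moeb 3 (exp (lift20 0 0)) = -rootHalf := by
      obtain ⟨s, hs, -, hs', ht⟩ := exp_lift20' exp_zero 0
      rw [ht]
      rw [hroot] at hs'
      have := hne hs
      rw [hs'] at this ⊢
      simp only [moeb, num, den]
      simp
      field_simp
      ring
    refine D.exists_lift beta2 3 e (continuous_lift20 0) (fun θ => ?_) (fun θ => ?_)
      neg_rootHalf_mem_base neg_rootHalf_mem_base h0 ?_ ?_ ?_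
    · obtain ⟨s, hs, -, -, ht⟩ := exp_lift20' exp_zero θ
      rw [ht]
      apply mem_slit_of_norm_lt_one
      rw [one_mul]
      exact norm_one_sub_div_lt hs
    · obtain ⟨s, hs, hs2, -, ht⟩ := exp_lift20' exp_zero θ
      have hb : circ θ = 1 - s ^ 2 := by rw [hs2]; ring
      have := hne hs
      have hd : den 3 (exp (lift20 0 θ)) = 2 / (1 + s) := by
        rw [ht]
        simp only [den]
        simp
        field_simp
        ring
      have hn : num 3 (exp (lift20 0 θ)) = -2 * s / (1 + s) := by
        rw [ht]
        simp only [num]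
        simp
        field_simp
        ring
      rw [hd, hn, hb]
      simp only [beta2]
      constructor
      · exact pow_ne_zero _ (div_ne_zero two_ne_zero this)
      · field_simp
    · rw [lift20_one, exp_add_int, h0]
    · apply label_of_mem_Icc <;> rw [lift20_zero_im] <;> simp <;> linarith
    · rw [lift20_one, label_add, zpow_one]
      apply label_of_mem_Icc <;> rw [lift20_zero_im] <;> simp <;> linarith

/-- Here `h² = circ θ`, so `h` makes a half-turn around `0`. The first one passes through the upper
half-plane and keeps the label. The second passes below and returns to the positive axis, where real
points are labelled by the upper half-plane, so it completes a turn. -/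
lemma exists_lift_beta2_one (e : Ω) :
    (∃ γ : C(unitInterval, D.Surface), γ 0 = point rootHalf rootHalf_mem_base e ∧
      γ 1 = point (-rootHalf) neg_rootHalf_mem_base e ∧
      ∀ t : unitInterval, D.pullback beta2 (γ t) = ((1 - circ t : ℂ) : OnePoint ℂ)) ∧
    (∃ γ : C(unitInterval, D.Surface), γ 0 = point (-rootHalf) neg_rootHalf_mem_base e ∧
      γ 1 = point rootHalf rootHalf_mem_base (D.rot 0 e) ∧
      ∀ t : unitInterval, D.pullback beta2 (γ t) = ((1 - circ t : ℂ) : OnePoint ℂ)) := by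
  have hpi := Real.pi_pos
  have key : ∀ (σ : ℂ) (c : ℂ), exp c = σ → σ ^ 2 = 1 → ∀ θ : ℝ,
      exp (log (1 / 2) / 2 + c + Real.pi * I * θ) ∈ slit ∧
      exp (log (1 / 2) / 2 + c + Real.pi * I * θ) ^ 2 = circ θ := by
    intro σ c hc hσ θ
    have h1 : exp (log (1 / 2) / 2 + c + Real.pi * I * θ) =
        rootHalf * σ * exp (Real.pi * I * θ) := by
      rw [exp_add, exp_add, hc, rootHalf]
    rw [h1]
    have h3 : (rootHalf * σ * exp (Real.pi * I * θ)) ^ 2 = circ θ := by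
      rw [mul_pow, mul_pow, rootHalf_sq, hσ, circ_eq, mul_one]
    refine ⟨mem_slit_of_norm_lt_one ?_, h3⟩
    have h4 := congrArg norm h3
    rw [norm_circ, norm_pow] at h4
    nlinarith [norm_nonneg (rootHalf * σ * exp (Real.pi * I * θ))]
  have hdiv : (log (1 / 2 : ℂ) / 2).im = 0 := by
    rw [log_half, div_ofNat_im, ofReal_im, zero_div]
  constructor
  · refine D.exists_lift beta2 0 e (b := fun θ => 1 - circ θ)
      (τ := fun θ => log (1 / 2) / 2 + 0 + Real.pi * I * θ)
      (by fun_prop) (fun θ => (key 1 0 exp_zero (by norm_num) θ).1) (fun θ => ?_)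
      rootHalf_mem_base neg_rootHalf_mem_base ?_ ?_ ?_ ?_
    · rw [← (key 1 0 exp_zero (by norm_num) θ).2]
      simp [beta2, num, den]
    · simp [moeb, num, den, rootHalf]
    · simp only [moeb, num, den, exp_add]
      simp [rootHalf]
    · apply label_of_mem_Icc <;> simp only [add_im, hdiv] <;> simp <;> linarith
    · apply label_of_mem_Icc <;> simp only [add_im, hdiv] <;> simp <;> linarith
  · refine D.exists_lift beta2 0 e (b := fun θ => 1 - circ θ)
      (τ := fun θ => log (1 / 2) / 2 + Real.pi * I + Real.pi * I * θ)
      (by fun_prop) (fun θ => (key (-1) _ exp_pi_mul_I (by norm_num) θ).1) (fun θ => ?_)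
      neg_rootHalf_mem_base rootHalf_mem_base ?_ ?_ ?_ ?_
    · rw [← (key (-1) _ exp_pi_mul_I (by norm_num) θ).2]
      simp [beta2, num, den]
    · simp only [moeb, num, den, exp_add]
      simp [rootHalf]
    · simp only [moeb, num, den, exp_add]
      simp [rootHalf]
    · apply label_of_mem_Icc <;> simp only [add_im, hdiv] <;> simp <;> linarith
    · have h1 : log (1 / 2) / 2 + Real.pi * I + Real.pi * I * ((1 : ℝ) : ℂ) =
          log (1 / 2) / 2 + (1 : ℤ) * (2 * Real.pi * I) := by push_cast; ring
      simp only [h1, label_add, zpow_one]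
      apply label_of_mem_Icc <;> rw [hdiv]
      exact hpi.le

/-- Logarithmic coordinates of the lifts by `beta1` of the circles. -/
def lift1 (c : ℂ) (θ : ℝ) : ℂ :=
  c + log (1 / 2) / 2 + Real.pi * I * θ - log (1 - circ θ) / 2

lemma continuous_lift1 (c : ℂ) : Continuous (lift1 c) := by
  have h1 : Continuous fun θ => log (1 - circ θ) :=
    (continuous_const.sub continuous_circ).clog one_sub_circ_mem
  unfold lift1
  fun_prop

lemma exp_lift1_sq {c : ℂ} (hc : exp c ^ 2 = -1) (θ : ℝ) :
    exp (lift1 c θ) ^ 2 * (1 - circ θ) = -circ θ := by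
  have h := one_sub_circ_ne_zero θ
  rw [lift1, exp_sub, exp_add, exp_add, div_pow, exp_half_log_sq h, div_mul_cancel₀ _ h, mul_pow,
    mul_pow, hc, exp_half_log_sq (by norm_num), circ_eq]
  ring

/-- If `t` is real with `t² ≥ 1`, taking norms in `(t² - 1) circ θ = t²` gives `t² - 1 = 2t²`, which
is impossible. -/
lemma exp_lift1_mem_slit {c : ℂ} (hc : exp c ^ 2 = -1) (θ : ℝ) : exp (lift1 c θ) ∈ slit := by
  intro him
  have h := exp_lift1_sq hc θ
  by_contra! hle
  obtain ⟨x, hx⟩ : ∃ x : ℝ, exp (lift1 c θ) = x := ⟨_, Complex.ext rfl (by simpa using him)⟩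
  rw [hx, ofReal_re] at hle
  rw [hx] at h
  have h1 : ((x ^ 2 - 1 : ℝ) : ℂ) * circ θ = ((x ^ 2 : ℝ) : ℂ) := by
    push_cast
    linear_combination -h
  have h2 := congrArg norm h1
  have hx1 : 1 ≤ x ^ 2 := (one_le_sq_iff_one_le_abs x).2 hle
  rw [norm_mul, norm_circ, norm_real, norm_real, Real.norm_of_nonneg (by linarith),
    Real.norm_of_nonneg (by linarith)] at h2
  linarith

lemma lift1_zero (c : ℂ) : lift1 c 0 = c := by
  have h1 : (1 : ℂ) - 1 / 2 = 1 / 2 := by norm_num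
  rw [lift1, circ_zero, h1]
  simp

lemma lift1_one (c : ℂ) : lift1 c 1 = c + Real.pi * I := by
  have h1 : (1 : ℂ) - 1 / 2 = 1 / 2 := by norm_num
  rw [lift1, circ_one, h1]
  push_cast
  ring

/-- In the coordinate `t` at the marked point `1` the function is `-t² / (1 - t²)`. -/
lemma beta1_eq_one {t b : ℂ} (h : t ^ 2 * (1 - b) = -b) :
    beta1.Q (num 1 t) (den 1 t) ≠ 0 ∧
      beta1.P (num 1 t) (den 1 t) = b * beta1.Q (num 1 t) (den 1 t) := by
  have ht : 1 - t ^ 2 ≠ 0 := fun h0 => by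
    have : t ^ 2 = 1 := by linear_combination -h0
    rw [this] at h
    have : (1 : ℂ) = 0 := by linear_combination h
    exact one_ne_zero this
  have e1 : beta1.Q (num 1 t) (den 1 t) = 4 * (1 - t ^ 2) := by
    simp [beta1, num, den]; ring
  have e2 : beta1.P (num 1 t) (den 1 t) = -4 * t ^ 2 := by
    simp [beta1, num, den]; ring
  rw [e1, e2]
  refine ⟨mul_ne_zero (by norm_num) ht, ?_⟩
  linear_combination -4 * h

/-- In the coordinate `t` at `-1` the function is `1 / (1 - t²)`, which is one minus the expression
at `1`. The same path `t` therefore lifts the circle around `1`. -/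
lemma beta1_eq_three {t b : ℂ} (h : t ^ 2 * (1 - b) = -b) :
    beta1.Q (num 3 t) (den 3 t) ≠ 0 ∧
      beta1.P (num 3 t) (den 3 t) = (1 - b) * beta1.Q (num 3 t) (den 3 t) := by
  have ht : 1 - t ^ 2 ≠ 0 := fun h0 => by
    have : t ^ 2 = 1 := by linear_combination -h0
    rw [this] at h
    have : (1 : ℂ) = 0 := by linear_combination h
    exact one_ne_zero this
  have e1 : beta1.Q (num 3 t) (den 3 t) = 4 * (t ^ 2 - 1) := by
    simp [beta1, num, den]; ring
  have e2 : beta1.P (num 3 t) (den 3 t) = -4 := by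
    simp [beta1, num, den]; ring
  rw [e1, e2]
  refine ⟨mul_ne_zero (by norm_num) fun h0 => ht (by linear_combination -h0), ?_⟩
  linear_combination -4 * h

lemma moeb_neg_I (j : Fin 4) : moeb j (-I) = -I := by
  have h : -I ∈ slit := by simp [slit]
  have hd := den_ne_zero j h (neg_ne_zero.2 I_ne_zero)
  rw [moeb, div_eq_iff hd]
  fin_cases j <;> simp [num, den, mul_add]
  all_goals ring

lemma exp_three_pi : exp (Real.pi / 2 * I + Real.pi * I) = -I := by
  rw [exp_add, exp_pi_div_two_mul_I, exp_pi_mul_I]; ring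

/-- Both circles lift to half-turns between `I` and `-I` around the ramified marked point: from `I`
down across the interval `j - 1`, and from `-I` up across the interval `j`. -/
lemma exists_lift_beta1 (j : Fin 4) {b : ℝ → ℂ}
    (hb : ∀ (t : ℂ) (θ : ℝ), t ^ 2 * (1 - circ θ) = -circ θ →
      beta1.Q (num j t) (den j t) ≠ 0 ∧
        beta1.P (num j t) (den j t) = b θ * beta1.Q (num j t) (den j t)) (e : Ω) :
    (∃ γ : C(unitInterval, D.Surface), γ 0 = point I I_mem_base e ∧
      γ 1 = point (-I) neg_I_mem_base (D.c (j - 1) e) ∧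
      ∀ t : unitInterval, D.pullback beta1 (γ t) = (b t : OnePoint ℂ)) ∧
    (∃ γ : C(unitInterval, D.Surface), γ 0 = point (-I) neg_I_mem_base e ∧
      γ 1 = point I I_mem_base ((D.c j)⁻¹ e) ∧
      ∀ t : unitInterval, D.pullback beta1 (γ t) = (b t : OnePoint ℂ)) := by
  have hpi := Real.pi_pos
  have hc1 : exp (Real.pi / 2 * I) ^ 2 = -1 := by rw [exp_pi_div_two_mul_I, I_sq]
  have hc2 : exp (Real.pi / 2 * I + Real.pi * I) ^ 2 = -1 := by
    rw [exp_three_pi, neg_sq, I_sq]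
  have l1 : ∀ e, D.label j e (Real.pi / 2 * I) = e := fun e => by
    apply label_of_mem_Icc <;> simp <;> linarith
  have l2 : ∀ e, D.label j e (Real.pi / 2 * I + Real.pi * I) = D.c (j - 1) e := fun e => by
    apply label_of_mem_Ioo <;> simp <;> linarith
  constructor
  · refine D.exists_lift beta1 j e (continuous_lift1 (Real.pi / 2 * I)) (exp_lift1_mem_slit hc1)
      (fun θ => hb _ θ (exp_lift1_sq hc1 θ)) _ _ ?_ ?_ ?_ ?_
    · rw [lift1_zero, exp_pi_div_two_mul_I, moeb_I]
    · rw [lift1_one, exp_three_pi, moeb_neg_I]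
    · rw [lift1_zero, l1]
    · rw [lift1_one, l2]
  · have e1 : Real.pi / 2 * I + Real.pi * I + Real.pi * I =
        Real.pi / 2 * I + (1 : ℤ) * (2 * Real.pi * I) := by push_cast; ring
    -- The chart is started on the upper half-plane from which `e` is reached across the interval `j
    -- - 1`. After a full turn the label is `rot j * (c (j - 1))⁻¹ = (c j)⁻¹` applied to `e`.
    refine D.exists_lift beta1 j ((D.c (j - 1))⁻¹ e) (continuous_lift1 _) (exp_lift1_mem_slit hc2)
      (fun θ => hb _ θ (exp_lift1_sq hc2 θ)) _ _ ?_ ?_ ?_ ?_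
    · rw [lift1_zero, exp_three_pi, moeb_neg_I]
    · rw [lift1_one, e1, exp_add_int, exp_pi_div_two_mul_I, moeb_I]
    · rw [lift1_zero, l2, ← Equiv.Perm.mul_apply, mul_inv_cancel, Equiv.Perm.one_apply]
    · rw [lift1_one, e1, label_add, l1, zpow_one, rot, ← Equiv.Perm.mul_apply, mul_assoc,
        mul_inv_cancel, mul_one]

/-! ### The Belyi property and the fibres over `1/2` -/

lemma isBelyi_beta1 [Nonempty Ω] : IsBelyi (D.pullback beta1) := by
  refine D.isBelyi_pullback _ (fun j => ?_) (fun h hh _ => ?_) ?_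
  · fin_cases j <;> simp [beta1, num, den, ratio]
    norm_num
  · obtain ⟨h0, h1, h2⟩ := hh
    -- The function is `(2 - h - h⁻¹) / 4`, whose derivative vanishes only at the marked points
    -- `±1`.
    refine ⟨-(1 - (h ^ 2)⁻¹) / 4, ?_, ?_⟩
    · rw [Ne, div_eq_zero_iff, not_or]
      refine ⟨?_, by norm_num⟩
      rw [neg_eq_zero, sub_eq_zero, eq_comm, inv_eq_one, sq_eq_one_iff, not_or]
      exact ⟨h1, h2⟩
    · have hd : HasDerivAt (fun h : ℂ => (2 - h - h⁻¹) / 4) (-(1 - (h ^ 2)⁻¹) / 4) h := by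
        exact ((((hasDerivAt_id h).const_sub 2).sub (hasDerivAt_inv h0)).div_const 4).congr_deriv
          (by ring)
      refine hd.congr_of_eventuallyEq ?_
      filter_upwards [isOpen_ne.mem_nhds h0] with h (hh : h ≠ 0)
      simp only [beta1]
      field_simp
      ring
  · simp [beta1, num, den, ratio]

lemma isBelyi_beta2 [Nonempty Ω] : IsBelyi (D.pullback beta2) := by
  refine D.isBelyi_pullback _ (fun j => ?_) (fun h hh _ => ?_) ?_
  · fin_cases j <;> simp [beta2, num, den, ratio]
  · refine ⟨-(2 * h), neg_ne_zero.2 (mul_ne_zero two_ne_zero hh.1), ?_⟩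
    simp only [beta2, one_pow, div_one]
    simpa using (hasDerivAt_pow 2 h).const_sub 1
  · simp [beta2, num, den, ratio]

/-- A fibre that consists of the points over two unmarked points. -/
def fibreEquiv (R : SphereMap) {w : OnePoint ℂ} {h₁ h₂ : ℂ} (hh₁ : h₁ ∈ base) (hh₂ : h₂ ∈ base)
    (hne : h₁ ≠ h₂) (hpoint : ∀ h ∈ base, ratio (R.P h 1) (R.Q h 1) = w ↔ h = h₁ ∨ h = h₂)
    (hmark : ∀ j, ratio (R.P (num j 0) (den j 0)) (R.Q (num j 0) (den j 0)) ≠ w) :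
    Ω ⊕ Ω ≃ {P : D.Surface // D.pullback R P = w} :=
  Equiv.ofBijective
    (Sum.elim (fun e => ⟨point h₁ hh₁ e, (hpoint h₁ hh₁).2 (Or.inl rfl)⟩)
      (fun e => ⟨point h₂ hh₂ e, (hpoint h₂ hh₂).2 (Or.inr rfl)⟩)) <| by
    constructor
    · rintro (e | e) (e' | e') h <;>
        replace h := (D.point_eq_point).1 (congrArg Subtype.val h)
      · rw [h.2]
      · exact absurd h.1 hne
      · exact absurd h.1.symm hne
      · rw [h.2]
    · rintro ⟨⟨⟨h, hh⟩, e⟩ | ⟨j, q⟩, hP⟩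
      · rcases (hpoint h hh).1 hP with rfl | rfl
        · exact ⟨Sum.inl e, rfl⟩
        · exact ⟨Sum.inr e, rfl⟩
      · exact absurd hP (hmark j)

variable {Ω' : Type} (ℋ : Hypermap Ω') (φ : Ω' ≃ Ω ⊕ Ω)

/-- The fibre of `-(h - 1)² / (4h)` over `1/2` is `±I`, so the edges are the upper half-planes
together with the lower ones, and the monodromy consists of crossings of intervals. -/
lemma isDessinOn_beta1 [Nonempty Ω]
    (hx : ∀ e, φ (ℋ.x e) = Sum.elim (fun f => Sum.inr (D.c 0 f))
      (fun f => Sum.inl ((D.c 1)⁻¹ f)) (φ e))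
    (hy : ∀ e, φ (ℋ.y e) = Sum.elim (fun f => Sum.inr (D.c 2 f))
      (fun f => Sum.inl ((D.c 3)⁻¹ f)) (φ e)) :
    IsDessinOn (D.pullback beta1) ℋ := by
  have hne : I ≠ -I := by simp [Complex.ext_iff]; norm_num
  refine ⟨D.isBelyi_beta1, φ.trans (D.fibreEquiv beta1 I_mem_base neg_I_mem_base hne ?_ ?_),
    fun e => ?_⟩
  · intro h hh
    rw [ratio_eq_coe_iff]
    have e1 : (beta1.Q h 1 ≠ 0 ∧ beta1.P h 1 = 1 / 2 * beta1.Q h 1) ↔ h ^ 2 = I ^ 2 := by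
      have := hh.1
      simp only [beta1, I_sq]
      constructor
      · rintro ⟨-, h1⟩
        linear_combination -h1
      · intro h1
        exact ⟨by simpa using this, by linear_combination -h1⟩
    rw [e1, sq_eq_sq_iff_eq_or_eq_neg]
  · intro j
    rw [Ne, ratio_eq_coe_iff]
    fin_cases j <;> simp [beta1, num, den]
    norm_num
  · have l1 := D.exists_lift_beta1 1 (b := circ) (fun t θ h => beta1_eq_one h)
    have l3 := D.exists_lift_beta1 3 (b := fun θ => 1 - circ θ) (fun t θ h => beta1_eq_three h)
    simp only [Equiv.trans_apply, hx, hy]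
    rcases φ e with f | f
    · exact ⟨(l1 f).1, (l3 f).1⟩
    · exact ⟨(l1 f).2, (l3 f).2⟩

/-- The fibre of `1 - h²` over `1/2` consists of the two square roots of `1/2`. Both are real, so
each contributes one point for every upper half-plane. -/
lemma isDessinOn_beta2 [Nonempty Ω]
    (hx : ∀ e, φ (ℋ.x e) = Sum.elim (fun f => Sum.inl (D.rot 1 f))
      (fun f => Sum.inr (D.rot 3 f)) (φ e))
    (hy : ∀ e, φ (ℋ.y e) = Sum.elim (fun f => Sum.inr f)
      (fun f => Sum.inl (D.rot 0 f)) (φ e)) :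
    IsDessinOn (D.pullback beta2) ℋ := by
  have hne : rootHalf ≠ -rootHalf := fun h => rootHalf_mem_base.1 (self_eq_neg.1 h)
  refine ⟨D.isBelyi_beta2,
    φ.trans (D.fibreEquiv beta2 rootHalf_mem_base neg_rootHalf_mem_base hne ?_ ?_), fun e => ?_⟩
  · intro h hh
    rw [ratio_eq_coe_iff]
    have e1 : (beta2.Q h 1 ≠ 0 ∧ beta2.P h 1 = 1 / 2 * beta2.Q h 1) ↔ h ^ 2 = rootHalf ^ 2 := by
      rw [rootHalf_sq]
      simp only [beta2]
      constructor
      · rintro ⟨-, h1⟩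
        linear_combination -h1
      · intro h1
        exact ⟨by simp, by linear_combination -h1⟩
    rw [e1, sq_eq_sq_iff_eq_or_eq_neg]
  · intro j
    rw [Ne, ratio_eq_coe_iff]
    fin_cases j <;> simp [beta2, num, den]
  · simp only [Equiv.trans_apply, hx, hy]
    rcases φ e with f | f
    · exact ⟨(D.exists_lift_beta2_zero f).1, (D.exists_lift_beta2_one f).1⟩
    · exact ⟨(D.exists_lift_beta2_zero f).2, (D.exists_lift_beta2_one f).2⟩

end GluingData

end

noncomputable section

/-! ### Regular hypermaps -/

namespace Hypermap

variable {Q : Type} [Group Q]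

lemma mulRight_mem_closure {a b q : Q} (hq : q ∈ Subgroup.closure {a, b}) :
    Equiv.mulRight q ∈ Subgroup.closure {Equiv.mulRight a, Equiv.mulRight b} := by
  induction hq using Subgroup.closure_induction with
  | mem x hx =>
    apply Subgroup.subset_closure
    rcases hx with rfl | rfl
    · exact Or.inl rfl
    · exact Or.inr rfl
  | one => rw [Equiv.mulRight_one]; exact one_mem _
  | mul x y _ _ hx hy => rw [Equiv.mulRight_mul]; exact mul_mem hy hx
  | inv x _ hx => rw [← Equiv.inv_mulRight]; exact inv_mem hx

lemma orderOf_mulRight (q : Q) : orderOf (Equiv.mulRight q) = orderOf q := by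
  rw [orderOf_eq_orderOf_iff]
  intro k
  rw [Equiv.pow_mulRight]
  constructor
  · intro h
    simpa using Equiv.congr_fun h 1
  · intro h
    rw [h, Equiv.mulRight_one]

variable [Finite Q]

/-- The hypermap of right multiplications by two generators of a finite group. -/
def ofGroup (a b : Q) (h : Subgroup.closure {a, b} = ⊤) : Hypermap Q where
  x := Equiv.mulRight a
  y := Equiv.mulRight b
  finite := inferInstance
  nonempty := ⟨1⟩
  transitive e f := ⟨Equiv.mulRight (e⁻¹ * f), mulRight_mem_closure (h ▸ Subgroup.mem_top _),
    by simp⟩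

variable {a b : Q} (h : Subgroup.closure {a, b} = ⊤)

lemma mulLeft_mem_aut (q : Q) : Equiv.mulLeft q ∈ (ofGroup a b h).Aut := by
  rw [Aut, Subgroup.centralizer_closure, Subgroup.mem_centralizer_iff]
  rintro g (rfl | rfl) <;> ext e <;> simp [ofGroup, mul_assoc]

/-- The monodromy group contains every right multiplication, and a permutation commuting with all of
them is determined by its value at `1`. -/
lemma apply_eq_of_mem_aut {σ : Equiv.Perm Q} (hσ : σ ∈ (ofGroup a b h).Aut) (q : Q) :
    σ q = σ 1 * q := by
  have h1 := Subgroup.mem_centralizer_iff.1 hσ (Equiv.mulRight q)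
    (mulRight_mem_closure (h ▸ Subgroup.mem_top q))
  simpa using (Equiv.congr_fun h1 1).symm

lemma isRegular_ofGroup : (ofGroup a b h).IsRegular := fun e f =>
  ⟨Equiv.mulLeft (f * e⁻¹), mulLeft_mem_aut h _, by simp⟩

/-- The automorphisms of a regular hypermap are the left multiplications. -/
def autEquiv : (ofGroup a b h).Aut ≃* Q where
  toFun σ := σ.1 1
  invFun q := ⟨Equiv.mulLeft q, mulLeft_mem_aut h q⟩
  left_inv σ := Subtype.ext (Equiv.ext fun q => (apply_eq_of_mem_aut h σ.2 q).symm)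
  right_inv q := by simp
  map_mul' σ τ := apply_eq_of_mem_aut h σ.2 (τ.1 1)

lemma z_ofGroup : (ofGroup a b h).z = (Equiv.mulRight (a * b))⁻¹ := by
  rw [z, Equiv.mulRight_mul]; rfl

lemma hasType_ofGroup : (ofGroup a b h).HasType (orderOf a) (orderOf b) (orderOf (a * b)) := by
  refine ⟨orderOf_mulRight a, orderOf_mulRight b, ?_⟩
  rw [z_ofGroup, orderOf_inv, orderOf_mulRight]

/-- The cycles are the left cosets of the cyclic subgroup generated by `q`. -/
lemma numCycles_mulRight (q : Q) : numCycles (Equiv.mulRight q) * orderOf q = Nat.card Q := by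
  have hs : Equiv.Perm.SameCycle.setoid (Equiv.mulRight q) =
      QuotientGroup.leftRel (Subgroup.zpowers q) := by
    ext e f
    rw [QuotientGroup.leftRel_apply, Subgroup.mem_zpowers_iff]
    refine exists_congr fun k => ?_
    rw [Equiv.zpow_mulRight, Equiv.coe_mulRight, eq_inv_mul_iff_mul_eq]
  rw [numCycles, hs, ← Nat.card_zpowers]
  exact (Subgroup.card_eq_card_quotient_mul_card_subgroup _).symm

lemma numCycles_inv_mulRight (q : Q) :
    numCycles (Equiv.mulRight q)⁻¹ * orderOf q = Nat.card Q := by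
  rw [Equiv.inv_mulRight, ← orderOf_inv, numCycles_mulRight]

lemma hasGenus_ofGroup {g c₁ c₂ c₃ : ℕ} (h1 : c₁ * orderOf a = Nat.card Q)
    (h2 : c₂ * orderOf b = Nat.card Q) (h3 : c₃ * orderOf (a * b) = Nat.card Q)
    (hg : (c₁ : ℤ) + c₂ - Nat.card Q + c₃ = 2 - 2 * g) : (ofGroup a b h).HasGenus g := by
  have key : ∀ {q : Q} {c d : ℕ}, c * orderOf q = Nat.card Q → d * orderOf q = Nat.card Q → d = c :=
    fun {q} {c d} hc hd => Nat.eq_of_mul_eq_mul_right (orderOf_pos q) (hd.trans hc.symm)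
  rw [HasGenus, z_ofGroup, show (ofGroup a b h).x = Equiv.mulRight a from rfl,
    show (ofGroup a b h).y = Equiv.mulRight b from rfl, key h1 (numCycles_mulRight a),
    key h2 (numCycles_mulRight b), key h3 (numCycles_inv_mulRight (a * b)), hg]

end Hypermap

end

noncomputable section

/-! ### The dessins of a finite group generated by three elements -/

/-- The cyclic group of order two. -/
abbrev C2 : Type := Multiplicative (ZMod 2)

/-- The generator of the cyclic group of order two. -/
def sigma : C2 := Multiplicative.ofAdd 1

lemma sigma_mul_sigma : sigma * sigma = 1 := by decide

lemma sigma_ne_one : sigma ≠ 1 := by decide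

lemma eq_one_or_eq_sigma (s : C2) : s = 1 ∨ s = sigma := by revert s; decide

/-- The gluing data given by right multiplications in a finite group. -/
def GluingData.ofGroup {N : Type} [Group N] [Finite N] (γ : Fin 4 → N) : GluingData N where
  c j := Equiv.mulRight (γ j)
  m j := orderOf (γ (j - 1) * (γ j)⁻¹)
  m_pos j := orderOf_pos _
  zpow_apply_eq_iff j k e := by
    rw [Equiv.inv_mulRight, ← Equiv.mulRight_mul, Equiv.zpow_mulRight, orderOf_dvd_iff_zpow_eq_one]
    simp

namespace GluingData

variable {N : Type} [Group N] [Finite N] (γ : Fin 4 → N)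

lemma ofGroup_c (j : Fin 4) (e : N) : (ofGroup γ).c j e = e * γ j := rfl

lemma ofGroup_c_inv (j : Fin 4) (e : N) : ((ofGroup γ).c j)⁻¹ e = e * (γ j)⁻¹ := rfl

lemma ofGroup_rot (j : Fin 4) : (ofGroup γ).rot j = Equiv.mulRight (γ (j - 1) * (γ j)⁻¹) := by
  rw [Equiv.mulRight_mul, ← Equiv.inv_mulRight]
  rfl

lemma ofGroup_transitive
    (h : Subgroup.closure (Set.range fun j => γ (j - 1) * (γ j)⁻¹) = ⊤) (e e' : N) :
    ∃ g ∈ Subgroup.closure (Set.range (ofGroup γ).rot), g e = e' := by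
  have key : ∀ q ∈ Subgroup.closure (Set.range fun j => γ (j - 1) * (γ j)⁻¹),
      Equiv.mulRight q ∈ Subgroup.closure (Set.range (ofGroup γ).rot) := by
    intro q hq
    induction hq using Subgroup.closure_induction with
    | mem x hx =>
      obtain ⟨j, rfl⟩ := hx
      exact Subgroup.subset_closure ⟨j, ofGroup_rot γ j⟩
    | one => rw [Equiv.mulRight_one]; exact one_mem _
    | mul x y _ _ hx hy => rw [Equiv.mulRight_mul]; exact mul_mem hy hx
    | inv x _ hx => rw [← Equiv.inv_mulRight]; exact inv_mem hx
  exact ⟨_, key (e⁻¹ * e') (h ▸ Subgroup.mem_top _), by simp⟩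

end GluingData

/-! ### Generating triples and their common covering surface -/

/-- A finite group generated by elements of orders `2`, `2n`, `4n` with product one, with a
subgroup of index two that contains precisely the second of them. -/
structure GeneratingTriple {G : Type} [Group G] (H : Subgroup G) (n : ℕ) (x y z : G) : Prop where
  index : H.index = 2
  order_x : orderOf x = 2
  order_y : orderOf y = 2 * n
  order_z : orderOf z = 4 * n
  mul_eq_one : x * y * z = 1
  x_notMem : x ∉ H
  y_mem : y ∈ H
  closure_eq : Subgroup.closure {y ^ 2, z ^ 2, z * y ^ 2 * z⁻¹} = H

namespace GeneratingTriple

variable {G : Type} [Group G] {H : Subgroup G} {n : ℕ} {x y z : G}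

lemma x_sq (t : GeneratingTriple H n x y z) : x ^ 2 = 1 := t.order_x ▸ pow_orderOf_eq_one x

lemma x_inv (t : GeneratingTriple H n x y z) : x⁻¹ = x :=
  inv_eq_of_mul_eq_one_left (by rw [← sq, t.x_sq])

lemma y_mul_z (t : GeneratingTriple H n x y z) : y * z = x := by
  have h := t.mul_eq_one
  rw [mul_assoc] at h
  rw [eq_inv_of_mul_eq_one_right h, t.x_inv]

lemma z_mul_x (t : GeneratingTriple H n x y z) : z * x = y⁻¹ := by
  have h : x * y = z⁻¹ := eq_inv_of_mul_eq_one_left t.mul_eq_one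
  rw [eq_inv_iff_mul_eq_one, mul_assoc, h, mul_inv_cancel]

/-- This says that conjugation by `z` takes the square of `x y x⁻¹` to `y²`, the turn around the
marked point `1`. Together with the next two identities it matches the crossings with the monodromy
of the first dessin. -/
lemma conj_sq (t : GeneratingTriple H n x y z) :
    z * (x * y * x⁻¹) * (x * y * x⁻¹) = y ^ 2 * z := by
  calc z * (x * y * x⁻¹) * (x * y * x⁻¹) = (z * x) * y * y * x⁻¹ := by group
    _ = y * x := by rw [t.z_mul_x, t.x_inv]; group
    _ = y ^ 2 * z := by rw [← t.y_mul_z, sq, mul_assoc]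

lemma z_mul_y (t : GeneratingTriple H n x y z) :
    z * y ^ 2 * z * (z * (x * y * x⁻¹)) = z * y := by
  calc z * y ^ 2 * z * (z * (x * y * x⁻¹)) = z * y ^ 2 * z * ((z * x) * y * x⁻¹) := by group
    _ = z * y ^ 2 * z * x := by rw [t.z_mul_x, t.x_inv]; group
    _ = z * y := by rw [mul_assoc (z * y ^ 2), t.z_mul_x]; group

lemma z_mul_conj_mul_y (t : GeneratingTriple H n x y z) : z * (x * y * x⁻¹) * y = z⁻¹ := by
  calc z * (x * y * x⁻¹) * y = (z * x) * y * x⁻¹ * y := by group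
    _ = x * y * z * z⁻¹ := by rw [t.z_mul_x, t.x_inv]; group
    _ = z⁻¹ := by rw [t.mul_eq_one, one_mul]

lemma conj_mul_y (t : GeneratingTriple H n x y z) : x * y * x⁻¹ * y = z⁻¹ ^ 2 := by
  calc x * y * x⁻¹ * y = z⁻¹ * (z * (x * y * x⁻¹) * y) := by group
    _ = z⁻¹ ^ 2 := by rw [t.z_mul_conj_mul_y]; group

lemma normal (t : GeneratingTriple H n x y z) : H.Normal := Subgroup.normal_of_index_eq_two t.index

lemma mul_mem_iff (t : GeneratingTriple H n x y z) {a b : G} : a * b ∈ H ↔ (a ∈ H ↔ b ∈ H) :=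
  Subgroup.mul_mem_iff_of_index_two t.index

lemma z_notMem (t : GeneratingTriple H n x y z) : z ∉ H := by
  intro hz
  exact t.x_notMem (t.y_mul_z ▸ mul_mem t.y_mem hz)

lemma conj_mem (t : GeneratingTriple H n x y z) : x * y * x⁻¹ ∈ H := t.normal.conj_mem y t.y_mem x

lemma sq_mem (t : GeneratingTriple H n x y z) (g : G) : g ^ 2 ∈ H := by
  rw [sq, t.mul_mem_iff]

/-- The crossing elements that define the covering surface. -/
def crossing (t : GeneratingTriple H n x y z) : Fin 4 → H :=
  ![1, ⟨(y ^ 2)⁻¹, inv_mem (t.sq_mem y)⟩,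
    ⟨z * y ^ 2 * z, by simp [t.mul_mem_iff, t.sq_mem y]⟩, ⟨z ^ 2, t.sq_mem z⟩]

/-- The turns around `1`, `0` and `-1` are right multiplications by `y²`, `z²` and `z y² z⁻¹`, the
generators required of a triple. The turn around `∞` is redundant because the product around all
four points telescopes. -/
lemma closure_crossing (t : GeneratingTriple H n x y z) :
    Subgroup.closure (Set.range fun j => t.crossing (j - 1) * (t.crossing j)⁻¹) = ⊤ := by
  apply Subgroup.map_injective H.subtype_injective
  rw [MonoidHom.map_closure, ← MonoidHom.range_eq_map, Subgroup.range_subtype]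
  apply le_antisymm
  · rw [Subgroup.closure_le]
    rintro _ ⟨g, -, rfl⟩
    exact g.2
  · refine t.closure_eq.symm.le.trans ?_
    rw [Subgroup.closure_le]
    have key : ∀ j, ((t.crossing (j - 1) * (t.crossing j)⁻¹ : H) : G) ∈ Subgroup.closure
        (H.subtype '' Set.range fun j => t.crossing (j - 1) * (t.crossing j)⁻¹) :=
      fun j => Subgroup.subset_closure ⟨_, ⟨j, rfl⟩, rfl⟩
    rintro g (rfl | rfl | rfl)
    · have := key 1
      rwa [show ((t.crossing (1 - 1) * (t.crossing 1)⁻¹ : H) : G) = y ^ 2 by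
        simp [crossing]] at this
    · have := key 0
      rwa [show ((t.crossing (0 - 1) * (t.crossing 0)⁻¹ : H) : G) = z ^ 2 by
        rw [show (0 - 1 : Fin 4) = 3 from rfl]; simp [crossing]] at this
    · have := key 3
      rwa [show ((t.crossing (3 - 1) * (t.crossing 3)⁻¹ : H) : G) = z * y ^ 2 * z⁻¹ by
        rw [show (3 - 1 : Fin 4) = 2 from rfl]; simp [crossing]; group] at this

/-- The edges of the first dessin as points of two fibres. -/
def edges1 (t : GeneratingTriple H n x y z) : H ⊕ H ≃ H × C2 :=
  Equiv.ofBijective (Sum.elim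
    -- The conjugation by `z` is forced by the labelling that suits the second dessin: the square of
    -- `x y x⁻¹` has to correspond to right multiplication by `y²`.
    (fun f => (⟨z⁻¹ * f * z, by simpa using t.normal.conj_mem f f.2 z⁻¹⟩, 1))
    (fun f => (⟨z⁻¹ * f * z * (x * y * x⁻¹),
      mul_mem (by simpa using t.normal.conj_mem f f.2 z⁻¹) t.conj_mem⟩, sigma))) <| by
    constructor
    · rintro (f | f) (f' | f') h <;>
        simp only [Sum.elim_inl, Sum.elim_inr, Prod.mk.injEq, Subtype.mk.injEq] at h
      · have := h.1
        simp only [mul_left_inj, mul_right_inj] at this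
        rw [Subtype.ext this]
      · exact absurd h.2.symm sigma_ne_one
      · exact absurd h.2 sigma_ne_one
      · have := h.1
        simp only [mul_left_inj, mul_right_inj] at this
        rw [Subtype.ext this]
    · rintro ⟨g, s⟩
      rcases eq_one_or_eq_sigma s with rfl | rfl
      · refine ⟨Sum.inl ⟨z * g * z⁻¹, t.normal.conj_mem g g.2 z⟩, Prod.ext (Subtype.ext ?_) rfl⟩
        simp only [Sum.elim_inl]
        group
      · refine ⟨Sum.inr ⟨z * (g * (x * y * x⁻¹)⁻¹) * z⁻¹,
          t.normal.conj_mem _ (mul_mem g.2 (inv_mem t.conj_mem)) z⟩,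
          Prod.ext (Subtype.ext ?_) rfl⟩
        simp only [Sum.elim_inr]
        group

lemma edges1_inl (t : GeneratingTriple H n x y z) (f : H) :
    ((t.edges1 (Sum.inl f)).1 : G) = z⁻¹ * f * z := rfl

lemma edges1_inr (t : GeneratingTriple H n x y z) (f : H) :
    ((t.edges1 (Sum.inr f)).1 : G) = z⁻¹ * f * z * (x * y * x⁻¹) := rfl

/-- The edges of the second dessin as points of two fibres. -/
def edges2 (t : GeneratingTriple H n x y z) : H ⊕ H ≃ G :=
  Equiv.ofBijective (Sum.elim (fun f => (f : G)) (fun f => (f : G) * z)) <| by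
    constructor
    · rintro (f | f) (f' | f') h <;> simp only [Sum.elim_inl, Sum.elim_inr] at h
      · rw [Subtype.ext h]
      · exact absurd (h ▸ f.2) (by rw [t.mul_mem_iff]; simp [t.z_notMem])
      · exact absurd (h ▸ f'.2) (by rw [t.mul_mem_iff]; simp [t.z_notMem])
      · rw [mul_left_inj] at h
        rw [Subtype.ext h]
    · intro g
      by_cases hg : g ∈ H
      · exact ⟨Sum.inl ⟨g, hg⟩, rfl⟩
      · refine ⟨Sum.inr ⟨g * z⁻¹, ?_⟩, by simp⟩
        rw [t.mul_mem_iff, inv_mem_iff]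
        simp [hg, t.z_notMem]

lemma edges2_inl (t : GeneratingTriple H n x y z) (f : H) : t.edges2 (Sum.inl f) = f := rfl

lemma edges2_inr (t : GeneratingTriple H n x y z) (f : H) : t.edges2 (Sum.inr f) = f * z := rfl

variable [Finite G]

/-- The covering surface. -/
abbrev gluing (t : GeneratingTriple H n x y z) : GluingData H := GluingData.ofGroup t.crossing

lemma isCompactRiemannSurface (t : GeneratingTriple H n x y z) :
    IsCompactRiemannSurface t.gluing.Surface :=
  t.gluing.isCompactRiemannSurface (GluingData.ofGroup_transitive _ t.closure_crossing)

lemma isDessinOn1 (t : GeneratingTriple H n x y z) {Q : Type} (ℋ : Hypermap Q) (ψ : Q ≃ H × C2)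
    (hx : ∀ q, ψ (ℋ.x q) = ψ q * (⟨x * y * x⁻¹, t.conj_mem⟩, sigma))
    (hy : ∀ q, ψ (ℋ.y q) = ψ q * (⟨y, t.y_mem⟩, sigma)) :
    IsDessinOn (t.gluing.pullback beta1) ℋ := by
  refine t.gluing.isDessinOn_beta1 ℋ (ψ.trans t.edges1.symm) (fun q => ?_) (fun q => ?_)
  · rw [Equiv.trans_apply, Equiv.symm_apply_eq, hx, Equiv.trans_apply]
    obtain ⟨f, hf⟩ := t.edges1.surjective (ψ q)
    rw [← hf, Equiv.symm_apply_apply]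
    rcases f with f | f
    · refine Prod.ext (Subtype.ext ?_) rfl
      rw [Prod.fst_mul, Subgroup.coe_mul, edges1_inl, Sum.elim_inl, edges1_inr,
        GluingData.ofGroup_c]
      simp [crossing]
    · refine Prod.ext (Subtype.ext ?_) sigma_mul_sigma
      rw [Prod.fst_mul, Subgroup.coe_mul, edges1_inr, Sum.elim_inr, edges1_inl,
        GluingData.ofGroup_c_inv]
      calc z⁻¹ * f * z * (x * y * x⁻¹) * (x * y * x⁻¹)
          = z⁻¹ * f * (z * (x * y * x⁻¹) * (x * y * x⁻¹)) := by group
        _ = _ := by rw [t.conj_sq]; simp [crossing, mul_assoc]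
  · rw [Equiv.trans_apply, Equiv.symm_apply_eq, hy, Equiv.trans_apply]
    obtain ⟨f, hf⟩ := t.edges1.surjective (ψ q)
    rw [← hf, Equiv.symm_apply_apply]
    rcases f with f | f
    · refine Prod.ext (Subtype.ext ?_) (one_mul _)
      rw [Prod.fst_mul, Subgroup.coe_mul, edges1_inl, Sum.elim_inl, edges1_inr,
        GluingData.ofGroup_c]
      calc z⁻¹ * f * z * y = z⁻¹ * f * (z * y) := by group
        _ = _ := by rw [← t.z_mul_y]; simp [crossing, mul_assoc]
    · refine Prod.ext (Subtype.ext ?_) sigma_mul_sigma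
      rw [Prod.fst_mul, Subgroup.coe_mul, edges1_inr, Sum.elim_inr, edges1_inl,
        GluingData.ofGroup_c_inv]
      calc z⁻¹ * f * z * (x * y * x⁻¹) * y = z⁻¹ * f * (z * (x * y * x⁻¹) * y) := by group
        _ = _ := by rw [t.z_mul_conj_mul_y]; simp [crossing, sq, mul_assoc]

/-- The two square roots of `1/2` correspond to the cosets `H` and `H z`. On the second one, right
multiplication by `y²` becomes the turn `z y² z⁻¹` around `-1`, and right multiplication by `z`
completes the turn `z²` around `0`. -/
lemma isDessinOn2 (t : GeneratingTriple H n x y z) {Q : Type} (ℋ : Hypermap Q) (ψ : Q ≃ G)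
    (hx : ∀ q, ψ (ℋ.x q) = ψ q * y ^ 2) (hy : ∀ q, ψ (ℋ.y q) = ψ q * z) :
    IsDessinOn (t.gluing.pullback beta2) ℋ := by
  refine t.gluing.isDessinOn_beta2 ℋ (ψ.trans t.edges2.symm) (fun q => ?_) (fun q => ?_)
  · rw [Equiv.trans_apply, Equiv.symm_apply_eq, hx, Equiv.trans_apply]
    obtain ⟨f, hf⟩ := t.edges2.surjective (ψ q)
    rw [← hf, Equiv.symm_apply_apply]
    rcases f with f | f
    · rw [edges2_inl, Sum.elim_inl, edges2_inl, GluingData.ofGroup_rot]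
      simp [crossing]
    · rw [edges2_inr, Sum.elim_inr, edges2_inr, GluingData.ofGroup_rot,
        show (3 - 1 : Fin 4) = 2 from rfl]
      simp [crossing, mul_assoc, sq]
  · rw [Equiv.trans_apply, Equiv.symm_apply_eq, hy, Equiv.trans_apply]
    obtain ⟨f, hf⟩ := t.edges2.surjective (ψ q)
    rw [← hf, Equiv.symm_apply_apply]
    rcases f with f | f
    · rfl
    · rw [edges2_inr, Sum.elim_inr, edges2_inl, GluingData.ofGroup_rot,
        show (0 - 1 : Fin 4) = 3 from rfl]
      simp [crossing, mul_assoc, sq]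

end GeneratingTriple

end

noncomputable section

/-! ### Triangle groups and their subgroups of index two -/

/-- The union of two cosets of a subgroup, as a subgroup. -/
def twoCosets {Γ : Type} [Group Γ] {J : Subgroup Γ} {s : Γ} (h1 : ∀ g ∈ J, s * g * s⁻¹ ∈ J)
    (h2 : ∀ g ∈ J, s⁻¹ * g * s ∈ J) (hs : s ^ 2 ∈ J) : Subgroup Γ where
  carrier := {g | g ∈ J ∨ g * s ∈ J}
  one_mem' := Or.inl J.one_mem
  mul_mem' := by
    rintro g h (hg | hg) (hh | hh)
    · exact Or.inl (mul_mem hg hh)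
    · exact Or.inr (by rw [mul_assoc]; exact mul_mem hg hh)
    · refine Or.inr ?_
      have := mul_mem hg (h2 _ hh)
      rwa [show g * s * (s⁻¹ * h * s) = g * h * s by group] at this
    · refine Or.inl ?_
      have := mul_mem (mul_mem hg (h2 _ hh)) (inv_mem hs)
      rwa [show g * s * (s⁻¹ * (h * s) * s) * (s ^ 2)⁻¹ = g * h by group] at this
  inv_mem' := by
    rintro g (hg | hg)
    · exact Or.inl (inv_mem hg)
    · refine Or.inr ?_
      have := mul_mem (h1 _ (inv_mem hg)) hs
      rwa [show s * (g * s)⁻¹ * s⁻¹ * s ^ 2 = g⁻¹ * s by group] at this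

namespace TriangleGroup

section Generators

variable {l m n : ℕ}

lemma u_pow : (u : TriangleGroup l m n) ^ l = 1 :=
  PresentedGroup.one_of_mem (rels := triangleRels l m n) (Or.inl rfl)

lemma uvw : (u * v * w : TriangleGroup l m n) = 1 :=
  PresentedGroup.one_of_mem (rels := triangleRels l m n) (Or.inr (Or.inr (Or.inr rfl)))

lemma mem_of_generators {P : Subgroup (TriangleGroup l m n)} (hu : u ∈ P) (hv : v ∈ P)
    (hw : w ∈ P) (g : TriangleGroup l m n) : g ∈ P := by
  refine PresentedGroup.generated_by _ P (fun j => ?_) g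
  fin_cases j
  exacts [hu, hv, hw]

variable {G : Type} [Group G]

/-- The homomorphism from a triangle group given by a triple of elements. -/
def lift (a b c : G) (ha : a ^ l = 1) (hb : b ^ m = 1) (hc : c ^ n = 1) (habc : a * b * c = 1) :
    TriangleGroup l m n →* G :=
  PresentedGroup.toGroup (f := ![a, b, c]) <| by
    rintro r (rfl | rfl | rfl | rfl) <;> simpa

variable {a b c : G} (ha : a ^ l = 1) (hb : b ^ m = 1) (hc : c ^ n = 1) (habc : a * b * c = 1)

lemma lift_u : lift a b c ha hb hc habc u = a := PresentedGroup.toGroup.of _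

lemma lift_v : lift a b c ha hb hc habc v = b := PresentedGroup.toGroup.of _

lemma lift_w : lift a b c ha hb hc habc w = c := PresentedGroup.toGroup.of _

end Generators

variable {n : ℕ}

lemma u_sq {m n : ℕ} : (u : TriangleGroup 2 m n) ^ 2 = 1 := u_pow

lemma u_inv {m n : ℕ} : (u : TriangleGroup 2 m n)⁻¹ = u :=
  inv_eq_of_mul_eq_one_left (by rw [← sq, u_sq])

lemma w_eq {l m n : ℕ} : (w : TriangleGroup l m n) = (u * v)⁻¹ := eq_inv_of_mul_eq_one_right uvw

lemma v_mul_w {m n : ℕ} : (v * w : TriangleGroup 2 m n) = u := by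
  rw [w_eq, mul_inv_rev, mul_inv_cancel_left, u_inv]

/-- Two cosets exhaust a group in which every generator lies in one of them. -/
lemma mem_or_mul_mem {l m n : ℕ} {N : Subgroup (TriangleGroup l m n)} [hN : N.Normal]
    {s : TriangleGroup l m n} (hs : s ^ 2 ∈ N) (hu : u ∈ N ∨ u * s ∈ N)
    (hv : v ∈ N ∨ v * s ∈ N) (hw : w ∈ N ∨ w * s ∈ N) (g : TriangleGroup l m n) :
    g ∈ N ∨ g * s ∈ N := by
  have hP := mem_of_generators (P := twoCosets (J := N) (fun g hg => hN.conj_mem g hg s)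
    (fun g hg => by simpa using hN.conj_mem g hg s⁻¹) hs)
  exact hP hu hv hw g

lemma mem_delta0_or (g : TriangleGroup 2 (2 * n) (4 * n)) : g ∈ Delta0 ∨ g * v ∈ Delta0 := by
  have hu : u ∈ (Delta0 : Subgroup (TriangleGroup 2 (2 * n) (4 * n))) :=
    Subgroup.subset_normalClosure (Or.inl rfl)
  have hv : v ^ 2 ∈ (Delta0 : Subgroup (TriangleGroup 2 (2 * n) (4 * n))) :=
    Subgroup.subset_normalClosure (Or.inr (Or.inl rfl))
  refine mem_or_mul_mem hv (Or.inl hu) (Or.inr (by rwa [← sq])) (Or.inr ?_) g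
  -- The product `w v` equals `v⁻¹ u⁻¹ v`, a conjugate of an element of `Delta0`.
  have := Subgroup.normalClosure_normal.conj_mem _ (inv_mem hu) v⁻¹
  rwa [show v⁻¹ * u⁻¹ * v⁻¹⁻¹ = (w : TriangleGroup 2 (2 * n) (4 * n)) * v by
    rw [w_eq]; group] at this

lemma mem_delta1_or (g : TriangleGroup 2 (2 * n) (4 * n)) : g ∈ Delta1 ∨ g * u ∈ Delta1 := by
  have hv : v ∈ (Delta1 : Subgroup (TriangleGroup 2 (2 * n) (4 * n))) :=
    Subgroup.subset_normalClosure (Or.inl rfl)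
  have hu : u ^ 2 ∈ (Delta1 : Subgroup (TriangleGroup 2 (2 * n) (4 * n))) :=
    Subgroup.subset_normalClosure (Or.inr (Or.inl rfl))
  refine mem_or_mul_mem hu (Or.inr (by rwa [← sq])) (Or.inl hv) (Or.inr ?_) g
  rw [w_eq, show (u * v)⁻¹ * u = (v : TriangleGroup 2 (2 * n) (4 * n))⁻¹ * (u⁻¹ * u) by group,
    inv_mul_cancel, mul_one]
  exact inv_mem hv

lemma mem_delta2_or (g : TriangleGroup 2 (2 * n) (4 * n)) : g ∈ Delta2 ∨ g * u ∈ Delta2 := by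
  have hw : w ∈ (Delta2 : Subgroup (TriangleGroup 2 (2 * n) (4 * n))) :=
    Subgroup.subset_normalClosure (Or.inl rfl)
  have hu : u ^ 2 ∈ (Delta2 : Subgroup (TriangleGroup 2 (2 * n) (4 * n))) :=
    Subgroup.subset_normalClosure (Or.inr (Or.inl rfl))
  refine mem_or_mul_mem hu (Or.inr (by rwa [← sq])) (Or.inr ?_) (Or.inl hw) g
  have := Subgroup.normalClosure_normal.conj_mem _ (inv_mem hw) u⁻¹
  rwa [show u⁻¹ * w⁻¹ * u⁻¹⁻¹ = (v : TriangleGroup 2 (2 * n) (4 * n)) * u by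
    rw [w_eq]; group] at this

/-- The homomorphism to `C2` with kernel `Delta0`. -/
def sign0 : TriangleGroup 2 (2 * n) (4 * n) →* C2 :=
  lift 1 sigma sigma (one_pow _) (by rw [pow_mul, sq, sigma_mul_sigma, one_pow])
    (by rw [show 4 * n = 2 * (2 * n) by ring, pow_mul, sq, sigma_mul_sigma, one_pow]) (by decide)

/-- The homomorphism to `C2` with kernel `Delta1`. -/
def sign1 : TriangleGroup 2 (2 * n) (4 * n) →* C2 :=
  lift sigma 1 sigma (by decide) (one_pow _)
    (by rw [show 4 * n = 2 * (2 * n) by ring, pow_mul, sq, sigma_mul_sigma, one_pow]) (by decide)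

/-- The homomorphism to `C2` with kernel `Delta2`. -/
def sign2 : TriangleGroup 2 (2 * n) (4 * n) →* C2 :=
  lift sigma sigma 1 (by decide) (by rw [pow_mul, sq, sigma_mul_sigma, one_pow]) (one_pow _)
    (by decide)

/-- Each generator is mapped to `sigma` by exactly two of the three characters. -/
lemma sign_mul : (sign0 * sign1 * sign2 : TriangleGroup 2 (2 * n) (4 * n) →* C2) = 1 := by
  apply PresentedGroup.ext
  intro j
  fin_cases j
  · change sign0 u * sign1 u * sign2 u = 1
    rw [sign0, sign1, sign2, lift_u, lift_u, lift_u]; decide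
  · change sign0 v * sign1 v * sign2 v = 1
    rw [sign0, sign1, sign2, lift_v, lift_v, lift_v]; decide
  · change sign0 w * sign1 w * sign2 w = 1
    rw [sign0, sign1, sign2, lift_w, lift_w, lift_w]; decide

/-- The normal closure lies in the kernel and, together with its coset of `v`, exhausts the group;
as `v` is not in the kernel, the two subgroups coincide. -/
lemma ker_sign0 : (sign0 : TriangleGroup 2 (2 * n) (4 * n) →* C2).ker = Delta0 := by
  have h : Delta0 ≤ (sign0 : TriangleGroup 2 (2 * n) (4 * n) →* C2).ker := by
    refine Subgroup.normalClosure_le_normal ?_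
    rintro g (rfl | rfl | rfl) <;> rw [SetLike.mem_coe, MonoidHom.mem_ker] <;>
      simp only [sign0, map_pow, lift_u, lift_v, lift_w] <;> decide
  refine le_antisymm (fun g hg => (mem_delta0_or g).resolve_right fun hv => ?_) h
  have := h hv
  rw [MonoidHom.mem_ker, map_mul, MonoidHom.mem_ker.1 hg, one_mul, sign0, lift_v] at this
  exact sigma_ne_one this

lemma ker_sign1 : (sign1 : TriangleGroup 2 (2 * n) (4 * n) →* C2).ker = Delta1 := by
  have h : Delta1 ≤ (sign1 : TriangleGroup 2 (2 * n) (4 * n) →* C2).ker := by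
    refine Subgroup.normalClosure_le_normal ?_
    rintro g (rfl | rfl | rfl) <;> rw [SetLike.mem_coe, MonoidHom.mem_ker] <;>
      simp only [sign1, map_pow, lift_u, lift_v, lift_w] <;> decide
  refine le_antisymm (fun g hg => (mem_delta1_or g).resolve_right fun hv => ?_) h
  have := h hv
  rw [MonoidHom.mem_ker, map_mul, MonoidHom.mem_ker.1 hg, one_mul, sign1, lift_u] at this
  exact sigma_ne_one this

lemma ker_sign2 : (sign2 : TriangleGroup 2 (2 * n) (4 * n) →* C2).ker = Delta2 := by
  have h : Delta2 ≤ (sign2 : TriangleGroup 2 (2 * n) (4 * n) →* C2).ker := by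
    refine Subgroup.normalClosure_le_normal ?_
    rintro g (rfl | rfl | rfl) <;> rw [SetLike.mem_coe, MonoidHom.mem_ker] <;>
      simp only [sign2, map_pow, lift_u, lift_v, lift_w] <;> decide
  refine le_antisymm (fun g hg => (mem_delta2_or g).resolve_right fun hv => ?_) h
  have := h hv
  rw [MonoidHom.mem_ker, map_mul, MonoidHom.mem_ker.1 hg, one_mul, sign2, lift_u] at this
  exact sigma_ne_one this

lemma closure_normal {Γ : Type} [Group Γ] {R : Set Γ}
    {s t : Γ} (hst : ∀ N : Subgroup Γ, s ∈ N → t ∈ N → N = ⊤)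
    (hs : ∀ r ∈ R, s * r * s⁻¹ ∈ Subgroup.closure R ∧ s⁻¹ * r * s ∈ Subgroup.closure R)
    (ht : ∀ r ∈ R, t * r * t⁻¹ ∈ Subgroup.closure R ∧ t⁻¹ * r * t ∈ Subgroup.closure R) :
    (Subgroup.closure R).Normal := by
  have conj : ∀ k : Γ, (∀ r ∈ R, k * r * k⁻¹ ∈ Subgroup.closure R) →
      ∀ g ∈ Subgroup.closure R, k * g * k⁻¹ ∈ Subgroup.closure R := by
    intro k hk g hg
    have : Subgroup.closure R ≤ (Subgroup.closure R).comap (MulAut.conj k).toMonoidHom :=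
      (Subgroup.closure_le _).2 hk
    exact this hg
  have key : ∀ k : Γ, (∀ r ∈ R, k * r * k⁻¹ ∈ Subgroup.closure R ∧
      k⁻¹ * r * k ∈ Subgroup.closure R) → k ∈ Subgroup.normalizer (Subgroup.closure R : Set Γ) := by
    intro k hk
    rw [Subgroup.mem_normalizer_iff]
    refine fun g => ⟨conj k (fun r hr => (hk r hr).1) g, fun hg => ?_⟩
    have := conj k⁻¹ (fun r hr => by simpa using (hk r hr).2) _ hg
    rwa [show k⁻¹ * (k * g * k⁻¹) * k⁻¹⁻¹ = g by group] at this
  exact Subgroup.normalizer_eq_top_iff.1 (hst _ (key s hs) (key t ht))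

/-- As `u² = 1`, conjugation by `u` exchanges `v` and `u v u⁻¹`, so they generate a normal subgroup.
It contains `w²`, which is the inverse of `(u v u⁻¹) v`. -/
lemma delta1_le : (Delta1 : Subgroup (TriangleGroup 2 (2 * n) (4 * n))) ≤
    Subgroup.closure {u * v * u⁻¹, v} := by
  have h1 : u * v * u⁻¹ ∈ Subgroup.closure
    {u * v * u⁻¹, (v : TriangleGroup 2 (2 * n) (4 * n))} := Subgroup.subset_closure (Or.inl rfl)
  have h2 : v ∈ Subgroup.closure
    {u * v * u⁻¹, (v : TriangleGroup 2 (2 * n) (4 * n))} := Subgroup.subset_closure (Or.inr rfl)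
  have : (Subgroup.closure {u * v * u⁻¹, (v : TriangleGroup 2 (2 * n) (4 * n))}).Normal := by
    refine closure_normal (s := u) (t := v) (fun N hu hv => ?_) ?_ ?_
    · exact (Subgroup.eq_top_iff' N).2 (mem_of_generators hu hv (w_eq ▸ inv_mem (mul_mem hu hv)))
    · have e : u * (u * v * u⁻¹) * u⁻¹ = (v : TriangleGroup 2 (2 * n) (4 * n)) := by
        rw [show u * (u * v * u⁻¹) * u⁻¹ = (u : TriangleGroup 2 (2 * n) (4 * n)) * u * v *
          (u * u)⁻¹ by group, ← sq, u_sq, one_mul, inv_one, mul_one]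
      rintro r (rfl | rfl)
      · refine ⟨by rwa [e], ?_⟩
        rwa [show u⁻¹ * (u * v * u⁻¹) * u = (v : TriangleGroup 2 (2 * n) (4 * n)) by group]
      · refine ⟨h1, ?_⟩
        rwa [show u⁻¹ * v * u = (u * v * u⁻¹ : TriangleGroup 2 (2 * n) (4 * n)) by rw [u_inv]]
    · rintro r hr
      have := Subgroup.subset_closure hr
      exact ⟨mul_mem (mul_mem h2 this) (inv_mem h2), mul_mem (mul_mem (inv_mem h2) this) h2⟩
  refine Subgroup.normalClosure_le_normal ?_
  rintro g (rfl | rfl | rfl)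
  · exact h2
  · exact u_sq ▸ one_mem _
  · have := inv_mem (mul_mem h1 h2)
    rw [u_inv] at this
    rwa [w_eq, inv_pow, show (u * v : TriangleGroup 2 (2 * n) (4 * n)) ^ 2 = u * v * u * v by
      rw [sq]; group, SetLike.mem_coe, u_inv]

/-- From `(v w)² = u² = 1` it follows that `v w v⁻¹ = w⁻¹ v⁻²`. So `v² ` and `w` generate a subgroup
normalised by `v` and `w`. -/
lemma delta2_le : (Delta2 : Subgroup (TriangleGroup 2 (2 * n) (4 * n))) ≤
    Subgroup.closure {v ^ 2, w} := by
  have h1 : v ^ 2 ∈ Subgroup.closure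
    {v ^ 2, (w : TriangleGroup 2 (2 * n) (4 * n))} := Subgroup.subset_closure (Or.inl rfl)
  have h2 : w ∈ Subgroup.closure
    {v ^ 2, (w : TriangleGroup 2 (2 * n) (4 * n))} := Subgroup.subset_closure (Or.inr rfl)
  have e : v * w = (w⁻¹ * v⁻¹ : TriangleGroup 2 (2 * n) (4 * n)) := by
    rw [← mul_inv_rev, v_mul_w, u_inv]
  have : (Subgroup.closure {v ^ 2, (w : TriangleGroup 2 (2 * n) (4 * n))}).Normal := by
    refine closure_normal (s := v) (t := w) (fun N hv hw => ?_) ?_ ?_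
    · exact (Subgroup.eq_top_iff' N).2 (mem_of_generators (v_mul_w ▸ mul_mem hv hw) hv hw)
    · rintro r (rfl | rfl)
      · rw [show v * v ^ 2 * v⁻¹ = (v : TriangleGroup 2 (2 * n) (4 * n)) ^ 2 by group,
          show v⁻¹ * v ^ 2 * v = (v : TriangleGroup 2 (2 * n) (4 * n)) ^ 2 by group]
        exact ⟨h1, h1⟩
      · constructor
        · rw [e, show w⁻¹ * v⁻¹ * v⁻¹ = (w⁻¹ * (v ^ 2)⁻¹ : TriangleGroup 2 (2 * n) (4 * n)) by
            group]
          exact mul_mem (inv_mem h2) (inv_mem h1)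
        · rw [show v⁻¹ * w * v = ((v ^ 2)⁻¹ * (v * w) * v : TriangleGroup 2 (2 * n) (4 * n)) by
            group, e, mul_assoc, inv_mul_cancel_right]
          exact mul_mem (inv_mem h1) (inv_mem h2)
    · rintro r hr
      have := Subgroup.subset_closure hr
      exact ⟨mul_mem (mul_mem h2 this) (inv_mem h2), mul_mem (mul_mem (inv_mem h2) this) h2⟩
  refine Subgroup.normalClosure_le_normal ?_
  rintro g (rfl | rfl | rfl)
  · exact h2
  · exact u_sq ▸ one_mem _
  · exact h1

end TriangleGroup

lemma closure_mk_eq_top {Γ : Type} [Group Γ] {D K : Subgroup Γ} [K.Normal] {s t : Γ} (hs : s ∈ D)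
    (ht : t ∈ D) (h : D ≤ Subgroup.closure {s, t}) :
    Subgroup.closure {(QuotientGroup.mk ⟨s, hs⟩ : D ⧸ K.subgroupOf D),
      QuotientGroup.mk ⟨t, ht⟩} = ⊤ := by
  have h1 : Subgroup.closure {(⟨s, hs⟩ : D), ⟨t, ht⟩} = ⊤ := by
    apply Subgroup.map_injective D.subtype_injective
    rw [MonoidHom.map_closure, ← MonoidHom.range_eq_map, Subgroup.range_subtype, Set.image_pair]
    refine le_antisymm ((Subgroup.closure_le _).2 ?_) h
    rintro g (rfl | rfl)
    exacts [hs, ht]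
  have h2 := congrArg (Subgroup.map (QuotientGroup.mk' (K.subgroupOf D))) h1
  rwa [MonoidHom.map_closure, Set.image_pair, ← MonoidHom.range_eq_map,
    QuotientGroup.range_mk'] at h2

end

noncomputable section

/-! ### The two dessins of a generating triple -/

namespace GeneratingTriple

open TriangleGroup

variable {G : Type} [Group G] {H : Subgroup G} {n : ℕ} {x y z : G}

lemma eq_top_of_le (t : GeneratingTriple H n x y z) {J : Subgroup G} (hJ : H ≤ J) {g : G}
    (hg : g ∉ H) (hgJ : g ∈ J) : J = ⊤ := by
  refine (Subgroup.eq_top_iff' J).2 fun k => ?_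
  by_cases hk : k ∈ H
  · exact hJ hk
  · have : k * g ∈ H := by rw [t.mul_mem_iff]; simp [hk, hg]
    simpa using mul_mem (hJ this) (inv_mem hgJ)

lemma le_of_mem (t : GeneratingTriple H n x y z) {J : Subgroup G} (h1 : y ^ 2 ∈ J)
    (h2 : z ^ 2 ∈ J) (h3 : z * y ^ 2 * z⁻¹ ∈ J) : H ≤ J := by
  refine t.closure_eq.symm.le.trans ((Subgroup.closure_le _).2 ?_)
  rintro g (rfl | rfl | rfl)
  exacts [h1, h2, h3]

/-- The homomorphism from the triangle group. -/
def hom (t : GeneratingTriple H n x y z) : TriangleGroup 2 (2 * n) (4 * n) →* G :=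
  lift x y z t.x_sq (t.order_y ▸ pow_orderOf_eq_one y) (t.order_z ▸ pow_orderOf_eq_one z)
    t.mul_eq_one

lemma hom_u (t : GeneratingTriple H n x y z) : t.hom u = x := lift_u _ _ _ _

lemma hom_v (t : GeneratingTriple H n x y z) : t.hom v = y := lift_v _ _ _ _

lemma hom_w (t : GeneratingTriple H n x y z) : t.hom w = z := lift_w _ _ _ _

lemma u_sq_mem {m k : ℕ} {N : Subgroup (TriangleGroup 2 m k)} : u ^ 2 ∈ N := by
  rw [u_sq]; exact one_mem N

lemma v_mem_delta1 : v ∈ (Delta1 : Subgroup (TriangleGroup 2 (2 * n) (4 * n))) :=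
  Subgroup.subset_normalClosure (Or.inl rfl)

lemma conj_mem_delta1 : u * v * u⁻¹ ∈ (Delta1 : Subgroup (TriangleGroup 2 (2 * n) (4 * n))) :=
  Subgroup.normalClosure_normal.conj_mem _ v_mem_delta1 u

lemma w_sq_mem_delta1 : w ^ 2 ∈ (Delta1 : Subgroup (TriangleGroup 2 (2 * n) (4 * n))) :=
  Subgroup.subset_normalClosure (Or.inr (Or.inr rfl))

lemma w_mem_delta2 : w ∈ (Delta2 : Subgroup (TriangleGroup 2 (2 * n) (4 * n))) :=
  Subgroup.subset_normalClosure (Or.inl rfl)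

lemma v_sq_mem_delta2 : v ^ 2 ∈ (Delta2 : Subgroup (TriangleGroup 2 (2 * n) (4 * n))) :=
  Subgroup.subset_normalClosure (Or.inr (Or.inr rfl))

lemma delta1_le_comap (t : GeneratingTriple H n x y z) : Delta1 ≤ H.comap t.hom := by
  have := t.normal
  refine Subgroup.normalClosure_le_normal ?_
  rintro g (rfl | rfl | rfl)
  · rw [SetLike.mem_coe, Subgroup.mem_comap, hom_v]; exact t.y_mem
  · exact u_sq_mem
  · rw [SetLike.mem_coe, Subgroup.mem_comap, map_pow]; exact t.sq_mem _

/-- An element `g` of the kernel outside `Delta1` would have `g u` in `Delta1`, whose image `x`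
would then lie in `H`. -/
lemma ker_le_delta1 (t : GeneratingTriple H n x y z) : t.hom.ker ≤ Delta1 := by
  intro g hg
  refine (mem_delta1_or g).resolve_right fun hu => t.x_notMem ?_
  have := t.delta1_le_comap hu
  rwa [Subgroup.mem_comap, map_mul, MonoidHom.mem_ker.1 hg, one_mul, hom_u] at this

/-- On the kernel the character `sign1` is trivial, so `sign0` and `sign2`, whose product with it is
trivial, agree there. -/
lemma delta0_inf_ker (t : GeneratingTriple H n x y z) :
    Delta0 ⊓ t.hom.ker = Delta2 ⊓ t.hom.ker := by
  have key : ∀ g ∈ t.hom.ker, g ∈ Delta0 ↔ g ∈ Delta2 := by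
    intro g hg
    have h1 : sign1 g = 1 := by rw [← MonoidHom.mem_ker, ker_sign1]; exact t.ker_le_delta1 hg
    have h := DFunLike.congr_fun sign_mul g
    simp only [MonoidHom.mul_apply, h1, mul_one, MonoidHom.one_apply] at h
    rw [← ker_sign0, ← ker_sign2, MonoidHom.mem_ker, MonoidHom.mem_ker]
    constructor
    · intro h0
      rwa [h0, one_mul] at h
    · intro h2
      rwa [h2, mul_one] at h
  ext g
  simp only [Subgroup.mem_inf]
  exact ⟨fun h => ⟨(key g h.2).1 h.1, h.2⟩, fun h => ⟨(key g h.2).2 h.1, h.2⟩⟩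

/-- The elements `v²`, `w²` and `w v² w⁻¹` lie in both subgroups and map to the generators of `H`.
This makes `Delta2` map onto `G` and makes the two components of `hom1` independent. -/
lemma le_map_inf (t : GeneratingTriple H n x y z) : H ≤ (Delta1 ⊓ Delta2).map t.hom := by
  refine t.le_of_mem ⟨v ^ 2, ⟨pow_mem v_mem_delta1 2, v_sq_mem_delta2⟩, ?_⟩
    ⟨w ^ 2, ⟨w_sq_mem_delta1, pow_mem w_mem_delta2 2⟩, ?_⟩
    ⟨w * v ^ 2 * w⁻¹, ⟨Subgroup.normalClosure_normal.conj_mem _ (pow_mem v_mem_delta1 2) w,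
      Subgroup.normalClosure_normal.conj_mem _ v_sq_mem_delta2 w⟩, ?_⟩
  · rw [map_pow, hom_v]
  · rw [map_pow, hom_w]
  · rw [map_mul, map_mul, map_inv, map_pow, hom_v, hom_w]

lemma map_delta2 (t : GeneratingTriple H n x y z) : Delta2.map t.hom = ⊤ :=
  t.eq_top_of_le (t.le_map_inf.trans (Subgroup.map_mono inf_le_right)) t.z_notMem
    ⟨w, w_mem_delta2, t.hom_w⟩

lemma hom_surjective (t : GeneratingTriple H n x y z) : Function.Surjective t.hom := by
  rw [← MonoidHom.range_eq_top, eq_top_iff, ← t.map_delta2, MonoidHom.range_eq_map]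
  exact Subgroup.map_mono le_top

/-- The intersection `K` of `Delta2` and the kernel. -/
abbrev ker2 (t : GeneratingTriple H n x y z) : Subgroup (TriangleGroup 2 (2 * n) (4 * n)) :=
  Delta2 ⊓ t.hom.ker

/-- The quotient of `Delta2`. -/
def quotient2 (t : GeneratingTriple H n x y z) : Delta2 ⧸ t.ker2.subgroupOf Delta2 ≃* G :=
  QuotientGroup.liftEquiv (φ := t.hom.comp (Subgroup.subtype Delta2)) _
    (by
      intro g
      obtain ⟨k, hk, rfl⟩ := (Subgroup.eq_top_iff' _).1 t.map_delta2 g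
      exact ⟨⟨k, hk⟩, rfl⟩)
    (by
      ext g
      rw [Subgroup.mem_subgroupOf, Subgroup.mem_inf]
      exact ⟨fun h => h.2, fun h => ⟨g.2, h⟩⟩)

lemma quotient2_mk (t : GeneratingTriple H n x y z) (g : TriangleGroup 2 (2 * n) (4 * n))
    (hg : g ∈ Delta2) : t.quotient2 (QuotientGroup.mk ⟨g, hg⟩) = t.hom g := rfl

/-- The homomorphism from `Delta1`. -/
def hom1 (t : GeneratingTriple H n x y z) :
    (Delta1 : Subgroup (TriangleGroup 2 (2 * n) (4 * n))) →* H × C2 :=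
  ((t.hom.comp (Subgroup.subtype Delta1)).codRestrict H fun g => t.delta1_le_comap g.2).prod
    (sign2.comp (Subgroup.subtype Delta1))

lemma sign2_v : sign2 (v : TriangleGroup 2 (2 * n) (4 * n)) = sigma := lift_v _ _ _ _

lemma sign2_u : sign2 (u : TriangleGroup 2 (2 * n) (4 * n)) = sigma := lift_u _ _ _ _

lemma hom1_surjective (t : GeneratingTriple H n x y z) : Function.Surjective t.hom1 := by
  rintro ⟨a, s⟩
  rcases eq_one_or_eq_sigma s with rfl | rfl
  · obtain ⟨k, ⟨hk1, hk2⟩, hk⟩ := t.le_map_inf a.2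
    refine ⟨⟨k, hk1⟩, Prod.ext (Subtype.ext hk) ?_⟩
    change sign2 k = 1
    rwa [← MonoidHom.mem_ker, ker_sign2]
  · obtain ⟨k, ⟨hk1, hk2⟩, hk⟩ := t.le_map_inf (mul_mem a.2 (inv_mem t.y_mem))
    refine ⟨⟨k * v, mul_mem hk1 v_mem_delta1⟩, Prod.ext (Subtype.ext ?_) ?_⟩
    · change t.hom (k * v) = a
      rw [map_mul, hk, hom_v, inv_mul_cancel_right]
    · change sign2 (k * v) = sigma
      rw [map_mul, sign2_v, MonoidHom.mem_ker.1 (ker_sign2.symm ▸ hk2 : k ∈ sign2.ker), one_mul]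

/-- The quotient of `Delta1`. -/
def quotient1 (t : GeneratingTriple H n x y z) : Delta1 ⧸ t.ker2.subgroupOf Delta1 ≃* H × C2 :=
  QuotientGroup.liftEquiv (φ := t.hom1) _ t.hom1_surjective
    (by
      ext g
      rw [Subgroup.mem_subgroupOf, Subgroup.mem_inf, MonoidHom.mem_ker, MonoidHom.mem_ker,
        ← ker_sign2, MonoidHom.mem_ker, Prod.ext_iff, Subtype.ext_iff]
      exact and_comm)

lemma quotient1_mk (t : GeneratingTriple H n x y z) (g : TriangleGroup 2 (2 * n) (4 * n))
    (hg : g ∈ Delta1) :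
    t.quotient1 (QuotientGroup.mk ⟨g, hg⟩) = (⟨t.hom g, t.delta1_le_comap hg⟩, sign2 g) := rfl

lemma quotient1_conj (t : GeneratingTriple H n x y z) :
    t.quotient1 (QuotientGroup.mk ⟨u * v * u⁻¹, conj_mem_delta1⟩) =
      (⟨x * y * x⁻¹, t.conj_mem⟩, sigma) := by
  refine Prod.ext (Subtype.ext ?_) ?_
  · rw [quotient1_mk]
    change t.hom (u * v * u⁻¹) = _
    rw [map_mul, map_mul, map_inv, hom_u, hom_v]
  · rw [quotient1_mk]
    change sign2 (u * v * u⁻¹) = _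
    rw [map_mul, map_mul, map_inv, sign2_u, sign2_v]
    exact mul_inv_cancel_right _ _

lemma quotient1_v (t : GeneratingTriple H n x y z) :
    t.quotient1 (QuotientGroup.mk ⟨v, v_mem_delta1⟩) = (⟨y, t.y_mem⟩, sigma) := by
  refine Prod.ext (Subtype.ext ?_) ?_
  · exact t.hom_v
  · exact sign2_v (n := n)

lemma orderOf_prod_sigma {g : H} (hg : orderOf (g : G) = 2 * n) :
    orderOf ((g, sigma) : H × C2) = 2 * n := by
  rw [Prod.orderOf_mk, ← Subgroup.orderOf_coe, hg,
    orderOf_eq_prime (p := 2) (by decide) sigma_ne_one]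
  exact Nat.lcm_eq_left (dvd_mul_right 2 n)

lemma order_conj (t : GeneratingTriple H n x y z) :
    orderOf (QuotientGroup.mk ⟨u * v * u⁻¹, conj_mem_delta1⟩ :
      Delta1 ⧸ t.ker2.subgroupOf Delta1) = 2 * n := by
  rw [← t.quotient1.orderOf_eq, quotient1_conj]
  apply orderOf_prod_sigma
  rw [← t.order_y]
  exact (MulAut.conj x).orderOf_eq y

lemma order_v (t : GeneratingTriple H n x y z) :
    orderOf (QuotientGroup.mk ⟨v, v_mem_delta1⟩ : Delta1 ⧸ t.ker2.subgroupOf Delta1) = 2 * n := by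
  rw [← t.quotient1.orderOf_eq, quotient1_v]
  exact orderOf_prod_sigma t.order_y

lemma order_conj_mul_v (t : GeneratingTriple H n x y z) :
    orderOf ((QuotientGroup.mk ⟨u * v * u⁻¹, conj_mem_delta1⟩ :
      Delta1 ⧸ t.ker2.subgroupOf Delta1) * QuotientGroup.mk ⟨v, v_mem_delta1⟩) = 2 * n := by
  rw [← t.quotient1.orderOf_eq, map_mul, quotient1_conj, quotient1_v, Prod.mk_mul_mk,
    sigma_mul_sigma, Prod.orderOf_mk, orderOf_one, Nat.lcm_one_right, ← Subgroup.orderOf_coe]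
  change orderOf (x * y * x⁻¹ * y) = _
  -- The product `x y x⁻¹ y` is `z⁻²`, and the `C2`-components cancel.
  have h2 : 2 ∣ orderOf z⁻¹ := by rw [orderOf_inv, t.order_z]; omega
  rw [t.conj_mul_y, orderOf_pow_of_dvd two_ne_zero h2, orderOf_inv, t.order_z]
  omega

lemma order_v_sq (t : GeneratingTriple H n x y z) :
    orderOf (QuotientGroup.mk ⟨v ^ 2, v_sq_mem_delta2⟩ :
      Delta2 ⧸ t.ker2.subgroupOf Delta2) = n := by
  rw [← t.quotient2.orderOf_eq, quotient2_mk, map_pow, hom_v,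
    orderOf_pow_of_dvd two_ne_zero (t.order_y ▸ dvd_mul_right 2 n), t.order_y]
  omega

lemma order_w (t : GeneratingTriple H n x y z) :
    orderOf (QuotientGroup.mk ⟨w, w_mem_delta2⟩ :
      Delta2 ⧸ t.ker2.subgroupOf Delta2) = 4 * n := by
  rw [← t.quotient2.orderOf_eq, quotient2_mk, hom_w, t.order_z]

lemma order_v_sq_mul_w (t : GeneratingTriple H n x y z) :
    orderOf ((QuotientGroup.mk ⟨v ^ 2, v_sq_mem_delta2⟩ :
      Delta2 ⧸ t.ker2.subgroupOf Delta2) * QuotientGroup.mk ⟨w, w_mem_delta2⟩) = 4 * n := by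
  rw [← t.quotient2.orderOf_eq, map_mul, quotient2_mk, quotient2_mk, map_pow, hom_v, hom_w, sq,
    mul_assoc, t.y_mul_z, ← t.order_z, ← orderOf_inv z,
    ← eq_inv_of_mul_eq_one_left t.mul_eq_one]
  have := (MulAut.conj y).orderOf_eq (x * y)
  rwa [MulAut.conj_apply, ← mul_assoc, mul_inv_cancel_right] at this

lemma card_quotient1 (t : GeneratingTriple H n x y z) :
    Nat.card (Delta1 ⧸ t.ker2.subgroupOf Delta1) = Nat.card G := by
  rw [Nat.card_congr t.quotient1.toEquiv, Nat.card_prod, ← H.card_mul_index, t.index,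
    Nat.card_eq_fintype_card (α := C2)]
  rfl

lemma card_quotient2 (t : GeneratingTriple H n x y z) :
    Nat.card (Delta2 ⧸ t.ker2.subgroupOf Delta2) = Nat.card G :=
  Nat.card_congr t.quotient2.toEquiv

variable [Finite G]

instance (t : GeneratingTriple H n x y z) : Finite (Delta1 ⧸ t.ker2.subgroupOf Delta1) :=
  Finite.of_equiv _ t.quotient1.symm.toEquiv

instance (t : GeneratingTriple H n x y z) : Finite (Delta2 ⧸ t.ker2.subgroupOf Delta2) :=
  Finite.of_equiv _ t.quotient2.symm.toEquiv

/-- The first dessin. -/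
def hypermap1 (t : GeneratingTriple H n x y z) :
    Hypermap (Delta1 ⧸ t.ker2.subgroupOf Delta1) :=
  Hypermap.ofGroup _ _ (closure_mk_eq_top conj_mem_delta1 v_mem_delta1 delta1_le)

/-- The second dessin. -/
def hypermap2 (t : GeneratingTriple H n x y z) :
    Hypermap (Delta2 ⧸ t.ker2.subgroupOf Delta2) :=
  Hypermap.ofGroup _ _ (closure_mk_eq_top v_sq_mem_delta2 w_mem_delta2 delta2_le)

lemma isGivenBy1 (t : GeneratingTriple H n x y z) : t.hypermap1.IsGivenBy (u * v * u⁻¹) v :=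
  ⟨conj_mem_delta1, v_mem_delta1, fun _ => rfl, fun _ => rfl⟩

lemma isGivenBy2 (t : GeneratingTriple H n x y z) : t.hypermap2.IsGivenBy (v ^ 2) w :=
  ⟨v_sq_mem_delta2, w_mem_delta2, fun _ => rfl, fun _ => rfl⟩

/-- The automorphism group of the first dessin. -/
def autEquiv1 (t : GeneratingTriple H n x y z) : t.hypermap1.Aut ≃* H × C2 :=
  (Hypermap.autEquiv _).trans t.quotient1

/-- The automorphism group of the second dessin. -/
def autEquiv2 (t : GeneratingTriple H n x y z) : t.hypermap2.Aut ≃* G :=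
  (Hypermap.autEquiv _).trans t.quotient2

lemma hasType1 (t : GeneratingTriple H n x y z) :
    t.hypermap1.HasType (2 * n) (2 * n) (2 * n) := by
  have := Hypermap.hasType_ofGroup
    (closure_mk_eq_top (K := t.ker2) conj_mem_delta1 v_mem_delta1 delta1_le)
  rwa [order_conj, order_v, order_conj_mul_v] at this

lemma hasType2 (t : GeneratingTriple H n x y z) : t.hypermap2.HasType n (4 * n) (4 * n) := by
  have := Hypermap.hasType_ofGroup
    (closure_mk_eq_top (K := t.ker2) v_sq_mem_delta2 w_mem_delta2 delta2_le)
  rwa [order_v_sq, order_w, order_v_sq_mul_w] at this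

lemma hasGenus1 (t : GeneratingTriple H n x y z) (hn : n = 3) (hG : Nat.card G = 2184) :
    t.hypermap1.HasGenus 547 := by
  -- All three orders are `6`, and `2184 / 6 = 364`.
  apply Hypermap.hasGenus_ofGroup (c₁ := 364) (c₂ := 364) (c₃ := 364)
  · rw [order_conj, card_quotient1, hn, hG]
  · rw [order_v, card_quotient1, hn, hG]
  · rw [order_conj_mul_v, card_quotient1, hn, hG]
  · rw [card_quotient1, hG]; norm_num

lemma hasGenus2 (t : GeneratingTriple H n x y z) (hn : n = 3) (hG : Nat.card G = 2184) :
    t.hypermap2.HasGenus 547 := by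
  -- The orders are `3, 12, 12`, giving `2184 / 3` and twice `2184 / 12` cycles.
  apply Hypermap.hasGenus_ofGroup (c₁ := 728) (c₂ := 182) (c₃ := 182)
  · rw [order_v_sq, card_quotient2, hn, hG]
  · rw [order_w, card_quotient2, hn, hG]
  · rw [order_v_sq_mul_w, card_quotient2, hn, hG]
  · rw [card_quotient2, hG]; norm_num

lemma exists_surface (t : GeneratingTriple H n x y z) :
    ∃ (S : Type) (_ : TopologicalSpace S) (_ : ChartedSpace ℂ S) (β₁ β₂ : S → OnePoint ℂ),
      IsCompactRiemannSurface S ∧ IsDessinOn β₁ t.hypermap1 ∧ IsDessinOn β₂ t.hypermap2 := by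
  refine ⟨t.gluing.Surface, inferInstance, inferInstance, _, _, t.isCompactRiemannSurface,
    t.isDessinOn1 _ t.quotient1.toEquiv (fun q => ?_) (fun q => ?_),
    t.isDessinOn2 _ t.quotient2.toEquiv (fun q => ?_) (fun q => ?_)⟩
  · exact (map_mul t.quotient1 _ _).trans (congrArg _ t.quotient1_conj)
  · exact (map_mul t.quotient1 _ _).trans (congrArg _ t.quotient1_v)
  · refine (map_mul t.quotient2 _ _).trans (congrArg _ ?_)
    exact (map_pow t.hom v 2).trans (congrArg (· ^ 2) t.hom_v)
  · exact (map_mul t.quotient2 _ _).trans (congrArg _ t.hom_w)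

end GeneratingTriple

end

noncomputable section

/-! ### Projective linear groups of degree two -/

namespace PGLTwo

open Matrix Matrix.GeneralLinearGroup

section Field

variable {F : Type} [Field F]

lemma det_ne_zero' (g : GL (Fin 2) F) : g 0 0 * g 1 1 - g 0 1 * g 1 0 ≠ 0 := by
  have := g.det_ne_zero
  rwa [det_fin_two] at this

/-- The lower unitriangular matrices. -/
def lower (t : F) : GL (Fin 2) F :=
  ⟨!![1, 0; t, 1], !![1, 0; -t, 1], by simp [one_fin_two], by simp [one_fin_two]⟩

lemma lower_val (t : F) : (lower t).val = !![1, 0; t, 1] := rfl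

lemma upper_val (t : F) : (upperRightHom t : GL (Fin 2) F).val = !![1, t; 0, 1] := rfl

/-- A matrix of determinant one with non-zero lower left entry is a product upper, lower, upper. If
that entry vanishes, multiplying by `lower 1` makes it non-zero. -/
lemma mem_of_unipotent {J : Subgroup (GL (Fin 2) F)} (hU : ∀ t, upperRightHom t ∈ J)
    (hL : ∀ t, lower t ∈ J) (g : GL (Fin 2) F) (hg : g.val.det = 1) : g ∈ J := by
  have key : ∀ k : GL (Fin 2) F, k.val.det = 1 → k 1 0 ≠ 0 → k ∈ J := by
    intro k hk hc
    rw [det_fin_two] at hk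
    have : k = upperRightHom ((k 0 0 - 1) / k 1 0) * lower (k 1 0) *
        upperRightHom ((k 1 1 - 1) / k 1 0) := by
      refine Units.ext ?_
      rw [Units.val_mul, Units.val_mul, upper_val, lower_val, upper_val, eta_fin_two k.val]
      simp only [mul_fin_two, of_apply, cons_val', cons_val_zero, cons_val_one]
      congr! <;> grind
    rw [this]
    exact mul_mem (mul_mem (hU _) (hL _)) (hU _)
  by_cases hc : g 1 0 = 0
  · have h1 : lower 1 * g ∈ J := by
      refine key _ (by rw [Units.val_mul, det_mul, hg, lower_val, det_fin_two]; simp) ?_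
      have hg' := det_ne_zero' g
      rw [hc, mul_zero, sub_zero] at hg'
      rw [coe_mul, lower_val, mul_apply, Fin.sum_univ_two]
      simpa [hc] using left_ne_zero_of_mul hg'
    simpa using mul_mem (inv_mem (hL 1)) h1
  · exact key g hg hc

lemma mk_eq_mk_iff {g h : GL (Fin 2) F} :
    ProjGenLinGroup.mk g = ProjGenLinGroup.mk h ↔ ∃ u : F, u ≠ 0 ∧ h.val = u • g.val := by
  rw [ProjGenLinGroup.mk_eq_mk_iff]
  constructor
  · rintro ⟨u, rfl⟩
    refine ⟨u, u.ne_zero, ?_⟩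
    rw [Units.val_mul, coe_scalar, scalar_apply, smul_eq_mul_diagonal]
  · rintro ⟨u, hu, h⟩
    refine ⟨Units.mk0 u hu, Units.ext ?_⟩
    rw [Units.val_mul, coe_scalar, scalar_apply, h, smul_eq_mul_diagonal, Units.val_mk0]

lemma mk_eq_one_iff {g : GL (Fin 2) F} :
    ProjGenLinGroup.mk g = 1 ↔ g 0 1 = 0 ∧ g 1 0 = 0 ∧ g 0 0 = g 1 1 := by
  rw [← map_one (ProjGenLinGroup.mk (n := Fin 2) (R := F)), eq_comm, mk_eq_mk_iff]
  constructor
  · rintro ⟨u, -, h⟩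
    rw [h]
    simp
  · rintro ⟨h1, h2, h3⟩
    refine ⟨g 0 0, fun h => det_ne_zero' g (by rw [h, h1]; ring), ?_⟩
    rw [eta_fin_two g.val, h1, h2, ← h3]
    ext i j
    fin_cases i <;> fin_cases j <;> simp

/-- Diagonal matrices. -/
def diag (s t : Fˣ) : GL (Fin 2) F :=
  ⟨!![(s : F), 0; 0, t], !![(s : F)⁻¹, 0; 0, (t : F)⁻¹], by simp [one_fin_two],
    by simp [one_fin_two]⟩

lemma diag_pow (s t : Fˣ) (k : ℕ) : diag s t ^ k = diag (s ^ k) (t ^ k) := by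
  induction k with
  | zero => refine Units.ext ?_; simp [diag, one_fin_two]
  | succ k ih => rw [pow_succ, ih]; refine Units.ext ?_; simp [diag, pow_succ]

lemma orderOf_mk_diag (s t : Fˣ) : orderOf (ProjGenLinGroup.mk (diag s t)) = orderOf (s / t) := by
  rw [orderOf_eq_orderOf_iff]
  intro k
  rw [← map_pow, diag_pow, mk_eq_one_iff, div_pow, div_eq_one]
  simp only [diag, of_apply, cons_val', cons_val_zero, cons_val_one, true_and, Units.ext_iff]

lemma orderOf_mk_of_mul_eq {g P : GL (Fin 2) F} {s t : Fˣ} (h : g * P = P * diag s t) :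
    orderOf (ProjGenLinGroup.mk g) = orderOf (s / t) := by
  have : MulAut.conj (ProjGenLinGroup.mk P) (ProjGenLinGroup.mk (diag s t)) =
      ProjGenLinGroup.mk g := by
    rw [MulAut.conj_apply, ← map_mul, ← h, map_mul, mul_inv_cancel_right]
  rw [← orderOf_mk_diag, ← this, MulEquiv.orderOf_eq]

/-- The projective linear group has trivial centre. -/
lemma eq_one_of_central (g : PGL(2, F)) (hg : ∀ h, g * h = h * g) : g = 1 := by
  induction g using ProjGenLinGroup.induction_on with | mk g =>
  have hd := det_ne_zero' g
  have h1 := hg (ProjGenLinGroup.mk (upperRightHom 1))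
  have h2 := hg (ProjGenLinGroup.mk (lower 1))
  rw [← map_mul, ← map_mul, mk_eq_mk_iff] at h1 h2
  obtain ⟨s, hs, h1⟩ := h1
  obtain ⟨r, hr, h2⟩ := h2
  rw [Units.val_mul, Units.val_mul, upper_val, eta_fin_two g.val] at h1
  rw [Units.val_mul, Units.val_mul, lower_val, eta_fin_two g.val] at h2
  have a00 := congrFun (congrFun h1 0) 0
  have a10 := congrFun (congrFun h1 1) 0
  have a11 := congrFun (congrFun h1 1) 1
  have b00 := congrFun (congrFun h2 0) 0
  have b01 := congrFun (congrFun h2 0) 1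
  have a01 := congrFun (congrFun h1 0) 1
  have b10 := congrFun (congrFun h2 1) 0
  have b11 := congrFun (congrFun h2 1) 1
  simp at a00 a10 a11 b00 b01 a01 b10 b11
  have hc : g 1 0 = 0 := by
    by_contra hc
    have hs1 : s = 1 := mul_right_cancel₀ hc (by linear_combination -a10)
    grind
  have hb : g 0 1 = 0 := by
    by_contra hb
    have hr1 : r = 1 := mul_right_cancel₀ hb (by linear_combination -b01)
    grind
  rw [mk_eq_one_iff]
  refine ⟨hb, hc, ?_⟩
  grind

end Field

end PGLTwo

end

noncomputable section

/-! ### The subgroup of index two -/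

namespace PGLTwo

open Matrix Matrix.GeneralLinearGroup

variable {p : ℕ} [Fact p.Prime]

/-- Scaling a `2 × 2` matrix multiplies its determinant by a square, so the square class of the
determinant is an invariant of the projective class. -/
lemma mk_mem_L2 {g : GL (Fin 2) (ZMod p)} :
    ProjGenLinGroup.mk g ∈ L2 p ↔ IsSquare g.val.det := by
  constructor
  · rintro ⟨s, hs⟩
    induction s using QuotientGroup.induction_on with | H s =>
    rw [ProjectiveSpecialLinearGroup.toPGL_mk, mk_eq_mk_iff] at hs
    obtain ⟨u, -, h⟩ := hs
    refine ⟨u, ?_⟩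
    rw [h, det_smul, SpecialLinearGroup.coe_GL_coe_matrix, s.det_coe, Fintype.card_fin, mul_one, sq]
  · rintro ⟨u, h⟩
    have hu : u ≠ 0 := by
      rintro rfl
      exact g.det_ne_zero (by rw [h, mul_zero])
    have hd : (u⁻¹ • g.val).det = 1 := by
      rw [det_smul, h, Fintype.card_fin]
      field_simp
    let s : SL(2, ZMod p) := ⟨u⁻¹ • g.val, hd⟩
    refine ⟨QuotientGroup.mk s, ?_⟩
    rw [ProjectiveSpecialLinearGroup.toPGL_mk, mk_eq_mk_iff]
    refine ⟨u, hu, ?_⟩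
    rw [SpecialLinearGroup.coe_GL_coe_matrix, show (s : Matrix _ _ (ZMod p)) = u⁻¹ • g.val from rfl,
      smul_smul, mul_inv_cancel₀ hu, one_smul]

lemma L2_le_of_unipotent {J : Subgroup PGL(2, ZMod p)}
    (hU : ∀ t : ZMod p, ProjGenLinGroup.mk (upperRightHom t) ∈ J)
    (hL : ∀ t : ZMod p, ProjGenLinGroup.mk (lower t) ∈ J) : L2 p ≤ J := by
  rintro _ ⟨s, rfl⟩
  induction s using QuotientGroup.induction_on with | H s =>
  rw [ProjectiveSpecialLinearGroup.toPGL_mk]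
  exact mem_of_unipotent (J := J.comap ProjGenLinGroup.mk) hU hL _ s.det_coe

lemma two_ne_zero_of_ne (hp : p ≠ 2) : (2 : ZMod p) ≠ 0 := by
  intro h
  have h2 : ((2 : ℕ) : ZMod p) = 0 := by exact_mod_cast h
  rw [ZMod.natCast_eq_zero_iff] at h2
  exact hp ((Nat.prime_dvd_prime_iff_eq Fact.out Nat.prime_two).1 h2)

lemma upper_mem_L2 (t : ZMod p) : ProjGenLinGroup.mk (upperRightHom t) ∈ L2 p := by
  rw [mk_mem_L2, upper_val, det_fin_two]
  simp

lemma lower_mem_L2 (t : ZMod p) : ProjGenLinGroup.mk (lower t) ∈ L2 p := by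
  rw [mk_mem_L2, lower_val, det_fin_two]
  simp

/-- A subgroup that contains the squares of the elements of `L2 p` contains `L2 p`. -/
lemma L2_le_of_sq (hp : p ≠ 2) {J : Subgroup PGL(2, ZMod p)} (h : ∀ g ∈ L2 p, g ^ 2 ∈ J) :
    L2 p ≤ J := by
  -- For odd `p` every unitriangular matrix is the square of another one, namely that with half the
  -- parameter.
  have half : ∀ t : ZMod p, t / 2 + t / 2 = t := fun t => by
    have h2 := two_ne_zero_of_ne hp
    field_simp
    ring
  refine L2_le_of_unipotent (fun t => ?_) (fun t => ?_)
  · have := h _ (upper_mem_L2 (t / 2))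
    rwa [← map_pow, show (upperRightHom (t / 2) : GL (Fin 2) (ZMod p)) ^ 2 = upperRightHom t by
      refine Units.ext ?_
      rw [Units.val_pow_eq_pow_val, upper_val, upper_val, sq]
      simp only [mul_fin_two, mul_one, mul_zero, zero_mul, add_zero, zero_add, one_mul, half]] at this
  · have := h _ (lower_mem_L2 (t / 2))
    rwa [← map_pow, show (lower (t / 2) : GL (Fin 2) (ZMod p)) ^ 2 = lower t by
      refine Units.ext ?_
      rw [Units.val_pow_eq_pow_val, lower_val, lower_val, sq]
      simp only [mul_fin_two, mul_one, mul_zero, zero_mul, add_zero, zero_add, one_mul, half]] at this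

lemma isSquare_mul_or {d : ZMod p} (hd : ¬ IsSquare d) (b : ZMod p) :
    IsSquare (b * d) ∨ IsSquare b := by
  rcases eq_or_ne b 0 with rfl | hb
  · exact Or.inr (IsSquare.zero)
  · by_contra! h
    have hd0 : d ≠ 0 := by rintro rfl; exact hd IsSquare.zero
    have h1 := quadraticChar_neg_one_iff_not_isSquare.2 h.1
    rw [map_mul, quadraticChar_neg_one_iff_not_isSquare.2 h.2,
      quadraticChar_neg_one_iff_not_isSquare.2 hd] at h1
    norm_num at h1

lemma exists_not_isSquare (hp : p ≠ 2) : ∃ d : ZMod p, ¬ IsSquare d :=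
  FiniteField.exists_nonsquare (by rwa [ZMod.ringChar_zmod_n])

lemma index_L2 (hp : p ≠ 2) : (L2 p).index = 2 := by
  obtain ⟨d, hd⟩ := exists_not_isSquare hp
  have hd0 : d ≠ 0 := by rintro rfl; exact hd IsSquare.zero
  rw [Subgroup.index_eq_two_iff_exists_notMem_and]
  refine ⟨ProjGenLinGroup.mk (diag (Units.mk0 d hd0) 1), ?_, fun g => ?_⟩
  · rw [mk_mem_L2, diag, det_fin_two]
    simpa using hd
  · induction g using ProjGenLinGroup.induction_on with | mk g =>
    rw [← map_mul, mk_mem_L2, mk_mem_L2, Units.val_mul, det_mul]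
    have : (diag (Units.mk0 d hd0) 1).val.det = d := by rw [diag, det_fin_two]; simp
    rw [this]
    exact isSquare_mul_or hd _

/-- A subgroup of index two contains all squares, hence `L2 p`, and the indices agree. -/
lemma index_eq_two_iff (hp : p ≠ 2) (H : Subgroup PGL(2, ZMod p)) : H.index = 2 ↔ H = L2 p := by
  refine ⟨fun h => ?_, fun h => h ▸ index_L2 hp⟩
  have hle : L2 p ≤ H := L2_le_of_sq hp fun g _ => by
    rw [sq, Subgroup.mul_mem_iff_of_index_two h]
  refine le_antisymm ?_ hle
  have := Subgroup.relIndex_mul_index hle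
  rw [h, index_L2 hp] at this
  exact Subgroup.relIndex_eq_one.1 (by omega)

/-- The identification of `L2 p` with the projective special linear group. -/
def equivPSL : L2 p ≃* PSL(2, ZMod p) :=
  (MonoidHom.ofInjective ProjectiveSpecialLinearGroup.toPGL_injective).symm

/-- The factor `C2` is central and non-trivial, whereas `PGL₂(p)` has trivial centre. -/
lemma isEmpty_mulEquiv : IsEmpty (L2 p × C2 ≃* PGL(2, ZMod p)) := by
  refine ⟨fun f => ?_⟩
  have h := eq_one_of_central (f (1, sigma)) fun h => by
    obtain ⟨k, rfl⟩ := f.surjective h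
    rw [← map_mul, ← map_mul]
    congr 1
    exact Prod.ext (by simp) (mul_comm _ _)
  rw [map_eq_one_iff f f.injective] at h
  exact sigma_ne_one (congrArg Prod.snd h)

lemma card_PGL_mul : Nat.card PGL(2, ZMod p) * (p - 1) = (p ^ 2 - 1) * (p ^ 2 - p) := by
  have h1 := Subgroup.card_eq_card_quotient_mul_card_subgroup
    (Subgroup.center (GL (Fin 2) (ZMod p)))
  have hinj : Function.Injective (scalar (Fin 2) : (ZMod p)ˣ →* GL (Fin 2) (ZMod p)) := by
    intro s t h
    have := congrArg (fun g : GL (Fin 2) (ZMod p) => g.val 0 0) h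
    exact Units.ext (by simpa using this)
  have h2 : Nat.card (Subgroup.center (GL (Fin 2) (ZMod p))) = p - 1 := by
    rw [center_eq_range_scalar, ← Nat.card_congr (MonoidHom.ofInjective hinj).toEquiv,
      Nat.card_eq_fintype_card, ZMod.card_units]
  rw [card_GL_field, h2, Fin.prod_univ_two, ZMod.card] at h1
  rw [Fin.val_zero, Fin.val_one, pow_zero, pow_one] at h1
  exact h1.symm

end PGLTwo

end

noncomputable section

/-! ### Arithmetic of the primes `4 * n + 1` modulo `8 * n` -/

lemma infinite_primes {n : ℕ} (hn : 3 ≤ n) :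
    {p : ℕ | p.Prime ∧ p ≡ 4 * n + 1 [MOD 8 * n]}.Infinite := by
  refine Nat.infinite_setOfPred_prime_and_modEq (by omega) ?_
  have h4 : (4 * n + 1).Coprime (4 * n) := by simp
  have h2 : (4 * n + 1).Coprime 2 := by
    rw [show 4 * n + 1 = 1 + 2 * n * 2 by ring, Nat.coprime_add_mul_right_left]
    exact Nat.coprime_one_left 2
  rw [show 8 * n = 2 * (4 * n) by ring]
  exact Nat.Coprime.mul_right h2 h4

/-- The arithmetical data: a prime `p`, and a unit of order `4 * n` modulo `p`. -/
structure UnitOfOrder (p n : ℕ) (d : (ZMod p)ˣ) : Prop where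
  three_le : 3 ≤ n
  modEq : p ≡ 4 * n + 1 [MOD 8 * n]
  order : orderOf d = 4 * n

/-- The oddness of the cofactor `2 * k + 1` is the purpose of working modulo `8n`: it is what makes
elements of order `4n` non-squares. -/
lemma exists_sub_one_eq {p n : ℕ} (hn : 3 ≤ n) (hp : p ≡ 4 * n + 1 [MOD 8 * n]) :
    ∃ k, p = 4 * n * (2 * k + 1) + 1 := by
  have h : p % (8 * n) = 4 * n + 1 := by rw [hp, Nat.mod_eq_of_lt (by omega)]
  refine ⟨p / (8 * n), ?_⟩
  conv_lhs => rw [← Nat.div_add_mod p (8 * n), h]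
  ring

lemma exists_unit_order {p n : ℕ} [Fact p.Prime] (hn : 3 ≤ n) (hp : p ≡ 4 * n + 1 [MOD 8 * n]) :
    ∃ d : (ZMod p)ˣ, orderOf d = 4 * n := by
  obtain ⟨k, hk⟩ := exists_sub_one_eq hn hp
  obtain ⟨g, hg⟩ := IsCyclic.exists_ofOrder_eq_natCard (α := (ZMod p)ˣ)
  have hc : orderOf g = 4 * n * (2 * k + 1) := by
    rw [hg, Nat.card_eq_fintype_card, ZMod.card_units]
    omega
  refine ⟨g ^ (2 * k + 1), ?_⟩
  rw [orderOf_pow_of_dvd (by omega) (hc ▸ dvd_mul_left _ _), hc, Nat.mul_div_cancel _ (by omega)]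

namespace UnitOfOrder

variable {p n : ℕ} {d : (ZMod p)ˣ}

lemma ne_two (t : UnitOfOrder p n d) : p ≠ 2 := by
  obtain ⟨k, hk⟩ := exists_sub_one_eq t.three_le t.modEq
  rw [mul_assoc] at hk
  omega

lemma order_sq (t : UnitOfOrder p n d) : orderOf (d ^ 2) = 2 * n := by
  rw [orderOf_pow_of_dvd two_ne_zero (t.order ▸ Dvd.intro (2 * n) (by ring)), t.order]
  omega

variable [Fact p.Prime]

lemma isSquare_neg_one (t : UnitOfOrder p n d) : IsSquare (-1 : ZMod p) := by
  obtain ⟨k, hk⟩ := exists_sub_one_eq t.three_le t.modEq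
  rw [ZMod.exists_sq_eq_neg_one_iff]
  rw [mul_assoc] at hk
  omega

/-- A square satisfies `d ^ ((p - 1) / 2) = 1`, but `(p - 1) / 2` is `2n` times an odd number and so
not divisible by `4n`. -/
lemma not_isSquare (t : UnitOfOrder p n d) : ¬ IsSquare (d : ZMod p) := by
  obtain ⟨k, hk⟩ := exists_sub_one_eq t.three_le t.modEq
  rintro ⟨e, he⟩
  have he0 : e ≠ 0 := by rintro rfl; exact d.ne_zero (by rw [he, mul_zero])
  have hpow : d ^ (2 * n * (2 * k + 1)) = 1 := by
    refine Units.ext ?_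
    rw [Units.val_pow_eq_pow_val, he, ← sq, ← pow_mul, Units.val_one]
    have := ZMod.pow_card_sub_one_eq_one he0
    rwa [show p - 1 = 2 * (2 * n * (2 * k + 1)) by rw [hk, Nat.add_sub_cancel]; ring] at this
  have hdvd := orderOf_dvd_of_pow_eq_one hpow
  rw [t.order, show 4 * n = 2 * n * 2 by ring,
    Nat.mul_dvd_mul_iff_left (by have := t.three_le; omega)] at hdvd
  omega

lemma pow_ne_one (t : UnitOfOrder p n d) {k : ℕ} (hk : 0 < k) (hk' : k < 12) :
    (d : ZMod p) ^ k ≠ 1 := by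
  intro h
  have : d ^ k = 1 := Units.ext (by rw [Units.val_pow_eq_pow_val, h, Units.val_one])
  have := Nat.le_of_dvd hk (t.order ▸ orderOf_dvd_of_pow_eq_one this)
  have := t.three_le
  omega

variable {a b c : ZMod p}

lemma mul_eq (ha : a ≠ 0) (h : (a ^ 2)⁻¹ * (b * c) + d + (d : ZMod p)⁻¹ = 1) :
    b * c * d = a ^ 2 * (d - d ^ 2 - 1) := by
  have hd := d.ne_zero
  field_simp at h
  linear_combination h

lemma mul_ne_zero (t : UnitOfOrder p n d) (ha : a ≠ 0)
    (h : (a ^ 2)⁻¹ * (b * c) + d + (d : ZMod p)⁻¹ = 1) : b * c ≠ 0 := by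
  intro hbc
  have h1 := mul_eq ha h
  rw [hbc, zero_mul, eq_comm, mul_eq_zero, or_iff_right (pow_ne_zero 2 ha)] at h1
  -- If `bc = 0` then `d² - d + 1 = 0`, which divides `d⁶ - 1`; the order of `d` is at least `12`.
  refine t.pow_ne_one (k := 6) (by norm_num) (by norm_num) ?_
  linear_combination (-(d : ZMod p) ^ 4 - d ^ 3 + d + 1) * h1

/-- Since `-1` is a square and `d` is not, this identity shows that `a² + bc` is a non-square. -/
lemma disc_mul (ha : a ≠ 0) (h : (a ^ 2)⁻¹ * (b * c) + d + (d : ZMod p)⁻¹ = 1) :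
    (a ^ 2 + b * c) * d = - (a * (d - 1)) ^ 2 := by
  linear_combination mul_eq ha h

lemma not_isSquare_disc (t : UnitOfOrder p n d) (ha : a ≠ 0)
    (h : (a ^ 2)⁻¹ * (b * c) + d + (d : ZMod p)⁻¹ = 1) : ¬ IsSquare (a ^ 2 + b * c) := by
  have h1 := disc_mul ha h
  have hd1 : (d : ZMod p) - 1 ≠ 0 := by
    have := t.pow_ne_one (k := 1) (by norm_num) (by norm_num)
    rwa [pow_one, ← sub_ne_zero] at this
  rintro ⟨s, hs⟩
  obtain ⟨i, hi⟩ := t.isSquare_neg_one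
  have hs0 : s ≠ 0 := by
    rintro rfl
    rw [hs, mul_zero, zero_mul, eq_comm, neg_eq_zero] at h1
    exact pow_ne_zero 2 (_root_.mul_ne_zero ha hd1) h1
  refine t.not_isSquare ⟨i * (a * (d - 1)) / s, ?_⟩
  field_simp
  linear_combination h1 - d * hs + (a * (d - 1)) ^ 2 * hi

lemma exists_abc : ∃ a b c : ZMod p, a ≠ 0 ∧ (a ^ 2)⁻¹ * (b * c) + d + (d : ZMod p)⁻¹ = 1 :=
  ⟨1, 1, 1 - d - (d : ZMod p)⁻¹, one_ne_zero, by ring⟩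

end UnitOfOrder

end

noncomputable section

/-! ### Generating pairs of `L2 p` -/

namespace PGLTwo

open Matrix Matrix.GeneralLinearGroup

variable {p : ℕ} [Fact p.Prime]

instance : Finite PGL(2, ZMod p) := Finite.of_surjective _ ProjGenLinGroup.mk_surjective

lemma pow_upper (k : ℕ) (t : ZMod p) :
    (upperRightHom t : GL (Fin 2) (ZMod p)) ^ k = upperRightHom (k * t) := by
  rw [← AddChar.map_nsmul_eq_pow, nsmul_eq_mul]

/-- A subgroup that contains a unipotent element, and an element that moves its fixed point,
contains `L2 p`. -/
lemma L2_le_of_upper {J : Subgroup PGL(2, ZMod p)}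
    (hU : ProjGenLinGroup.mk (upperRightHom (1 : ZMod p)) ∈ J) {h : GL (Fin 2) (ZMod p)}
    (hJ : ProjGenLinGroup.mk h ∈ J) (hc : h 1 0 ≠ 0) : L2 p ≤ J := by
  have hU' : ∀ t : ZMod p, ProjGenLinGroup.mk (upperRightHom t) ∈ J := by
    intro t
    have := pow_mem hU t.val
    rwa [← map_pow, pow_upper, ZMod.natCast_zmod_val, mul_one] at this
  refine L2_le_of_unipotent hU' fun t => ?_
  obtain ⟨a, b, c, e, he⟩ : ∃ a b c e, h.val = !![a, b; c, e] := ⟨_, _, _, _, eta_fin_two h.val⟩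
  replace hc : c ≠ 0 := by rwa [he] at hc
  set k := upperRightHom (-(a / c)) * h with hk
  have hkJ : ProjGenLinGroup.mk k ∈ J := by
    rw [hk, map_mul]; exact mul_mem (hU' _) hJ
  have hd : a * e - b * c ≠ 0 := by simpa [he] using det_ne_zero' h
  obtain ⟨s, hs⟩ : ∃ s, s * c ^ 2 = - (t * (a * e - b * c)) :=
    ⟨-(t * (a * e - b * c)) / c ^ 2, by field_simp⟩
  have : k * upperRightHom s = lower t * k := by
    refine Units.ext ?_
    rw [hk]
    simp only [Units.val_mul, upper_val, lower_val, he, mul_fin_two]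
    clear_value k
    clear hk hkJ he hU hU' hJ
    congr! 3 <;> grind
  have h1 := mul_mem (mul_mem hkJ (hU' s)) (inv_mem hkJ)
  rwa [← map_mul, this, map_mul, mul_inv_cancel_right] at h1

lemma L2_le_of_conj (hp : p ≠ 2) {J : Subgroup PGL(2, ZMod p)} (P : PGL(2, ZMod p))
    (h : L2 p ≤ J.comap (MulAut.conj P).toMonoidHom) : L2 p ≤ J := by
  intro g hg
  have := h ((Subgroup.normal_of_index_eq_two (index_L2 hp)).conj_mem g hg P⁻¹)
  rw [Subgroup.mem_comap] at this
  change P * (P⁻¹ * g * P⁻¹⁻¹) * P⁻¹ ∈ J at this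
  rwa [show P * (P⁻¹ * g * P⁻¹⁻¹) * P⁻¹ = g by group] at this

/-- Parabolic elements are conjugate to unitriangular ones. -/
lemma exists_conj_upper {F : Type} [Field F] {g : GL (Fin 2) F} {s : F}
    (htr : g 0 0 + g 1 1 = 2 * s) (hdet : g 0 0 * g 1 1 - g 0 1 * g 1 0 = s ^ 2)
    (hg : ProjGenLinGroup.mk g ≠ 1) :
    ∃ P : GL (Fin 2) F, ProjGenLinGroup.mk (P⁻¹ * g * P) = ProjGenLinGroup.mk (upperRightHom 1) := by
  have hs : s ≠ 0 := by
    rintro rfl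
    exact det_ne_zero' g (by rw [hdet]; ring)
  have key : ∀ P : GL (Fin 2) F, g.val * P.val = s • (P.val * !![1, 1; 0, 1]) →
      ProjGenLinGroup.mk (P⁻¹ * g * P) = ProjGenLinGroup.mk (upperRightHom 1) := by
    intro P hP
    rw [eq_comm, mk_eq_mk_iff]
    refine ⟨s, hs, ?_⟩
    rw [mul_assoc, Units.val_mul, Units.val_mul, hP, Matrix.mul_smul, ← mul_assoc, ← Units.val_mul,
      inv_mul_cancel, Units.val_one, one_mul, upper_val]
  rw [Ne, mk_eq_one_iff] at hg
  obtain ⟨a, b, c, e, he⟩ : ∃ a b c e, g.val = !![a, b; c, e] := ⟨_, _, _, _, eta_fin_two g.val⟩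
  simp only [he, of_apply, cons_val', cons_val_zero, cons_val_one] at htr hdet hg
  -- The columns of `P` must satisfy `(g - s) P₂ = s P₁`. Any `P₂` outside the kernel of `g - s`
  -- works; `(0, s)` is used when `c = 0` and `(s, 0)` otherwise.
  by_cases hc : c = 0
  · have hb : b ≠ 0 := by
      rintro rfl
      refine hg ⟨rfl, hc, ?_⟩
      have : (a - e) ^ 2 = 0 := by linear_combination (a + e + 2 * s) * htr - 4 * hdet
      exact sub_eq_zero.1 (pow_eq_zero_iff two_ne_zero |>.1 this)
    refine ⟨mkOfDetNeZero !![b, 0; e - s, s] (by simp [hb, hs]), key _ ?_⟩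
    change g.val * !![b, 0; e - s, s] = s • (!![b, 0; e - s, s] * !![1, 1; 0, 1])
    rw [he]
    simp only [mul_fin_two, smul_of, smul_cons, smul_eq_mul, smul_empty]
    clear key
    congr! 3 <;> grind
  · refine ⟨mkOfDetNeZero !![a - s, s; c, 0] (by simp [hc, hs]), key _ ?_⟩
    change g.val * !![a - s, s; c, 0] = s • (!![a - s, s; c, 0] * !![1, 1; 0, 1])
    rw [he]
    simp only [mul_fin_two, smul_of, smul_cons, smul_eq_mul, smul_empty]
    clear key
    congr! 3 <;> grind

/-- If `g ^ p` is the scalar `s`, then `(g - s) ^ p = g ^ p - s ^ p = 0` in characteristic `p`,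
because `s ^ p = s`. So `s` is a double eigenvalue. -/
lemma isParabolic_of_pow {g : GL (Fin 2) (ZMod p)} (hg : ProjGenLinGroup.mk g ^ p = 1) :
    ∃ s : ZMod p, g 0 0 + g 1 1 = 2 * s ∧ g 0 0 * g 1 1 - g 0 1 * g 1 0 = s ^ 2 := by
  rw [← map_pow, mk_eq_one_iff] at hg
  obtain ⟨h1, h2, h3⟩ := hg
  set s := (g ^ p) 0 0 with hs
  have hpow : g.val ^ p = scalar (Fin 2) s := by
    rw [← Units.val_pow_eq_pow_val, eta_fin_two (g ^ p).val, h1, h2, ← h3]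
    ext i j
    fin_cases i <;> fin_cases j <;> simp [hs]
  have hnil : (g.val - scalar (Fin 2) s) ^ p = 0 := by
    rw [sub_pow_char_of_commute _ (Matrix.scalar_commute s (fun r => Commute.all s r) _).symm, hpow,
      ← map_pow, ZMod.pow_card, sub_self]
  have htr := (isNilpotent_trace_of_isNilpotent ⟨p, hnil⟩).eq_zero
  have hdet : (g.val - scalar (Fin 2) s).det = 0 := by
    refine pow_eq_zero_iff (n := p) (Fact.out : p.Prime).ne_zero |>.1 ?_
    rw [← det_pow, hnil, det_zero]
  rw [trace_fin_two] at htr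
  rw [det_fin_two] at hdet
  simp only [Matrix.sub_apply, scalar_apply, diagonal_apply_eq] at htr hdet
  simp at hdet
  exact ⟨s, by linear_combination htr, by linear_combination hdet + s * htr⟩

/-- A subgroup of order divisible by `p` without fixed points contains `L2 p`. -/
lemma L2_le_of_dvd_card (hp : p ≠ 2) {J : Subgroup PGL(2, ZMod p)} (hdvd : p ∣ Nat.card J)
    (hJ : ∀ v : Fin 2 → ZMod p, v ≠ 0 → ∃ g : GL (Fin 2) (ZMod p), ProjGenLinGroup.mk g ∈ J ∧
      ∀ a : ZMod p, g.val *ᵥ v ≠ a • v) : L2 p ≤ J := by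
  -- Cauchy's theorem supplies an element of order `p`, which is conjugate to a transvection; the
  -- hypothesis on `J` gives an element moving its fixed point.
  obtain ⟨⟨g, hgJ⟩, hg⟩ := exists_prime_orderOf_dvd_card' p hdvd
  rw [Subgroup.orderOf_mk] at hg
  induction g using ProjGenLinGroup.induction_on with | mk g =>
  obtain ⟨s, htr, hdet⟩ := isParabolic_of_pow (g := g) (orderOf_dvd_iff_pow_eq_one.1 hg.dvd)
  obtain ⟨P, hP⟩ := exists_conj_upper htr hdet fun h => by
    rw [h, orderOf_one] at hg
    exact (Fact.out : p.Prime).one_lt.ne hg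
  refine L2_le_of_conj hp (ProjGenLinGroup.mk P) ?_
  have hmem : ∀ k : GL (Fin 2) (ZMod p), ProjGenLinGroup.mk k ∈ J → ProjGenLinGroup.mk (P⁻¹ * k * P) ∈
      J.comap (MulAut.conj (ProjGenLinGroup.mk P)).toMonoidHom := by
    intro k hk
    rw [Subgroup.mem_comap]
    change ProjGenLinGroup.mk P * ProjGenLinGroup.mk (P⁻¹ * k * P) * (ProjGenLinGroup.mk P)⁻¹ ∈ J
    rw [← map_inv, ← map_mul, ← map_mul]
    rwa [show P * (P⁻¹ * k * P) * P⁻¹ = k by group]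
  have hv : P.val *ᵥ ![1, 0] ≠ 0 := by
    intro h
    have := congrArg (P⁻¹.val *ᵥ ·) h
    simp only [mulVec_mulVec, ← Units.val_mul, inv_mul_cancel, Units.val_one, one_mulVec,
      mulVec_zero] at this
    simpa using congrFun this 0
  obtain ⟨k, hk, hkv⟩ := hJ _ hv
  refine L2_le_of_upper (hP ▸ hmem g hgJ) (hmem k hk) fun h0 => hkv ((P⁻¹ * k * P) 0 0) ?_
  have h1 : (P⁻¹ * k * P).val *ᵥ ![1, 0] = (P⁻¹ * k * P) 0 0 • ![1, 0] := by
    ext i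
    fin_cases i
    · simp [mulVec, dotProduct, Fin.sum_univ_two]
    · simpa [mulVec, dotProduct, Fin.sum_univ_two] using h0
  rw [← mulVec_smul, ← h1, mulVec_mulVec, mulVec_mulVec, ← Units.val_mul, ← Units.val_mul]
  congr 2
  group

end PGLTwo

end

noncomputable section

/-! ### Groups all of whose non-trivial elements have two fixed points -/

/-- With `f i` the orbit sizes of a group of order `N`, the hypothesis reads `∑ (N - f i) = 2N - 2`,
as in the classification of finite rotation groups. A non-free orbit contributes at least `N / 2`.
If `f j ≥ 3` and `6 f j ≤ N`, the other orbits contribute at least `N + 1` and less than `7N / 6`,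
so exactly two of them are non-free. Two halves contribute only `N`, and otherwise the contribution
is at least `N / 2 + 2N / 3`. -/
lemma le_two_of_sum {ι : Type} [Fintype ι] {N : ℕ} (hN : 0 < N) (f : ι → ℕ) (hf : ∀ i, f i ∣ N)
    (h : ∑ i, f i + 2 * (N - 1) = Fintype.card ι * N) (j : ι) (hj : 6 * f j ≤ N) : f j ≤ 2 := by
  classical
  by_contra! hj3
  have hle : ∀ i, f i ≤ N := fun i => Nat.le_of_dvd hN (hf i)
  have hcases : ∀ i, f i = N ∨ 2 * f i = N ∨ 3 * f i ≤ N := by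
    intro i
    obtain ⟨k, hk⟩ := hf i
    rcases k with _ | _ | _ | k
    · omega
    · left; omega
    · right; left; rw [hk]; ring
    · right; right; rw [hk, mul_comm]; gcongr; omega
  have hsum : ∑ i, (N - f i) + ∑ i, f i = Fintype.card ι * N := by
    rw [← Finset.sum_add_distrib, Finset.sum_congr rfl fun i _ => Nat.sub_add_cancel (hle i),
      Finset.sum_const, Finset.card_univ, smul_eq_mul]
  have hS := Finset.add_sum_erase Finset.univ (fun i => N - f i) (Finset.mem_univ j)
  rw [← Finset.sum_filter_ne_zero] at hS
  set A := (Finset.univ.erase j).filter fun i => N - f i ≠ 0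
  have hA : ∀ i ∈ A, 2 * f i = N ∨ 3 * f i ≤ N := by
    intro i hi
    have := (Finset.mem_filter.1 hi).2
    have := hcases i
    omega
  have hcard := Finset.card_nsmul_le_sum A (fun i => 2 * (N - f i)) N fun i hi => by
    have := hA i hi
    omega
  rw [← Finset.mul_sum, smul_eq_mul] at hcard
  have h2 : A.card ≤ 2 := by
    by_contra! h3
    have := Nat.mul_le_mul_right N h3
    omega
  have hup := Finset.sum_le_card_nsmul A (fun i => N - f i) N fun i _ => Nat.sub_le _ _
  rw [smul_eq_mul] at hup
  have h2' : A.card = 2 := by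
    by_contra hne
    have := Nat.mul_le_mul_right N (show A.card ≤ 1 by omega)
    omega
  obtain ⟨i, k, hik, hAik⟩ := Finset.card_eq_two.1 h2'
  have hi := hA i (by rw [hAik]; simp)
  have hk := hA k (by rw [hAik]; simp)
  rw [hAik, Finset.sum_pair hik] at hS
  omega

/-- In a finite permutation group all of whose non-trivial elements have exactly two fixed points,
large stabilisers have small orbits. -/
lemma card_orbit_le_two {J X : Type} [Group J] [Finite J] [MulAction J X] [Finite X]
    (hfix : ∀ g : J, g ≠ 1 → Nat.card (MulAction.fixedBy X g) = 2) (x : X)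
    (hx : 6 ≤ Nat.card (MulAction.stabilizer J x)) : Nat.card (MulAction.orbit J x) ≤ 2 := by
  classical
  have := Fintype.ofFinite J
  have := Fintype.ofFinite X
  have hmul : ∀ y : X, Nat.card (MulAction.orbit J y) * Nat.card (MulAction.stabilizer J y) =
      Nat.card J := by
    intro y
    simp only [Nat.card_eq_fintype_card]
    exact MulAction.card_orbit_mul_card_stabilizer_eq_card_group J y
  -- Burnside's lemma: the identity fixes all of `X`, every other element fixes two points.
  have hburn := MulAction.sum_card_fixedBy_eq_card_orbits_mul_card_group J X
  have hX := Fintype.card_congr (MulAction.selfEquivSigmaOrbits J X)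
  rw [Fintype.card_sigma] at hX
  rw [← Finset.add_sum_erase Finset.univ _ (Finset.mem_univ (1 : J)),
    Finset.sum_congr rfl (g := fun _ => 2) (fun g hg => by
      rw [← Nat.card_eq_fintype_card]; exact hfix g (Finset.ne_of_mem_erase hg)),
    Finset.sum_const, Finset.card_erase_of_mem (Finset.mem_univ _), Finset.card_univ,
    smul_eq_mul] at hburn
  have h1 : Fintype.card (MulAction.fixedBy X (1 : J)) = Fintype.card X := by
    rw [← Nat.card_eq_fintype_card, MulAction.fixedBy_one_eq_univ, Nat.card_univ,
      Nat.card_eq_fintype_card]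
  rw [h1, hX] at hburn
  have horb : MulAction.orbit J (Quotient.mk (MulAction.orbitRel J X) x).out =
      MulAction.orbit J x :=
    MulAction.orbit_eq_iff.2 (MulAction.orbitRel_apply.1
      (@Quotient.mk_out X (MulAction.orbitRel J X) x))
  have := le_two_of_sum (N := Fintype.card J) Fintype.card_pos
    (fun q : Quotient (MulAction.orbitRel J X) => Fintype.card (MulAction.orbit J q.out))
    (fun q => ?_) (by rw [← hburn]; ring) (Quotient.mk _ x) ?_
  · rw [← Nat.card_eq_fintype_card, horb] at this
    exact this
  · rw [← Nat.card_eq_fintype_card, ← Nat.card_eq_fintype_card, ← hmul q.out]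
    exact dvd_mul_right _ _
  · rw [← Nat.card_eq_fintype_card, ← Nat.card_eq_fintype_card, horb, ← hmul x, mul_comm]
    gcongr

/-! ### Fixed points on the projective line over the quadratic extension -/

namespace PGLTwo

open Matrix Matrix.GeneralLinearGroup

open scoped Classical in
-- Finite fixed points are the roots of a quadratic polynomial whose discriminant is that of the
-- characteristic polynomial. If the lower left entry vanishes, the polynomial becomes linear and
-- `∞` takes the place of the second root.
lemma exists_fixed_points {K : Type} [Field K] [NeZero (2 : K)] {g : GL (Fin 2) K} {r : K}
    (hr : r ≠ 0) (hd : (g 0 0 + g 1 1) ^ 2 - 4 * (g 0 0 * g 1 1 - g 0 1 * g 1 0) = r * r) :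
    ∃ x y : OnePoint K, x ≠ y ∧ ∀ z, g • z = z ↔ z = x ∨ z = y := by
  have h2 : (2 : K) ≠ 0 := NeZero.ne _
  have hfin : ∀ k : K, g • (k : OnePoint K) = k ↔
      g 1 0 * (k * k) + (g 1 1 - g 0 0) * k + -g 0 1 = 0 := by
    intro k
    rw [← fixpointPolynomial_aeval_eq_zero_iff, fixpointPolynomial]
    simp [sq, sub_eq_add_neg]
  by_cases hc : g 1 0 = 0
  · have hne : g 1 1 - g 0 0 ≠ 0 := by
      intro h
      apply hr
      rw [hc, sub_eq_zero.1 h] at hd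
      exact mul_self_eq_zero.1 (by linear_combination -hd)
    refine ⟨OnePoint.infty, ((g 0 1 / (g 1 1 - g 0 0) : K) : OnePoint K),
      OnePoint.infty_ne_coe _, fun z => ?_⟩
    cases z with
    | infty => simp [OnePoint.smul_infty_eq_self_iff, hc]
    | coe k =>
      rw [hfin, hc, or_iff_right (OnePoint.coe_ne_infty k), OnePoint.coe_eq_coe, eq_div_iff hne]
      constructor <;> intro h <;> linear_combination h
  · have hdisc : discrim (g 1 0) (g 1 1 - g 0 0) (-g 0 1) = r * r := by
      rw [discrim]
      linear_combination hd
    refine ⟨(((-(g 1 1 - g 0 0) + r) / (2 * g 1 0) : K) : OnePoint K),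
      (((-(g 1 1 - g 0 0) - r) / (2 * g 1 0) : K) : OnePoint K), ?_, fun z => ?_⟩
    · rw [Ne, OnePoint.coe_eq_coe, div_left_inj' (mul_ne_zero h2 hc)]
      intro h
      exact hr ((mul_eq_zero.1 (show 2 * r = 0 by linear_combination h)).resolve_left h2)
    · cases z with
      | infty =>
        rw [OnePoint.smul_infty_eq_self_iff]
        simp [hc]
      | coe k =>
        rw [hfin, quadratic_eq_zero_iff hc hdisc, OnePoint.coe_eq_coe, OnePoint.coe_eq_coe]

variable {p : ℕ} [Fact p.Prime]

/-- Euler's criterion: `(p² - 1) / 2` is a multiple of `p - 1`, so non-zero elements of the prime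
field pass it. -/
lemma isSquare_algebraMap (hp : p ≠ 2) (t : ZMod p) :
    IsSquare (algebraMap (ZMod p) (GaloisField p 2) t) := by
  have := Fintype.ofFinite (GaloisField p 2)
  rcases eq_or_ne t 0 with rfl | ht
  · rw [map_zero]; exact IsSquare.zero
  · rw [FiniteField.isSquare_iff]
    · have hcard : Fintype.card (GaloisField p 2) = p ^ 2 := by
        rw [← Nat.card_eq_fintype_card, GaloisField.card p 2 two_ne_zero]
      obtain ⟨m, hm⟩ := (Fact.out : p.Prime).odd_of_ne_two hp
      have : p ^ 2 / 2 = (p - 1) * (m + 1) := by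
        have e1 : p ^ 2 = 2 * (2 * m * (m + 1)) + 1 := by rw [hm]; ring
        have e2 : p - 1 = 2 * m := by omega
        rw [e2]
        omega
      rw [hcard, this, pow_mul, ← map_pow, ZMod.pow_card_sub_one_eq_one ht, map_one, one_pow]
    · rwa [ringChar.eq (GaloisField p 2) p]
    · rwa [Ne, map_eq_zero]

open scoped Classical in
/-- The action of `PGL₂(p)` on the projective line over the quadratic extension. -/
instance : MulAction PGL(2, ZMod p) (OnePoint (GaloisField p 2)) :=
  letI : MulAction (GL (Fin 2) (ZMod p)) (OnePoint (GaloisField p 2)) :=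
    MulAction.compHom _ (Matrix.GeneralLinearGroup.map (algebraMap (ZMod p) (GaloisField p 2)))
  ProjGenLinGroup.mulActionOfGL fun u x => by
    change Matrix.GeneralLinearGroup.map (algebraMap (ZMod p) (GaloisField p 2))
      (scalar (Fin 2) u) • x = x
    rw [Matrix.GeneralLinearGroup.map_scalar]
    cases x with
    | infty => rw [OnePoint.smul_infty_eq_self_iff]; simp
    | coe k => rw [← fixpointPolynomial_aeval_eq_zero_iff, fixpointPolynomial]; simp

open scoped Classical in
lemma mk_smul (g : GL (Fin 2) (ZMod p)) (x : OnePoint (GaloisField p 2)) :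
    ProjGenLinGroup.mk g • x =
      Matrix.GeneralLinearGroup.map (algebraMap (ZMod p) (GaloisField p 2)) g • x := rfl

open scoped Classical in
lemma smul_of_diag {K : Type} [Field K] {g : GL (Fin 2) K} {a : K} (ha : a ≠ 0)
    (hg : g.val = !![a, 0; 0, a⁻¹]) (k : K) :
    g • (k : OnePoint K) = ((a ^ 2 * k : K) : OnePoint K) := by
  rw [OnePoint.smul_some_eq_ite, hg]
  simp [ha]
  field_simp

lemma map_diag {F K : Type} [Field F] [Field K] (f : F →+* K) {g : GL (Fin 2) F} {a : F}
    (hg : g.val = !![a, 0; 0, a⁻¹]) :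
    (Matrix.GeneralLinearGroup.map f g).val = !![f a, 0; 0, (f a)⁻¹] := by
  rw [eta_fin_two (Matrix.GeneralLinearGroup.map f g).val]
  simp [hg]

open scoped Classical in
lemma smul_zero_eq {K : Type} [Field K] {g : GL (Fin 2) K} (hg : g 1 1 ≠ 0) :
    g • ((0 : K) : OnePoint K) = ((g 0 1 / g 1 1 : K) : OnePoint K) := by
  rw [OnePoint.smul_some_eq_ite]
  simp [hg]

instance : Finite (OnePoint (GaloisField p 2)) :=
  inferInstanceAs (Finite (Option (GaloisField p 2)))

/-- If the discriminant vanished, the element would be conjugate to a transvection and have order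
`p`. A non-zero discriminant acquires a square root in the quadratic extension. -/
lemma exists_fixed_points_of_coprime (hp : p ≠ 2) {g : PGL(2, ZMod p)} (hg : g ≠ 1)
    (hgp : ¬ p ∣ orderOf g) :
    ∃ x y : OnePoint (GaloisField p 2), x ≠ y ∧ ∀ z, g • z = z ↔ z = x ∨ z = y := by
  classical
  induction g using ProjGenLinGroup.induction_on with | mk g =>
  have h2 := two_ne_zero_of_ne hp
  have h2' : NeZero (2 : GaloisField p 2) := by
    refine ⟨fun h => h2 ((algebraMap (ZMod p) (GaloisField p 2)).injective ?_)⟩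
    rw [map_ofNat, h, map_zero]
  set D : ZMod p := (g 0 0 + g 1 1) ^ 2 - 4 * (g 0 0 * g 1 1 - g 0 1 * g 1 0) with hD
  have hD0 : D ≠ 0 := by
    intro h0
    obtain ⟨P, hP⟩ := exists_conj_upper (g := g) (s := (g 0 0 + g 1 1) / 2) (by field_simp)
      (by field_simp; linear_combination -h0) hg
    have hP' : ProjGenLinGroup.mk g = MulAut.conj (ProjGenLinGroup.mk P)
        (ProjGenLinGroup.mk (upperRightHom 1)) := by
      rw [MulAut.conj_apply, ← hP, ← map_inv, ← map_mul, ← map_mul]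
      congr 1
      group
    have hpow : ProjGenLinGroup.mk g ^ p = 1 := by
      rw [hP', ← map_pow, ← map_pow, pow_upper, mul_one, CharP.cast_eq_zero, AddChar.map_zero_eq_one,
        map_one, map_one]
    rcases (Nat.dvd_prime Fact.out).1 (orderOf_dvd_of_pow_eq_one hpow) with h | h
    · exact hg (orderOf_eq_one_iff.1 h)
    · exact hgp h.symm.dvd
  obtain ⟨r, hr⟩ := isSquare_algebraMap hp D
  have hr0 : r ≠ 0 := by
    rintro rfl
    rw [mul_zero, map_eq_zero] at hr
    exact hD0 hr
  refine exists_fixed_points hr0 ?_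
  rw [← hr, hD]
  simp only [map_sub, map_pow, map_add, map_mul, map_ofNat, Matrix.GeneralLinearGroup.map_apply]

lemma card_fixedBy (hp : p ≠ 2) {J : Subgroup PGL(2, ZMod p)} (hJ : ¬ p ∣ Nat.card J) {g : J}
    (hg : g ≠ 1) : Nat.card (MulAction.fixedBy (OnePoint (GaloisField p 2)) g) = 2 := by
  obtain ⟨x, y, hxy, h⟩ := exists_fixed_points_of_coprime hp (g := g)
    (fun h => hg (Subtype.ext h))
    (fun h => hJ (h.trans (by rw [Subgroup.orderOf_coe]; exact orderOf_dvd_natCard g)))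
  have : MulAction.fixedBy (OnePoint (GaloisField p 2)) g = {x, y} := Set.ext h
  rw [this, Nat.card_coe_set_eq, Set.ncard_pair hxy]

open scoped Classical in
/-- A group that contains a diagonal element of order at least six and a matrix without zeros
contains `L2 p`. -/
lemma L2_le_of_diag (hp : p ≠ 2) {J : Subgroup PGL(2, ZMod p)} {d : (ZMod p)ˣ}
    {Y M : GL (Fin 2) (ZMod p)} (hY : Y.val = !![(d : ZMod p), 0; 0, (d : ZMod p)⁻¹])
    (hYJ : ProjGenLinGroup.mk Y ∈ J) (hMJ : ProjGenLinGroup.mk M ∈ J)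
    (hord : 6 ≤ orderOf (ProjGenLinGroup.mk Y)) (hd : (d : ZMod p) ^ 2 ≠ 1) (h01 : M 0 1 ≠ 0)
    (h10 : M 1 0 ≠ 0) (h11 : M 1 1 ≠ 0) : L2 p ≤ J := by
  have hd0 := d.ne_zero
  by_cases hdvd : p ∣ Nat.card J
  · refine L2_le_of_dvd_card hp hdvd fun v hv => ?_
    by_cases hv0 : v 0 = 0
    · refine ⟨M, hMJ, fun a h => ?_⟩
      have h0 := congrFun h 0
      simp only [mulVec, dotProduct, Fin.sum_univ_two, Pi.smul_apply, hv0, mul_zero, zero_add,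
        smul_eq_mul, mul_eq_zero, h01, false_or] at h0
      exact hv (funext fun i => by fin_cases i <;> assumption)
    · by_cases hv1 : v 1 = 0
      · refine ⟨M, hMJ, fun a h => ?_⟩
        have h0 := congrFun h 1
        simp only [mulVec, dotProduct, Fin.sum_univ_two, Pi.smul_apply, hv1, mul_zero, add_zero,
          smul_eq_mul, mul_eq_zero, h10, false_or] at h0
        exact hv0 h0
      · refine ⟨Y, hYJ, fun a h => ?_⟩
        have h0 := congrFun h 0
        have h1 := congrFun h 1
        simp only [hY, mulVec, dotProduct, Fin.sum_univ_two, Pi.smul_apply, smul_eq_mul, of_apply,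
          cons_val', cons_val_zero, cons_val_one, zero_mul, add_zero, zero_add] at h0 h1
        have e0 := mul_right_cancel₀ hv0 h0
        have e1 := mul_right_cancel₀ hv1 h1
        rw [← e0, ← mul_eq_one_iff_inv_eq₀ hd0, ← sq] at e1
        exact hd e1
  -- The stabiliser of the point `0` contains the diagonal element, so its order is at least six and
  -- its orbit should have at most two points. But `0`, its image under `M` and the further image
  -- under `Y` are distinct.
  · exfalso
    have hYmul : ∀ k : ZMod p, ProjGenLinGroup.mk Y •
        ((algebraMap _ (GaloisField p 2) k : GaloisField p 2) : OnePoint (GaloisField p 2)) =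
        ((algebraMap _ (GaloisField p 2) (d ^ 2 * k) : GaloisField p 2) :
          OnePoint (GaloisField p 2)) := by
      intro k
      rw [mk_smul, smul_of_diag (a := algebraMap (ZMod p) (GaloisField p 2) d), map_mul, map_pow]
      · rwa [Ne, map_eq_zero]
      · exact map_diag _ hY
    let o : OnePoint (GaloisField p 2) :=
      ((algebraMap (ZMod p) (GaloisField p 2) 0 : GaloisField p 2) : OnePoint (GaloisField p 2))
    have hstab : 6 ≤ Nat.card (MulAction.stabilizer J o) := by
      have hmem : (⟨ProjGenLinGroup.mk Y, hYJ⟩ : J) ∈ MulAction.stabilizer J o := by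
        rw [MulAction.mem_stabilizer_iff]
        exact (hYmul 0).trans (by rw [mul_zero])
      refine hord.trans ?_
      rw [← Subgroup.orderOf_mk _ hYJ, ← Subgroup.orderOf_mk _ hmem]
      exact orderOf_le_card
    have horb := card_orbit_le_two (fun g hg => card_fixedBy hp hdvd hg) o hstab
    set A : ZMod p := M 0 1 / M 1 1 with hA
    have hA0 : A ≠ 0 := div_ne_zero h01 h11
    have hMo : ProjGenLinGroup.mk M • o = ((algebraMap (ZMod p) (GaloisField p 2) A :
        GaloisField p 2) : OnePoint (GaloisField p 2)) := by
      change ProjGenLinGroup.mk M •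
        ((algebraMap (ZMod p) (GaloisField p 2) 0 : GaloisField p 2) :
          OnePoint (GaloisField p 2)) = _
      rw [mk_smul, map_zero, smul_zero_eq, hA, map_div₀, Matrix.GeneralLinearGroup.map_apply,
        Matrix.GeneralLinearGroup.map_apply]
      rwa [Matrix.GeneralLinearGroup.map_apply, Ne, map_eq_zero]
    have hinj : ∀ k l : ZMod p, ((algebraMap (ZMod p) (GaloisField p 2) k : GaloisField p 2) :
        OnePoint (GaloisField p 2)) = ((algebraMap (ZMod p) (GaloisField p 2) l :
        GaloisField p 2) : OnePoint (GaloisField p 2)) ↔ k = l := by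
      intro k l
      rw [OnePoint.coe_eq_coe, (algebraMap (ZMod p) (GaloisField p 2)).injective.eq_iff]
    have hsub : ({o, ProjGenLinGroup.mk M • o,
        ProjGenLinGroup.mk Y • ProjGenLinGroup.mk M • o} : Set _) ⊆ MulAction.orbit J o := by
      rintro z (rfl | rfl | rfl)
      · exact MulAction.mem_orbit_self _
      · exact ⟨⟨_, hMJ⟩, rfl⟩
      · exact ⟨⟨_, hYJ⟩ * ⟨_, hMJ⟩, mul_smul _ _ _⟩
    have h3 := Set.ncard_le_ncard hsub
    rw [hMo, hYmul, Set.ncard_eq_three.2 ⟨_, _, _, ?_, ?_, ?_, rfl⟩, ← Nat.card_coe_set_eq] at h3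
    · omega
    · rw [Ne, hinj]; exact hA0.symm
    · rw [Ne, hinj]; exact (mul_ne_zero (pow_ne_zero 2 hd0) hA0).symm
    · rw [Ne, hinj]
      intro h
      exact hd (mul_right_cancel₀ hA0 (by rw [one_mul, ← h]))

end PGLTwo

end

noncomputable section

/-! ### The generating triples -/

/-- Because `y z` is an involution, `y` normalises the subgroup `J` on the right. As `y²` is in `J`,
the group generated by `y` and `z²` is contained in `J ∪ J y`, and all its squares lie in `J`. -/
lemma sq_mem_closure {Γ : Type} [Group Γ] {y z : Γ} (h : (y * z) ^ 2 = 1) {g : Γ}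
    (hg : g ∈ Subgroup.closure {y, z ^ 2}) :
    g ^ 2 ∈ Subgroup.closure {y ^ 2, z ^ 2, z * y ^ 2 * z⁻¹} := by
  set J := Subgroup.closure {y ^ 2, z ^ 2, z * y ^ 2 * z⁻¹} with hJ
  have hy : y ^ 2 ∈ J := Subgroup.subset_closure (Or.inl rfl)
  have hz : z ^ 2 ∈ J := Subgroup.subset_closure (Or.inr (Or.inl rfl))
  have hzy : z⁻¹ * y ^ 2 * z ∈ J := by
    have h3 : z * y ^ 2 * z⁻¹ ∈ J := Subgroup.subset_closure (Or.inr (Or.inr rfl))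
    have := mul_mem (mul_mem (inv_mem hz) h3) hz
    rwa [show (z ^ 2)⁻¹ * (z * y ^ 2 * z⁻¹) * z ^ 2 = z⁻¹ * y ^ 2 * z by group] at this
  have e1 : y * z = z⁻¹ * y⁻¹ := by
    rw [← mul_inv_rev, eq_inv_iff_mul_eq_one, ← sq, h]
  have h1 : ∀ g ∈ J, y * g * y⁻¹ ∈ J := by
    have : J ≤ J.comap (MulAut.conj y).toMonoidHom := by
      refine (Subgroup.closure_le _).2 ?_
      rintro g (rfl | rfl | rfl)
      · change y * y ^ 2 * y⁻¹ ∈ J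
        rwa [show y * y ^ 2 * y⁻¹ = y ^ 2 by group]
      · change y * z ^ 2 * y⁻¹ ∈ J
        have := mul_mem (mul_mem (inv_mem hzy) (inv_mem hz)) (inv_mem hy)
        rwa [show (z⁻¹ * y ^ 2 * z)⁻¹ * (z ^ 2)⁻¹ * (y ^ 2)⁻¹ =
          (z⁻¹ * y⁻¹) * (y⁻¹ * (z⁻¹ * y⁻¹)) * y⁻¹ by group, ← e1,
          show y * z * (y⁻¹ * (y * z)) * y⁻¹ = y * z ^ 2 * y⁻¹ by rw [sq]; group] at this
      · change y * (z * y ^ 2 * z⁻¹) * y⁻¹ ∈ J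
        rwa [show y * (z * y ^ 2 * z⁻¹) * y⁻¹ = (y * z) * y ^ 2 * (y * z)⁻¹ by group, e1,
          show z⁻¹ * y⁻¹ * y ^ 2 * (z⁻¹ * y⁻¹)⁻¹ = z⁻¹ * y ^ 2 * z by group]
    exact fun g hg => this hg
  have h2 : ∀ g ∈ J, y⁻¹ * g * y ∈ J := by
    intro g hg
    have := mul_mem (mul_mem (inv_mem hy) (h1 g hg)) hy
    rwa [show (y ^ 2)⁻¹ * (y * g * y⁻¹) * y ^ 2 = y⁻¹ * g * y by group] at this
  have hle : Subgroup.closure {y, z ^ 2} ≤ twoCosets h1 h2 hy := by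
    refine (Subgroup.closure_le _).2 ?_
    rintro g (rfl | rfl)
    · exact Or.inr (by rwa [← sq])
    · exact Or.inl hz
  rcases hle hg with h3 | h3
  · exact pow_mem h3 2
  · have := mul_mem (mul_mem h3 (h2 _ h3)) (inv_mem hy)
    rwa [show g * y * (y⁻¹ * (g * y) * y) * (y ^ 2)⁻¹ = g ^ 2 by rw [sq, sq]; group] at this

namespace UnitOfOrder

open Matrix.GeneralLinearGroup PGLTwo

open Matrix (mul_fin_two of_apply cons_val' cons_val_zero cons_val_one)

variable {p n : ℕ} [Fact p.Prime] {d : (ZMod p)ˣ} {a b c : ZMod p} {X Y : GL (Fin 2) (ZMod p)}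

lemma orderOf_involution (hp : p ≠ 2)
    (hX : (X : Matrix (Fin 2) (Fin 2) (ZMod p)) = !![a, b; c, -a]) :
    orderOf (Matrix.ProjGenLinGroup.mk X) = 2 := by
  refine orderOf_eq_prime ?_ ?_
  · rw [← map_pow, mk_eq_one_iff, Units.val_pow_eq_pow_val, hX, sq, mul_fin_two]
    refine ⟨?_, ?_, ?_⟩ <;> simp only [of_apply, cons_val', cons_val_zero, cons_val_one] <;> ring
  · rw [Ne, mk_eq_one_iff, hX]
    rintro ⟨h1, h2, h3⟩
    have hd := det_ne_zero' X
    simp only [hX, of_apply, cons_val', cons_val_zero, cons_val_one] at h1 h2 h3 hd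
    have ha : 2 * a = 0 := by linear_combination h3
    rw [mul_eq_zero, or_iff_right (two_ne_zero_of_ne hp)] at ha
    exact hd (by rw [h1, ha]; ring)

lemma orderOf_diag (t : UnitOfOrder p n d)
    (hY : (Y : Matrix (Fin 2) (Fin 2) (ZMod p)) = !![(d : ZMod p), 0; 0, (d : ZMod p)⁻¹]) :
    orderOf (Matrix.ProjGenLinGroup.mk Y) = 2 * n := by
  have : Y = diag d d⁻¹ := Units.ext (by simp only [hY, diag, Units.val_inv_eq_inv_val])
  rw [this, orderOf_mk_diag, div_inv_eq_mul, ← sq, t.order_sq]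

lemma diag_mem_L2
    (hY : (Y : Matrix (Fin 2) (Fin 2) (ZMod p)) = !![(d : ZMod p), 0; 0, (d : ZMod p)⁻¹]) :
    Matrix.ProjGenLinGroup.mk Y ∈ L2 p := by
  have hdet : Y.val.det = 1 := by
    rw [hY, Matrix.det_fin_two_of, mul_zero, sub_zero, mul_inv_cancel₀ d.ne_zero]
  rw [mk_mem_L2, hdet]
  exact IsSquare.one

lemma mk_notMem_L2 (t : UnitOfOrder p n d)
    (hX : (X : Matrix (Fin 2) (Fin 2) (ZMod p)) = !![a, b; c, -a])
    (h : ¬ IsSquare (a ^ 2 + b * c)) : Matrix.ProjGenLinGroup.mk X ∉ L2 p := by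
  have hdet : X.val.det = -1 * (a ^ 2 + b * c) := by rw [hX, Matrix.det_fin_two_of]; ring
  rw [mk_mem_L2, hdet]
  intro hs
  apply h
  have := t.isSquare_neg_one.mul hs
  rwa [← mul_assoc, neg_one_mul, neg_neg, one_mul] at this

/-- The matrices of the generating triple. -/
structure IsPair (d : (ZMod p)ˣ) (a b c : ZMod p) (X Y : GL (Fin 2) (ZMod p)) : Prop where
  ne_zero : a ≠ 0
  eq_one : (a ^ 2)⁻¹ * (b * c) + d + (d : ZMod p)⁻¹ = 1
  hX : (X : Matrix (Fin 2) (Fin 2) (ZMod p)) = !![a, b; c, -a]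
  hY : (Y : Matrix (Fin 2) (Fin 2) (ZMod p)) = !![(d : ZMod p), 0; 0, (d : ZMod p)⁻¹]

namespace IsPair

lemma val_mul (h : IsPair d a b c X Y) :
    (X * Y).val = !![a * d, b * (d : ZMod p)⁻¹; c * d, -a * (d : ZMod p)⁻¹] := by
  rw [Units.val_mul, h.hX, h.hY, mul_fin_two]
  simp only [mul_zero, add_zero, zero_add]

/-- The eigenvalues of `X Y` are `a (d - 1)` and `a (d - 1) / d`, with ratio `d`. The columns of the
conjugating matrix are corresponding eigenvectors. -/
lemma orderOf_mul (h : IsPair d a b c X Y) (t : UnitOfOrder p n d) :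
    orderOf (Matrix.ProjGenLinGroup.mk (X * Y)) = 4 * n := by
  have hd := d.ne_zero
  have ha := h.ne_zero
  have hbc := mul_eq ha h.eq_one
  have hb : b ≠ 0 := left_ne_zero_of_mul (t.mul_ne_zero ha h.eq_one)
  have hd1 : (d : ZMod p) - 1 ≠ 0 := by
    have := t.pow_ne_one (k := 1) (by norm_num) (by norm_num)
    rwa [pow_one, ← sub_ne_zero] at this
  have hs : a * (d - 1) ≠ 0 := _root_.mul_ne_zero ha hd1
  have hdet : (!![b, b; -a * d, a * (d - 1 - d ^ 2)] :
      Matrix (Fin 2) (Fin 2) (ZMod p)).det ≠ 0 := by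
    rw [Matrix.det_fin_two_of, show b * (a * (d - 1 - d ^ 2)) - b * (-a * d) =
      -(b * a * (d - 1) ^ 2) by ring]
    exact neg_ne_zero.2 (_root_.mul_ne_zero (_root_.mul_ne_zero hb ha) (pow_ne_zero 2 hd1))
  rw [orderOf_mk_of_mul_eq (P := mkOfDetNeZero _ hdet) (s := Units.mk0 _ hs)
    (t := Units.mk0 _ hs / d), div_div_cancel, t.order]
  refine Units.ext ?_
  rw [Units.val_mul, h.val_mul, Units.val_mul]
  change _ * !![b, b; -a * d, a * (d - 1 - d ^ 2)] = !![b, b; -a * d, a * (d - 1 - d ^ 2)] *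
    !![a * (d - 1), 0; 0, ((Units.mk0 _ hs / d : (ZMod p)ˣ) : ZMod p)]
  rw [Units.val_div_eq_div_val, Units.val_mk0]
  simp only [mul_fin_two]
  clear hs hdet
  refine congrArg Matrix.of (congrArg₂ (fun u v => ![u, v])
    (congrArg₂ (fun u v => ![u, v]) ?_ ?_) (congrArg₂ (fun u v => ![u, v]) ?_ ?_))
  · field_simp
    ring
  · field_simp
    ring
  · field_simp
    linear_combination hbc
  · field_simp
    linear_combination (d : ZMod p) * hbc

/-- The two elements needed for `L2_le_of_diag` are `Y`, of order `2n ≥ 6`, and `(X Y)²`, whose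
off-diagonal entries are non-zero because `d² ≠ 1`. -/
lemma le_closure (h : IsPair d a b c X Y) (t : UnitOfOrder p n d) :
    L2 p ≤ Subgroup.closure {Matrix.ProjGenLinGroup.mk Y,
      Matrix.ProjGenLinGroup.mk (X * Y)⁻¹ ^ 2} := by
  have hd := d.ne_zero
  have ha := h.ne_zero
  have hbc := mul_eq ha h.eq_one
  have hb : b ≠ 0 := left_ne_zero_of_mul (t.mul_ne_zero ha h.eq_one)
  have hc : c ≠ 0 := right_ne_zero_of_mul (t.mul_ne_zero ha h.eq_one)
  have hd2 := t.pow_ne_one (k := 2) (by norm_num) (by norm_num)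
  have hd4 := t.pow_ne_one (k := 4) (by norm_num) (by norm_num)
  have hval : ((X * Y) ^ 2).val =
      !![a * d, b * (d : ZMod p)⁻¹; c * d, -a * (d : ZMod p)⁻¹] *
        !![a * d, b * (d : ZMod p)⁻¹; c * d, -a * (d : ZMod p)⁻¹] := by
    rw [sq, Units.val_mul, h.val_mul]
  rw [mul_fin_two] at hval
  have hM : Matrix.ProjGenLinGroup.mk ((X * Y) ^ 2) ∈ Subgroup.closure
      {Matrix.ProjGenLinGroup.mk Y, Matrix.ProjGenLinGroup.mk (X * Y)⁻¹ ^ 2} := by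
    have : Matrix.ProjGenLinGroup.mk ((X * Y) ^ 2) =
        (Matrix.ProjGenLinGroup.mk (X * Y)⁻¹ ^ 2)⁻¹ := by
      rw [map_pow, map_inv, inv_pow, inv_inv]
    rw [this]
    exact inv_mem (Subgroup.subset_closure (Or.inr rfl))
  refine L2_le_of_diag t.ne_two h.hY (Subgroup.subset_closure (Or.inl rfl)) hM ?_ hd2 ?_ ?_ ?_
  · rw [t.orderOf_diag h.hY]
    have := t.three_le
    omega
  · rw [hval]
    simp only [of_apply, cons_val', cons_val_zero, cons_val_one]
    intro h0
    have h1 : a * b * ((d : ZMod p) ^ 2 - 1) = 0 := by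
      field_simp at h0
      grind
    exact _root_.mul_ne_zero (_root_.mul_ne_zero ha hb) (sub_ne_zero.2 hd2) h1
  · rw [hval]
    simp only [of_apply, cons_val', cons_val_zero, cons_val_one]
    intro h0
    have h1 : a * c * ((d : ZMod p) ^ 2 - 1) = 0 := by
      field_simp at h0
      grind
    exact _root_.mul_ne_zero (_root_.mul_ne_zero ha hc) (sub_ne_zero.2 hd2) h1
  · rw [hval]
    simp only [of_apply, cons_val', cons_val_zero, cons_val_one]
    intro h0
    -- By the relation the entry `bc + a² / d²` equals `a² (1 - d) (1 + d²) / d²`; the extra factor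
    -- `1 + d` turns this into `1 - d⁴`.
    have h1 : a ^ 2 * (1 - (d : ZMod p) ^ 4) = 0 := by
      field_simp at h0
      linear_combination (1 + (d : ZMod p)) * h0 - (d + (d : ZMod p) ^ 2) * hbc
    exact _root_.mul_ne_zero (pow_ne_zero 2 ha) (sub_ne_zero.2 hd4.symm) h1

/-- The generating triple. -/
lemma generatingTriple (h : IsPair d a b c X Y) (t : UnitOfOrder p n d) :
    GeneratingTriple (L2 p) n (Matrix.ProjGenLinGroup.mk X) (Matrix.ProjGenLinGroup.mk Y)
      (Matrix.ProjGenLinGroup.mk (X * Y)⁻¹) where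
  index := index_L2 t.ne_two
  order_x := orderOf_involution t.ne_two h.hX
  order_y := t.orderOf_diag h.hY
  order_z := by rw [map_inv, orderOf_inv, h.orderOf_mul t]
  mul_eq_one := by rw [← map_mul, ← map_mul, mul_inv_cancel, map_one]
  x_notMem := t.mk_notMem_L2 h.hX (t.not_isSquare_disc h.ne_zero h.eq_one)
  y_mem := diag_mem_L2 h.hY
  closure_eq := by
    have hsq : ∀ g : PGL(2, ZMod p), g ^ 2 ∈ L2 p := fun g => by
      rw [sq, Subgroup.mul_mem_iff_of_index_two (index_L2 t.ne_two)]
    -- Since `L2 p` is generated by squares, it is enough to have squares of elements of the group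
    -- generated by `y` and `z²` in the smaller closure.
    refine le_antisymm ((Subgroup.closure_le _).2 ?_)
      (L2_le_of_sq t.ne_two fun g hg => sq_mem_closure ?_ (h.le_closure t hg))
    · rintro g (rfl | rfl | rfl)
      · exact hsq _
      · exact hsq _
      · exact (Subgroup.normal_of_index_eq_two (index_L2 t.ne_two)).conj_mem _ (hsq _) _
    · rw [← map_mul, show Y * (X * Y)⁻¹ = X⁻¹ by group, map_inv, inv_pow, inv_eq_one,
        ← orderOf_dvd_iff_pow_eq_one, orderOf_involution t.ne_two h.hX]

lemma closure_eq (h : IsPair d a b c X Y) (t : UnitOfOrder p n d) :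
    Subgroup.closure {Matrix.ProjGenLinGroup.mk Y, Matrix.ProjGenLinGroup.mk (X * Y)⁻¹ ^ 2} =
      L2 p := by
  refine le_antisymm ((Subgroup.closure_le _).2 ?_) (h.le_closure t)
  rintro g (rfl | rfl)
  · exact diag_mem_L2 h.hY
  · exact (h.generatingTriple t).sq_mem _

lemma closure_eq_top (h : IsPair d a b c X Y) (t : UnitOfOrder p n d) :
    Subgroup.closure {Matrix.ProjGenLinGroup.mk Y, Matrix.ProjGenLinGroup.mk (X * Y)⁻¹} = ⊤ := by
  have hz := Subgroup.subset_closure (k := {Matrix.ProjGenLinGroup.mk Y,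
    Matrix.ProjGenLinGroup.mk (X * Y)⁻¹}) (Or.inr rfl)
  refine (h.generatingTriple t).eq_top_of_le ?_ (h.generatingTriple t).z_notMem hz
  rw [← h.closure_eq t, Subgroup.closure_le]
  rintro g (rfl | rfl)
  · exact Subgroup.subset_closure (Or.inl rfl)
  · exact pow_mem hz 2

end IsPair

end UnitOfOrder

end

theorem mainTheorem10 (n : ℕ) (hn : 3 ≤ n) :
    -- there are infinitely many primes of the required form
    {p : ℕ | p.Prime ∧ p ≡ 4 * n + 1 [MOD 8 * n]}.Infinite ∧
    ∀ (p : ℕ) [Fact p.Prime], p ≡ 4 * n + 1 [MOD 8 * n] →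
      -- `L₂(p)` is the unique subgroup of index two of `PGL₂(p)`
      (∀ H : Subgroup PGL(2, ZMod p), H.index = 2 ↔ H = L2 p) ∧
      (∃ d : (ZMod p)ˣ, orderOf d = 4 * n) ∧
      ∀ d : (ZMod p)ˣ, orderOf d = 4 * n →
        -- arbitrary `X` of trace zero
        (∀ (a b c : ZMod p) (X Y : GL (Fin 2) (ZMod p)),
          (X : Matrix (Fin 2) (Fin 2) (ZMod p)) = !![a, b; c, -a] →
          (Y : Matrix (Fin 2) (Fin 2) (ZMod p)) = !![(d : ZMod p), 0; 0, (d : ZMod p)⁻¹] →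
          orderOf (Matrix.ProjGenLinGroup.mk X) = 2 ∧
          orderOf (Matrix.ProjGenLinGroup.mk Y) = 2 * n ∧
          Matrix.ProjGenLinGroup.mk Y ∈ L2 p ∧
          (¬ IsSquare (a ^ 2 + b * c) → Matrix.ProjGenLinGroup.mk X ∉ L2 p)) ∧
        -- the choice of `X` is possible, and every such choice gives a generating triple
        (∃ a b c : ZMod p, a ≠ 0 ∧ (a ^ 2)⁻¹ * (b * c) + d + (d : ZMod p)⁻¹ = 1) ∧
        ∀ a b c : ZMod p, a ≠ 0 → (a ^ 2)⁻¹ * (b * c) + d + (d : ZMod p)⁻¹ = 1 →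
          b * c ≠ 0 ∧ ¬ IsSquare (a ^ 2 + b * c) ∧
          ∃ X Y : GL (Fin 2) (ZMod p),
            (X : Matrix (Fin 2) (Fin 2) (ZMod p)) = !![a, b; c, -a] ∧
            (Y : Matrix (Fin 2) (Fin 2) (ZMod p)) = !![(d : ZMod p), 0; 0, (d : ZMod p)⁻¹] ∧
            ∃ x y z : PGL(2, ZMod p),
              x = Matrix.ProjGenLinGroup.mk X ∧ y = Matrix.ProjGenLinGroup.mk Y ∧
              z = Matrix.ProjGenLinGroup.mk (X * Y)⁻¹ ∧
              orderOf x = 2 ∧ orderOf y = 2 * n ∧ orderOf z = 4 * n ∧ x * y * z = 1 ∧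
              x ∉ L2 p ∧ y ∈ L2 p ∧
              Subgroup.closure {y, z ^ 2} = L2 p ∧ Subgroup.closure {y, z} = ⊤ ∧
              -- the epimorphism from the triangle group, and its kernel
              ∃ θ : TriangleGroup 2 (2 * n) (4 * n) →* PGL(2, ZMod p),
                θ TriangleGroup.u = x ∧ θ TriangleGroup.v = y ∧
                θ TriangleGroup.w = z ∧ Function.Surjective θ ∧
                θ.ker ≤ TriangleGroup.Delta1 ∧
                TriangleGroup.Delta0 ⊓ θ.ker = TriangleGroup.Delta2 ⊓ θ.ker ∧
                -- the two regular dessins `ℋ₁` and `ℋ₂` given by `K = Δ₂ ∩ ker θ`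
                ∃ (ℋ₁ : Hypermap (TriangleGroup.Delta1 ⧸
                    (TriangleGroup.Delta2 ⊓ θ.ker).subgroupOf (TriangleGroup.Delta1)))
                  (ℋ₂ : Hypermap (TriangleGroup.Delta2 ⧸
                    (TriangleGroup.Delta2 ⊓ θ.ker).subgroupOf (TriangleGroup.Delta2))),
                  TriangleGroup.Delta2 ⊓ θ.ker ≤ TriangleGroup.Delta1 ∧
                  ℋ₁.IsGivenBy (TriangleGroup.u * TriangleGroup.v *
                    TriangleGroup.u⁻¹) TriangleGroup.v ∧
                  ℋ₂.IsGivenBy (TriangleGroup.v ^ 2) TriangleGroup.w ∧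
                  ℋ₁.IsRegular ∧ ℋ₂.IsRegular ∧
                  ℋ₁.HasType (2 * n) (2 * n) (2 * n) ∧ ℋ₂.HasType n (4 * n) (4 * n) ∧
                  Nonempty (ℋ₁.Aut ≃* PSL(2, ZMod p) × Multiplicative (ZMod 2)) ∧
                  Nonempty (ℋ₂.Aut ≃* PGL(2, ZMod p)) ∧
                  IsEmpty (ℋ₁.Aut ≃* ℋ₂.Aut) ∧
                  (n = 3 → p = 13 → ℋ₁.HasGenus 547 ∧ ℋ₂.HasGenus 547) ∧
                  -- both dessins lie on one and the same compact Riemann surface `S`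
                  ∃ (S : Type) (_ : TopologicalSpace S) (_ : ChartedSpace ℂ S)
                    (β₁ β₂ : S → OnePoint ℂ),
                    IsCompactRiemannSurface S ∧ IsDessinOn β₁ ℋ₁ ∧ IsDessinOn β₂ ℋ₂ := by
  refine ⟨infinite_primes hn, fun p _ hp => ?_⟩
  obtain ⟨d₀, hd₀⟩ := exists_unit_order hn hp
  have h2 : p ≠ 2 := (UnitOfOrder.mk hn hp hd₀).ne_two
  refine ⟨PGLTwo.index_eq_two_iff h2, ⟨d₀, hd₀⟩, fun d hd => ?_⟩
  have t : UnitOfOrder p n d := ⟨hn, hp, hd⟩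
  refine ⟨fun a b c X Y hX hY => ⟨UnitOfOrder.orderOf_involution h2 hX, t.orderOf_diag hY,
    UnitOfOrder.diag_mem_L2 hY, t.mk_notMem_L2 hX⟩, UnitOfOrder.exists_abc, fun a b c ha h => ?_⟩
  have hsq := t.not_isSquare_disc ha h
  refine ⟨t.mul_ne_zero ha h, hsq, ?_⟩
  have hdet : (!![a, b; c, -a] : Matrix (Fin 2) (Fin 2) (ZMod p)).det ≠ 0 := by
    rw [Matrix.det_fin_two_of]
    intro h0
    -- The determinant is `-(a² + bc)`; if it vanished, `a² + bc = 0` would be a square.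
    exact hsq ⟨0, by linear_combination -h0⟩
  have hdet' : (!![(d : ZMod p), 0; 0, (d : ZMod p)⁻¹] :
      Matrix (Fin 2) (Fin 2) (ZMod p)).det ≠ 0 := by
    rw [Matrix.det_fin_two_of, mul_inv_cancel₀ d.ne_zero, mul_zero, sub_zero]
    exact one_ne_zero
  let X := Matrix.GeneralLinearGroup.mkOfDetNeZero _ hdet
  let Y := Matrix.GeneralLinearGroup.mkOfDetNeZero _ hdet'
  have pair : UnitOfOrder.IsPair d a b c X Y := ⟨ha, h, rfl, rfl⟩
  have T := pair.generatingTriple t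
  refine ⟨X, Y, rfl, rfl, _, _, _, rfl, rfl, rfl, T.order_x, T.order_y, T.order_z, T.mul_eq_one,
    T.x_notMem, T.y_mem, pair.closure_eq t, pair.closure_eq_top t,
    T.hom, T.hom_u, T.hom_v, T.hom_w, T.hom_surjective, T.ker_le_delta1, T.delta0_inf_ker,
    T.hypermap1, T.hypermap2, inf_le_right.trans T.ker_le_delta1, T.isGivenBy1, T.isGivenBy2,
    Hypermap.isRegular_ofGroup _, Hypermap.isRegular_ofGroup _, T.hasType1, T.hasType2,
    ⟨T.autEquiv1.trans (PGLTwo.equivPSL.prodCongr (MulEquiv.refl _))⟩, ⟨T.autEquiv2⟩,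
    ⟨fun e => PGLTwo.isEmpty_mulEquiv.false ((T.autEquiv1.symm.trans e).trans T.autEquiv2)⟩,
    fun h3 h13 => ?_, T.exists_surface⟩
  -- For `p = 13` the order is determined by `N * 12 = 168 * 156`.
  have hG : Nat.card PGL(2, ZMod p) = 2184 := by
    have := PGLTwo.card_PGL_mul (p := p)
    generalize Nat.card PGL(2, ZMod p) = N at this ⊢
    subst h13
    omega
  exact ⟨T.hasGenus1 h3 hG, T.hasGenus2 h3 hG⟩
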